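/- **Setting.** Let $\mathcal X,\mathcal Y$ be standard Borel spaces, $\mathcal X\ne\emptyset$, and let $(X,Y)$ be a random pair in $\mathcal X\times\mathcal Y$. Let $\Delta:\mathcal X\times\mathcal X\to[0,\infty]$ be a measurable distortion and let $d$ be a divergence: $d(p,q)\in[0,\infty]$ for probability measures $p,q$ on $\mathcal X$, and $d(p,q)=0$ if and only if $p=q$. Logarithms have base $2$, and information and code lengths are measured in bits. For $D,P\in[0,\infty]$ let $$R_C^I(D,P)=\inf_{p_{\hat X|X,Y}} I(X;\hat X|Y)\quad\text{subject to}\quad \mathbb E[\Delta(X,\hat X)|Y]\le D,\qquad d(p_{X|Y},p_{\hat X|Y})\le P,$$ with $\inf\emptyset=\infty$. Throughout, a constraint on a quantity that depends on $Y$ is understood in one of two senses, the same one everywhere: (a) for almost every value $y$ of $Y$; (b) on average over $Y$ (as an upper integral, if the quantity is not measurable in $y$). The theorem holds for either sense. A *codec with shared randomness* with message set $\mathcal M$ has a variable $W$, uniform on $[0,1]$ and independent of $(X,Y)$, a measurable encoder $M=f(X,Y,W)\in\mathcal M$ and a measurable decoder $\hat X=g(M,Y,W)\in\mathcal X$. It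 is *variable-length* if $\mathcal M$ is the set of finite binary strings and, for all values $y,w$ of $Y,W$, the codewords $\{f(x,y,w):x\in\mathcal X\}$ form a uniquely decodable code; its rate is then the expected length of $M$. For blocks, $(X_i,Y_i)$, $i=1,\dots,n$, are i.i.d. copies of $(X,Y)$, and a codec for $(X^n,Y^n)$ produces $\hat X^n$. **Theorem.** 1. (Monotonicity and convexity) $R_C^I(D,P)$ is non-increasing in $D$ and in $P$. If $d$ is convex in its second argument, then $R_C^I$ is jointly convex in $(D,P)$. 2. (One-shot achievability) If $R_C^I(D,P)<\infty$ and $R^0>R_C^I(D,P)+\log(R_C^I(D,P)+1)+5$, there is a variable-length codec with shared randomness, of rate at most $R^0$, with $\mathbb E[\Delta(X,\hat X)|Y]\le D$ and $d(p_{X|Y},p_{\hat X|Y})\le P$. 3. (Asymptotic achievability and converse) - Let $R_C^I(D,P)<R<\infty$. For all sufficiently large $n$ there is a variable-length codec with shared randomness for $(X^n,Y^n)$, of expected length at most $nR$, such that for every $i\le n$ one has $\mathbb E[\Delta(X_i,\hat X_i)|Y_i]\le D$ and $d(p_{X_i|Y_i},p_{\hat X_i|Y_i})\le P$, and also $\mathbb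 E[\Delta(X_i,\hat X_i)|Y^n]\le D$ and $d(p_{X_i|Y^n},p_{\hat X_i|Y^n})\le P$. - Let $R_C^I(D,P)<R<\infty$ and $\varepsilon>0$, let $\Delta$ be bounded and, in sense (a), let $\mathcal Y$ be finite. For all sufficiently large $n$ there is a fixed-length codec with shared randomness for $(X^n,Y^n)$, with at most $2^{nR}$ messages, such that $\mathbb E[\Delta(X_i,\hat X_i)|Y_i]\le D+\varepsilon$ and $d(p_{X_i|Y_i},p_{\hat X_i|Y_i})\le P$ for every $i\le n$. - Let $d$ be convex in its second argument and $n\ge1$. For every codec with shared randomness for $(X^n,Y^n)$ with $\frac1n\sum_i\mathbb E[\Delta(X_i,\hat X_i)|Y_i=\cdot\,]\le D$ and $\frac1n\sum_i d(p_{X_i|Y_i=\cdot},p_{\hat X_i|Y_i=\cdot})\le P$: if it is fixed-length with $m$ messages, then $\frac1n\log m\ge R_C^I(D,P)$; if it is variable-length, then its expected length is at least $nR_C^I(D,P)$. 4. For every random triple $(X,\hat X,Y)$ with $X,\hat X\in\mathcal X$ and $Y\in\mathcal Y$: if $d(p_{X|Y},p_{\hat X|Y})=0$ (that is, $\le 0$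 in the chosen sense), then $p_X=p_{\hat X}$, so $d(p_X,p_{\hat X})=0$. Now let $\mathcal X=\mathbb R^k$ with $\Delta(x,\hat x)=\|x-\hat x\|^2$, and let $D\in[0,\infty]$. A *one-shot codec* is now one without shared randomness: a conditional law $p_{M|X,Y}$ of a finite binary string $M$, drawn for each value $y$ of $Y$ from a uniquely decodable code, and a conditional law $p_{\hat X|M,Y}$ (given $(M,Y)$, $\hat X$ is independent of $X$); its rate is the expected length of $M$. It is *optimal* for $(D,P)$ if it satisfies $\mathbb E[\Delta(X,\hat X)|Y]\le D$ and $d(p_{X|Y},p_{\hat X|Y})\le P$ and no one-shot codec satisfying them has a smaller rate. 5. $R_C^I(D,0)\le R_C^I(\tfrac12D,\infty)$. 6. For every one-shot codec with code $M$ and $\mathbb E[\|X-\hat X\|^2|Y]\le D/2$ there is a decoder for the same encoder whose reconstruction $\tilde X$ satisfies $p_{\tilde X|M,Y}=p_{X|M,Y}$, $d(p_{X|Y},p_{\tilde X|Y})=0$ and $\mathbb E[\|X-\tilde X\|^2|Y]\le D$. If the given codec is optimal for $(D/2,\infty)$, then the codec with the new decoder is optimal for $(D,0)$. -/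

import Mathlib

open MeasureTheory ProbabilityTheory InformationTheory
open scoped ENNReal NNReal unitInterval

namespace RDCP

/-- Codewords are finite binary strings; every set of them is measurable. -/
instance instMeasurableSpaceListBool : MeasurableSpace (List Bool) := ⊤

instance instDiscreteMeasurableSpaceListBool : DiscreteMeasurableSpace (List Bool) :=
  ⟨fun _ => trivial⟩

/-- A divergence `d(p, q)`: a `[0, ∞]`-valued function that vanishes, on probability measures,
exactly on the diagonal. -/
def IsDivergence {𝒳 : Type*} [MeasurableSpace 𝒳] (d : Measure 𝒳 → Measure 𝒳 → ℝ≥0∞) : Prop :=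
  ∀ (p q : Measure 𝒳) [IsProbabilityMeasure p] [IsProbabilityMeasure q], d p q = 0 ↔ p = q

/-- `d` is convex in its second argument, over the probability measures. -/
def ConvexInSecond {𝒳 : Type*} [MeasurableSpace 𝒳] (d : Measure 𝒳 → Measure 𝒳 → ℝ≥0∞) : Prop :=
  ∀ (p : Measure 𝒳) [IsProbabilityMeasure p],
    ConvexOn ℝ≥0 {q : Measure 𝒳 | IsProbabilityMeasure q} (d p)

/-- The two customary meanings of an inequality `F(Y) ≤ c` between a quantity conditional on `Y`
and a constant: almost surely, or on average over `Y`. -/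
inductive Sense
  | almostSure
  | average

/-- `F(Y) ≤ c`, where `Y` has law `ρ`. In the average sense this is `∫ F dρ ≤ c` for measurable
`F`; the measurable majorant `g` makes it an upper integral for a non-measurable `F`. -/
def Sense.AtMost {𝒴 : Type*} [MeasurableSpace 𝒴] (s : Sense) (ρ : Measure 𝒴)
    (F : 𝒴 → ℝ≥0∞) (c : ℝ≥0∞) : Prop :=
  match s with
  | .almostSure => ∀ᵐ y ∂ρ, F y ≤ c
  | .average => ∃ g : 𝒴 → ℝ≥0∞, Measurable g ∧ (∀ᵐ y ∂ρ, F y ≤ g y) ∧ ∫⁻ y, g y ∂ρ ≤ c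

section Triples

/-! A triple `(Y, X, X̂)` is given by its joint law `γ` on `𝒴 × 𝒳 × 𝒳`. Then `γ.fst` is the law of
`Y`, and `γ.condKernel` is the regular conditional law of `(X, X̂)` given `Y`. -/

variable {𝒴 𝒳 : Type*} [MeasurableSpace 𝒴] [MeasurableSpace 𝒳] [StandardBorelSpace 𝒳] [Nonempty 𝒳]

/-- `p_{X|Y}`. -/
noncomputable def sourceGiven (γ : Measure (𝒴 × 𝒳 × 𝒳)) [IsFiniteMeasure γ] : Kernel 𝒴 𝒳 :=
  γ.condKernel.fst

/-- `p_{X̂|Y}`. -/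
noncomputable def reconGiven (γ : Measure (𝒴 × 𝒳 × 𝒳)) [IsFiniteMeasure γ] : Kernel 𝒴 𝒳 :=
  γ.condKernel.snd

/-- `E[Δ(X, X̂) | Y = y]`. -/
noncomputable def condDistortion (Δ : 𝒳 → 𝒳 → ℝ≥0∞) (γ : Measure (𝒴 × 𝒳 × 𝒳))
    [IsFiniteMeasure γ] (y : 𝒴) : ℝ≥0∞ :=
  ∫⁻ p, Δ p.1 p.2 ∂(γ.condKernel y)

/-- `d(p_{X|Y=y}, p_{X̂|Y=y})`. -/
noncomputable def condPerception (d : Measure 𝒳 → Measure 𝒳 → ℝ≥0∞) (γ : Measure (𝒴 × 𝒳 × 𝒳))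
    [IsFiniteMeasure γ] (y : 𝒴) : ℝ≥0∞ :=
  d (sourceGiven γ y) (reconGiven γ y)

/-- The conditional mutual information `I(X; X̂ | Y)` in bits: the Kullback-Leibler divergence of
the joint law from the law with the same marginals of `(Y, X)` and `(Y, X̂)` under which `X` and
`X̂` are conditionally independent given `Y`. -/
noncomputable def condMutualInfo (γ : Measure (𝒴 × 𝒳 × 𝒳)) [IsFiniteMeasure γ] : ℝ≥0∞ :=
  klDiv γ (γ.fst ⊗ₘ (sourceGiven γ ×ₖ reconGiven γ)) / ENNReal.ofReal (Real.log 2)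

/-- The constraints `E[Δ(X, X̂) | Y] ≤ D` and `d(p_{X|Y}, p_{X̂|Y}) ≤ P`. -/
def Meets (s : Sense) (Δ : 𝒳 → 𝒳 → ℝ≥0∞) (d : Measure 𝒳 → Measure 𝒳 → ℝ≥0∞) (D P : ℝ≥0∞)
    (γ : Measure (𝒴 × 𝒳 × 𝒳)) [IsFiniteMeasure γ] : Prop :=
  s.AtMost γ.fst (condDistortion Δ γ) D ∧ s.AtMost γ.fst (condPerception d γ) P

/-- The law of `(Y, X, X̂)` when `(Y, X)` has law `μ` and `X̂` is drawn from `p_{X̂|X,Y} = κ`. -/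
noncomputable def tripleLaw (μ : Measure (𝒴 × 𝒳)) (κ : Kernel (𝒴 × 𝒳) 𝒳) :
    Measure (𝒴 × 𝒳 × 𝒳) :=
  (μ ⊗ₘ κ).map fun t => (t.1.1, t.1.2, t.2)

instance instIsFiniteMeasureTripleLaw (μ : Measure (𝒴 × 𝒳)) [IsFiniteMeasure μ]
    (κ : Kernel (𝒴 × 𝒳) 𝒳) [IsFiniteKernel κ] : IsFiniteMeasure (tripleLaw μ κ) := by
  unfold tripleLaw; infer_instance

/-- The rate-distortion-conditional-perception function `R_C^I(D, P)` in bits; it is `∞` if no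
channel meets the constraints. -/
noncomputable def rdcpFunction (s : Sense) (Δ : 𝒳 → 𝒳 → ℝ≥0∞)
    (d : Measure 𝒳 → Measure 𝒳 → ℝ≥0∞) (μ : Measure (𝒴 × 𝒳)) [IsFiniteMeasure μ]
    (D P : ℝ≥0∞) : ℝ≥0∞ :=
  ⨅ (κ : Kernel (𝒴 × 𝒳) 𝒳) (_ : IsMarkovKernel κ) (_ : Meets s Δ d D P (tripleLaw μ κ)),
    condMutualInfo (tripleLaw μ κ)

end Triples

/-- A codec whose encoder and decoder both know `Y` and share unlimited randomness: a variable `W`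
uniform on `[0, 1]` and independent of `(Y, X)`. The code is `M = enc ((Y, X), W)` in the message
set `𝓜`, the reconstruction is `X̂ = dec ((Y, M), W)`. Private randomness of either side can be
taken from `W`. -/
structure SharedCodec (𝒴 𝒳 𝓜 : Type*) [MeasurableSpace 𝒴] [MeasurableSpace 𝒳]
    [MeasurableSpace 𝓜] where
  enc : (𝒴 × 𝒳) × I → 𝓜
  dec : (𝒴 × 𝓜) × I → 𝒳
  measurable_enc : Measurable enc
  measurable_dec : Measurable dec

namespace SharedCodec

variable {𝒴 𝒳 𝓜 : Type*} [MeasurableSpace 𝒴] [MeasurableSpace 𝒳] [MeasurableSpace 𝓜]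

/-- The law of `(Y, X, X̂)`. -/
noncomputable def law (c : SharedCodec 𝒴 𝒳 𝓜) (μ : Measure (𝒴 × 𝒳)) : Measure (𝒴 × 𝒳 × 𝒳) :=
  (μ.prod (volume : Measure I)).map fun t => (t.1.1, t.1.2, c.dec ((t.1.1, c.enc t), t.2))

instance instIsFiniteMeasureLaw (c : SharedCodec 𝒴 𝒳 𝓜) (μ : Measure (𝒴 × 𝒳))
    [IsFiniteMeasure μ] : IsFiniteMeasure (c.law μ) := by
  unfold law; infer_instance

/-- For given `Y` and `W`, the binary codewords in use form a uniquely decodable code. -/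
def IsUniquelyDecodable (c : SharedCodec 𝒴 𝒳 (List Bool)) : Prop :=
  ∀ (y : 𝒴) (w : I), UniquelyDecodable (Set.range fun x => c.enc ((y, x), w))

/-- The expected code length. -/
noncomputable def rate (c : SharedCodec 𝒴 𝒳 (List Bool)) (μ : Measure (𝒴 × 𝒳)) : ℝ≥0∞ :=
  ∫⁻ t, ((c.enc t).length : ℝ≥0∞) ∂(μ.prod (volume : Measure I))

end SharedCodec

section Blocks

variable {𝒴 𝒳 : Type*} [MeasurableSpace 𝒴] [MeasurableSpace 𝒳]

/-- The law of `(Y^n, X^n)` for `n` independent copies of `(Y, X)`. -/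
noncomputable def iidSource (μ : Measure (𝒴 × 𝒳)) (n : ℕ) :
    Measure ((Fin n → 𝒴) × (Fin n → 𝒳)) :=
  (Measure.pi fun _ : Fin n => μ).map fun p => (fun i => (p i).1, fun i => (p i).2)

instance instIsProbabilityMeasureIidSource (μ : Measure (𝒴 × 𝒳)) [IsProbabilityMeasure μ]
    (n : ℕ) : IsProbabilityMeasure (iidSource μ n) :=
  Measure.isProbabilityMeasure_map (Measurable.aemeasurable (by fun_prop))

/-- The law of `(Y_i, X_i, X̂_i)`, from the law of `(Y^n, X^n, X̂^n)`. -/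
noncomputable def letterLaw {n : ℕ} (γ : Measure ((Fin n → 𝒴) × (Fin n → 𝒳) × (Fin n → 𝒳)))
    (i : Fin n) : Measure (𝒴 × 𝒳 × 𝒳) :=
  γ.map fun t => (t.1 i, t.2.1 i, t.2.2 i)

instance instIsFiniteMeasureLetterLaw {n : ℕ}
    (γ : Measure ((Fin n → 𝒴) × (Fin n → 𝒳) × (Fin n → 𝒳))) [IsFiniteMeasure γ] (i : Fin n) :
    IsFiniteMeasure (letterLaw γ i) := by
  unfold letterLaw; infer_instance

/-- The law of `(Y^n, X_i, X̂_i)`: the `i`-th letter, with the side information of the block. -/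
noncomputable def letterBlockLaw {n : ℕ}
    (γ : Measure ((Fin n → 𝒴) × (Fin n → 𝒳) × (Fin n → 𝒳))) (i : Fin n) :
    Measure ((Fin n → 𝒴) × 𝒳 × 𝒳) :=
  γ.map fun t => (t.1, t.2.1 i, t.2.2 i)

instance instIsFiniteMeasureLetterBlockLaw {n : ℕ}
    (γ : Measure ((Fin n → 𝒴) × (Fin n → 𝒳) × (Fin n → 𝒳))) [IsFiniteMeasure γ] (i : Fin n) :
    IsFiniteMeasure (letterBlockLaw γ i) := by
  unfold letterBlockLaw; infer_instance

/-- The block constraints `(1/n) ∑ E[Δ(X_i, X̂_i) | Y_i] ≤ D` and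
`(1/n) ∑ d(p_{X_i|Y_i}, p_{X̂_i|Y_i}) ≤ P`; here `ρ` is the law of each `Y_i`. -/
def MeetsOnAverage [StandardBorelSpace 𝒳] [Nonempty 𝒳] (s : Sense) (Δ : 𝒳 → 𝒳 → ℝ≥0∞)
    (d : Measure 𝒳 → Measure 𝒳 → ℝ≥0∞) (D P : ℝ≥0∞) (ρ : Measure 𝒴) {n : ℕ}
    (γ : Measure ((Fin n → 𝒴) × (Fin n → 𝒳) × (Fin n → 𝒳))) [IsFiniteMeasure γ] : Prop :=
  s.AtMost ρ (fun y => (∑ i, condDistortion Δ (letterLaw γ i) y) / n) D ∧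
    s.AtMost ρ (fun y => (∑ i, condPerception d (letterLaw γ i) y) / n) P

end Blocks

/-- A one-shot codec without shared randomness, both sides knowing `Y`: `enc` is the conditional
law of the binary code `M` given `(Y, X)`, `dec` the conditional law of the reconstruction given
`(Y, M)`. For each value `y` of `Y` the codewords come from a uniquely decodable code. -/
structure OneShotCodec (𝒴 𝒳 : Type*) [MeasurableSpace 𝒴] [MeasurableSpace 𝒳] where
  enc : Kernel (𝒴 × 𝒳) (List Bool)
  dec : Kernel (𝒴 × List Bool) 𝒳
  isMarkovKernel_enc : IsMarkovKernel enc
  isMarkovKernel_dec : IsMarkovKernel dec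
  codebook : 𝒴 → Set (List Bool)
  uniquelyDecodable : ∀ y, UniquelyDecodable (codebook y)
  enc_mem : ∀ y x, ∀ᵐ m ∂(enc (y, x)), m ∈ codebook y

namespace OneShotCodec

variable {𝒴 𝒳 : Type*} [MeasurableSpace 𝒴] [MeasurableSpace 𝒳]

attribute [instance] OneShotCodec.isMarkovKernel_enc OneShotCodec.isMarkovKernel_dec

/-- The law of `(((Y, X), M), X̂)`. -/
noncomputable def fullLaw (c : OneShotCodec 𝒴 𝒳) (μ : Measure (𝒴 × 𝒳)) :
    Measure (((𝒴 × 𝒳) × List Bool) × 𝒳) :=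
  (μ ⊗ₘ c.enc) ⊗ₘ (c.dec.comap (fun t => (t.1.1, t.2)) (by fun_prop))

instance instIsFiniteMeasureFullLaw (c : OneShotCodec 𝒴 𝒳) (μ : Measure (𝒴 × 𝒳))
    [IsFiniteMeasure μ] : IsFiniteMeasure (c.fullLaw μ) := by
  unfold fullLaw; infer_instance

/-- The law of `(Y, X, X̂)`. -/
noncomputable def law (c : OneShotCodec 𝒴 𝒳) (μ : Measure (𝒴 × 𝒳)) : Measure (𝒴 × 𝒳 × 𝒳) :=
  (c.fullLaw μ).map fun t => (t.1.1.1, t.1.1.2, t.2)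

instance instIsFiniteMeasureLaw (c : OneShotCodec 𝒴 𝒳) (μ : Measure (𝒴 × 𝒳))
    [IsFiniteMeasure μ] : IsFiniteMeasure (c.law μ) := by
  unfold law; infer_instance

/-- The law of `((Y, M), X)`. -/
noncomputable def codeSourceLaw (c : OneShotCodec 𝒴 𝒳) (μ : Measure (𝒴 × 𝒳)) :
    Measure ((𝒴 × List Bool) × 𝒳) :=
  (c.fullLaw μ).map fun t => ((t.1.1.1, t.1.2), t.1.1.2)

instance instIsFiniteMeasureCodeSourceLaw (c : OneShotCodec 𝒴 𝒳) (μ : Measure (𝒴 × 𝒳))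
    [IsFiniteMeasure μ] : IsFiniteMeasure (c.codeSourceLaw μ) := by
  unfold codeSourceLaw; infer_instance

/-- The law of `((Y, M), X̂)`. -/
noncomputable def codeReconLaw (c : OneShotCodec 𝒴 𝒳) (μ : Measure (𝒴 × 𝒳)) :
    Measure ((𝒴 × List Bool) × 𝒳) :=
  (c.fullLaw μ).map fun t => ((t.1.1.1, t.1.2), t.2)

instance instIsFiniteMeasureCodeReconLaw (c : OneShotCodec 𝒴 𝒳) (μ : Measure (𝒴 × 𝒳))
    [IsFiniteMeasure μ] : IsFiniteMeasure (c.codeReconLaw μ) := by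
  unfold codeReconLaw; infer_instance

/-- The expected code length. -/
noncomputable def rate (c : OneShotCodec 𝒴 𝒳) (μ : Measure (𝒴 × 𝒳)) : ℝ≥0∞ :=
  ∫⁻ t, (t.2.length : ℝ≥0∞) ∂(μ ⊗ₘ c.enc)

/-- The codec meets the constraints `(D, P)`, and no codec that meets them has a smaller rate. -/
def IsOptimal [StandardBorelSpace 𝒳] [Nonempty 𝒳] (c : OneShotCodec 𝒴 𝒳) (s : Sense)
    (Δ : 𝒳 → 𝒳 → ℝ≥0∞) (d : Measure 𝒳 → Measure 𝒳 → ℝ≥0∞) (μ : Measure (𝒴 × 𝒳))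
    [IsFiniteMeasure μ] (D P : ℝ≥0∞) : Prop :=
  Meets s Δ d D P (c.law μ) ∧
    ∀ c' : OneShotCodec 𝒴 𝒳, Meets s Δ d D P (c'.law μ) → c.rate μ ≤ c'.rate μ

end OneShotCodec

/-- The squared error `‖x - x̂‖²`. -/
noncomputable def squaredError {k : ℕ} (x x' : EuclideanSpace ℝ (Fin k)) : ℝ≥0∞ :=
  ENNReal.ofReal (‖x - x'‖ ^ 2)

end RDCP

set_option linter.unusedSectionVars false

open MeasureTheory ProbabilityTheory InformationTheory
open scoped ENNReal NNReal unitInterval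

/-! Everything is expressed through the joint law γ of (Y, X, X̂). The laws with source marginal μ
are exactly those produced by channels, and I(X; X̂ | Y) is the divergence of γ from the law in
which X̂ is redrawn given Y alone. Since the source side is fixed, conditional laws mix with
constant weights; with joint convexity of the KL divergence this gives convexity of the rate
function (`convexOn_rdcpFunction`) and, later, the single-letter step of the converse.

Achievability is exact channel simulation. Both sides read the same independent proposals, of law
p_{X̂|Y}, off the shared randomness. Greedy rejection sampling accepts one of them so that the
triple has law γ exactly, and only the accepted index K (counted from 0) is sent. The bound i + 1 ≤
(1 + level) / residual turns E log (K + 1) into two Riemann sums, whence E log₂ (K + 1) ≤ I + 2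
(`tsum_share_mul_log_le`); a Rice code with a well-chosen parameter then needs at most I + log₂ (I +
1) + 5 bits. As the law is exact, so are the constraints. Simulating n independent copies has an
overhead of order log n. With fixed length, proposals from the k-th on are given up; after a failure
the decoder draws X̂ so as to restore the law of (Y, X̂), which keeps perception exact, and the law
of large numbers for the information density makes failure rare.

For the converse, give the messages in use weights exp (-ℓ) of sum at most one: uniform weights, or
those of the Kraft-McMillan inequality. A product of letterwise tests g, each of mean at most one
for every fixed reconstruction, then has weighted mean at most one (`lintegral_prod_mul_weight_le`).
By log t ≤ t - 1, n times the mean of log g under the average letter law is at most E ℓ; tests g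
close to the density with respect to the conditionally independent law give n times the information
(`mul_klDiv_meanLetterLaw_le`).

For squared error, two independent draws from a law differ by twice its variance in mean square. So
a draw from the posterior at most doubles the error of any decoder and gives (Y, X̂) the law of (Y,
X). Conversely, in a codec with perfect perception X and X̂ are independent given (Y, M) and have
the same law given Y. Decoding to the mean of X, or exchanging the roles of X and X̂ and decoding to
the mean of X̂, gives two codecs of equal rate whose errors add up to at most the original one; the
better one for each y has at most half of it (`exists_codec_half_distortion`). -/

namespace RDCP

/-! ### Calculus of the two senses of a constraint -/

section AtMost

variable {𝒴 𝒵 : Type*} [MeasurableSpace 𝒴] [MeasurableSpace 𝒵] {s : Sense} {ρ : Measure 𝒴}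
  {F G : 𝒴 → ℝ≥0∞} {b c : ℝ≥0∞}

lemma Sense.AtMost.mono (h : s.AtMost ρ F b) (hGF : ∀ᵐ y ∂ρ, G y ≤ F y) (hbc : b ≤ c) :
    s.AtMost ρ G c := by
  cases s with
  | almostSure =>
    filter_upwards [show ∀ᵐ y ∂ρ, F y ≤ b from h, hGF] with y h₁ h₂ using h₂.trans (h₁.trans hbc)
  | average =>
    obtain ⟨g, hg, hFg, hgb⟩ := h
    exact ⟨g, hg, by filter_upwards [hFg, hGF] with y h₁ h₂ using h₂.trans h₁, hgb.trans hbc⟩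

lemma Sense.AtMost.congr (h : s.AtMost ρ F c) (hGF : ∀ᵐ y ∂ρ, G y = F y) : s.AtMost ρ G c :=
  h.mono (hGF.mono fun _ hy => hy.le) le_rfl

lemma Sense.atMost_top : s.AtMost ρ F ∞ := by
  cases s with
  | almostSure => exact .of_forall fun _ => le_top
  | average => exact ⟨fun _ => ∞, measurable_const, .of_forall fun _ => le_top, le_top⟩

lemma Sense.AtMost.comp {τ : Measure 𝒵} {f : 𝒵 → 𝒴} (h : s.AtMost ρ F c)
    (hf : MeasurePreserving f τ ρ) : s.AtMost τ (fun z => F (f z)) c := by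
  cases s with
  | almostSure => exact hf.quasiMeasurePreserving.ae h
  | average =>
    obtain ⟨g, hg, hFg, hgc⟩ := h
    exact ⟨fun z => g (f z), hg.comp hf.measurable, hf.quasiMeasurePreserving.ae hFg,
      (hf.lintegral_comp hg).trans_le hgc⟩

lemma Sense.AtMost.const_mul (h : s.AtMost ρ F c) (a : ℝ≥0∞) :
    s.AtMost ρ (fun y => a * F y) (a * c) := by
  cases s with
  | almostSure => exact Filter.Eventually.mono h fun y hy => mul_le_mul_right hy a
  | average =>
    obtain ⟨g, hg, hFg, hgc⟩ := h
    exact ⟨fun y => a * g y, hg.const_mul a, hFg.mono fun y hy => mul_le_mul_right hy a,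
      (lintegral_const_mul a hg).trans_le (mul_le_mul_right hgc a)⟩

lemma Sense.AtMost.add (hF : s.AtMost ρ F b) (hG : s.AtMost ρ G c) :
    s.AtMost ρ (fun y => F y + G y) (b + c) := by
  cases s with
  | almostSure =>
    filter_upwards [show ∀ᵐ y ∂ρ, F y ≤ b from hF, show ∀ᵐ y ∂ρ, G y ≤ c from hG] with y h₁ h₂
      using add_le_add h₁ h₂
  | average =>
    obtain ⟨g, hg, hFg, hgb⟩ := hF
    obtain ⟨g', hg', hGg', hgc⟩ := hG
    refine ⟨fun y => g y + g' y, hg.add hg', ?_, (lintegral_add_left hg g').trans_le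
      (add_le_add hgb hgc)⟩
    filter_upwards [hFg, hGg'] with y h₁ h₂ using add_le_add h₁ h₂

lemma Sense.AtMost.ae_eq_zero (h : s.AtMost ρ F 0) : ∀ᵐ y ∂ρ, F y = 0 := by
  cases s with
  | almostSure => exact Filter.Eventually.mono h fun y hy => le_zero_iff.1 hy
  | average =>
    obtain ⟨g, hg, hFg, hgc⟩ := h
    have := (lintegral_eq_zero_iff hg).1 (le_zero_iff.1 hgc)
    filter_upwards [hFg, this] with y h₁ h₂
    exact le_zero_iff.1 (h₁.trans h₂.le)

lemma Sense.atMost_zero (h : ∀ᵐ y ∂ρ, F y = 0) : s.AtMost ρ F c := by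
  cases s with
  | almostSure => exact h.mono fun y hy => by simp [hy]
  | average => exact ⟨fun _ => 0, measurable_const, h.mono fun y hy => hy.le, by simp⟩

lemma Sense.AtMost.lintegral_le (h : Sense.average.AtMost ρ F c) : ∫⁻ y, F y ∂ρ ≤ c := by
  obtain ⟨g, -, hFg, hgc⟩ := h
  exact (lintegral_mono_ae hFg).trans hgc

end AtMost

/-! ### Conditional laws and the reference law of the mutual information -/

section Disintegration

variable {𝒴 𝒳 : Type*} [MeasurableSpace 𝒴] [MeasurableSpace 𝒳] [StandardBorelSpace 𝒳] [Nonempty 𝒳]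

instance instIsMarkovKernelSourceGiven (γ : Measure (𝒴 × 𝒳 × 𝒳)) [IsFiniteMeasure γ] :
    IsMarkovKernel (sourceGiven γ) := by
  unfold sourceGiven; infer_instance

instance instIsMarkovKernelReconGiven (γ : Measure (𝒴 × 𝒳 × 𝒳)) [IsFiniteMeasure γ] :
    IsMarkovKernel (reconGiven γ) := by
  unfold reconGiven; infer_instance

lemma compProd_map_right {α β δ : Type*} [MeasurableSpace α] [MeasurableSpace β]
    [MeasurableSpace δ] (ρ : Measure α) [SFinite ρ] (K : Kernel α β) [IsSFiniteKernel K] {f : β → δ}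
    (hf : Measurable f) : (ρ ⊗ₘ K).map (fun t => (t.1, f t.2)) = ρ ⊗ₘ K.map f := by
  ext A hA
  rw [Measure.map_apply (by fun_prop) hA, Measure.compProd_apply (by measurability),
    Measure.compProd_apply hA]
  refine lintegral_congr fun y => ?_
  rw [Kernel.map_apply' _ hf _ (measurable_prodMk_left hA)]
  rfl

lemma map_source (γ : Measure (𝒴 × 𝒳 × 𝒳)) [IsFiniteMeasure γ] :
    γ.map (fun t => (t.1, t.2.1)) = γ.fst ⊗ₘ sourceGiven γ := by
  conv_lhs => rw [← γ.disintegrate γ.condKernel]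
  rw [compProd_map_right _ _ measurable_fst, sourceGiven, Kernel.fst_eq]

lemma map_recon (γ : Measure (𝒴 × 𝒳 × 𝒳)) [IsFiniteMeasure γ] :
    γ.map (fun t => (t.1, t.2.2)) = γ.fst ⊗ₘ reconGiven γ := by
  conv_lhs => rw [← γ.disintegrate γ.condKernel]
  rw [compProd_map_right _ _ measurable_snd, reconGiven, Kernel.snd_eq]

lemma fst_map_prodMk {α β δ : Type*} [MeasurableSpace α] [MeasurableSpace β]
    [MeasurableSpace δ] (γ : Measure (α × β)) {f : α × β → δ} (hf : Measurable f) :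
    (γ.map fun t => (t.1, f t)).fst = γ.fst := by
  rw [Measure.fst, Measure.map_map measurable_fst (by fun_prop)]; rfl

lemma fst_eq_of_map_source {γ : Measure (𝒴 × 𝒳 × 𝒳)} {μ : Measure (𝒴 × 𝒳)}
    (h : γ.map (fun t => (t.1, t.2.1)) = μ) : γ.fst = μ.fst := by
  rw [← h, fst_map_prodMk γ (f := fun t => t.2.1) (by fun_prop)]

/-- Disintegrations are unique almost everywhere, so p_{X|Y} depends on γ only through the law of
(Y, X). -/
lemma sourceGiven_ae_eq {γ : Measure (𝒴 × 𝒳 × 𝒳)} [IsFiniteMeasure γ] {μ : Measure (𝒴 × 𝒳)}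
    [IsFiniteMeasure μ] (h : γ.map (fun t => (t.1, t.2.1)) = μ) :
    sourceGiven γ =ᵐ[μ.fst] μ.condKernel := by
  have h' := map_source γ
  rw [h, fst_eq_of_map_source h] at h'
  exact eq_condKernel_of_measure_eq_compProd _ h'

lemma reconGiven_ae_eq {γ : Measure (𝒴 × 𝒳 × 𝒳)} [IsFiniteMeasure γ] {τ : Measure (𝒴 × 𝒳)}
    [IsFiniteMeasure τ] (h : γ.map (fun t => (t.1, t.2.2)) = τ) :
    reconGiven γ =ᵐ[τ.fst] τ.condKernel := by
  have h' := map_recon γ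
  have h'' : γ.fst = τ.fst := by
    rw [← h, fst_map_prodMk γ (f := fun t => t.2.2) (by fun_prop)]
  rw [h, h''] at h'
  exact eq_condKernel_of_measure_eq_compProd _ h'

/-- Any explicit disintegration may replace the canonical one: the two agree almost everywhere, and
neither sense of a constraint sees null sets. -/
lemma meets_compProd_iff {ρ : Measure 𝒴} [IsFiniteMeasure ρ] {K : Kernel 𝒴 (𝒳 × 𝒳)}
    [IsMarkovKernel K] {γ : Measure (𝒴 × 𝒳 × 𝒳)} [IsFiniteMeasure γ] (hγ : γ = ρ ⊗ₘ K)
    {s : Sense} {Δ : 𝒳 → 𝒳 → ℝ≥0∞} {d : Measure 𝒳 → Measure 𝒳 → ℝ≥0∞} {D P : ℝ≥0∞} :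
    Meets s Δ d D P γ ↔ s.AtMost ρ (fun y => ∫⁻ p, Δ p.1 p.2 ∂K y) D ∧
      s.AtMost ρ (fun y => d ((K y).map Prod.fst) ((K y).map Prod.snd)) P := by
  subst hγ
  have h := condKernel_compProd ρ K
  rw [Meets, Measure.fst_compProd]
  have h₁ : ∀ᵐ y ∂ρ, condDistortion Δ (ρ ⊗ₘ K) y = ∫⁻ p, Δ p.1 p.2 ∂K y := by
    filter_upwards [h] with y hy
    rw [condDistortion, hy]
  have h₂ : ∀ᵐ y ∂ρ, condPerception d (ρ ⊗ₘ K) y = d ((K y).map Prod.fst) ((K y).map Prod.snd) := by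
    filter_upwards [h] with y hy
    rw [condPerception, sourceGiven, reconGiven, Kernel.fst_apply, Kernel.snd_apply, hy]
  exact ⟨fun H => ⟨H.1.congr (h₁.mono fun _ hy => hy.symm), H.2.congr (h₂.mono fun _ hy => hy.symm)⟩,
    fun H => ⟨H.1.congr h₁, H.2.congr h₂⟩⟩

/-- The law of `(Y, X, X̂)` with `(Y, X)` of law `μ`, and `X̂` drawn from `R` given `Y`. -/
noncomputable def indepLaw (μ : Measure (𝒴 × 𝒳)) (R : Kernel 𝒴 𝒳) : Measure (𝒴 × 𝒳 × 𝒳) :=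
  tripleLaw μ (R.prodMkRight 𝒳)

lemma lintegral_tripleLaw {μ : Measure (𝒴 × 𝒳)} [SFinite μ] {κ : Kernel (𝒴 × 𝒳) 𝒳}
    [IsSFiniteKernel κ] {f : 𝒴 × 𝒳 × 𝒳 → ℝ≥0∞} (hf : Measurable f) :
    ∫⁻ t, f t ∂(tripleLaw μ κ) = ∫⁻ p, ∫⁻ z, f (p.1, p.2, z) ∂κ p ∂μ := by
  rw [tripleLaw, lintegral_map hf (by fun_prop), Measure.lintegral_compProd (by fun_prop)]

lemma tripleLaw_apply {μ : Measure (𝒴 × 𝒳)} [SFinite μ] {κ : Kernel (𝒴 × 𝒳) 𝒳}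
    [IsSFiniteKernel κ] {A : Set (𝒴 × 𝒳 × 𝒳)} (hA : MeasurableSet A) :
    tripleLaw μ κ A = ∫⁻ p, κ p {z | (p.1, p.2, z) ∈ A} ∂μ := by
  rw [tripleLaw, Measure.map_apply (by fun_prop) hA, Measure.compProd_apply (by measurability)]
  rfl

instance instIsProbabilityMeasureTripleLaw (μ : Measure (𝒴 × 𝒳)) [IsProbabilityMeasure μ]
    (κ : Kernel (𝒴 × 𝒳) 𝒳) [IsMarkovKernel κ] : IsProbabilityMeasure (tripleLaw μ κ) :=
  Measure.isProbabilityMeasure_map (Measurable.aemeasurable (by fun_prop))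

lemma map_source_tripleLaw (μ : Measure (𝒴 × 𝒳)) [SFinite μ] (κ : Kernel (𝒴 × 𝒳) 𝒳)
    [IsMarkovKernel κ] : (tripleLaw μ κ).map (fun t => (t.1, t.2.1)) = μ := by
  rw [tripleLaw, Measure.map_map (by fun_prop) (by fun_prop)]
  conv_rhs => rw [← Measure.fst_compProd μ κ]
  rfl

/-- The channel is the conditional kernel of X̂ given (Y, X). Hence any joint law with the right
source marginal competes in the infimum. -/
lemma exists_eq_tripleLaw {γ : Measure (𝒴 × 𝒳 × 𝒳)} [IsFiniteMeasure γ] {μ : Measure (𝒴 × 𝒳)}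
    (h : γ.map (fun t => (t.1, t.2.1)) = μ) :
    ∃ κ : Kernel (𝒴 × 𝒳) 𝒳, IsMarkovKernel κ ∧ γ = tripleLaw μ κ := by
  let γ' : Measure ((𝒴 × 𝒳) × 𝒳) := γ.map fun t => ((t.1, t.2.1), t.2.2)
  have hfst : γ'.fst = μ := by
    rw [← h, Measure.fst, Measure.map_map measurable_fst (by fun_prop)]; rfl
  refine ⟨γ'.condKernel, inferInstance, ?_⟩
  rw [tripleLaw, ← hfst, γ'.disintegrate, Measure.map_map (by fun_prop) (by fun_prop)]
  exact Measure.map_id.symm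

/-- In this form the reference law depends on γ only through p_{X̂|Y}, and linearly so. -/
lemma refLaw_eq_indepLaw {γ : Measure (𝒴 × 𝒳 × 𝒳)} [IsFiniteMeasure γ] {μ : Measure (𝒴 × 𝒳)}
    [IsFiniteMeasure μ] (h : γ.map (fun t => (t.1, t.2.1)) = μ) :
    γ.fst ⊗ₘ (sourceGiven γ ×ₖ reconGiven γ) = indepLaw μ (reconGiven γ) := by
  subst h
  ext A hA
  rw [indepLaw, tripleLaw_apply hA, Measure.compProd_apply hA, map_source,
    Measure.lintegral_compProd]
  · refine lintegral_congr fun y => ?_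
    rw [Kernel.prod_apply, Measure.prod_apply (measurable_prodMk_left hA)]
    rfl
  · have : Measurable fun p : (𝒴 × 𝒳) =>
        (reconGiven γ).prodMkRight 𝒳 p (Prod.mk p ⁻¹' {q | (q.1.1, q.1.2, q.2) ∈ A}) :=
      Kernel.measurable_kernel_prodMk_left
        ((show Measurable fun q : (𝒴 × 𝒳) × 𝒳 => (q.1.1, q.1.2, q.2) by fun_prop) hA)
    exact this

lemma condMutualInfo_eq {γ : Measure (𝒴 × 𝒳 × 𝒳)} [IsFiniteMeasure γ] {μ : Measure (𝒴 × 𝒳)}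
    [IsFiniteMeasure μ] (h : γ.map (fun t => (t.1, t.2.1)) = μ) :
    condMutualInfo γ = klDiv γ (indepLaw μ (reconGiven γ)) / ENNReal.ofReal (Real.log 2) := by
  rw [condMutualInfo, refLaw_eq_indepLaw h]

lemma indepLaw_congr {μ : Measure (𝒴 × 𝒳)} [IsFiniteMeasure μ] {R R' : Kernel 𝒴 𝒳}
    [IsFiniteKernel R] [IsFiniteKernel R'] (h : R =ᵐ[μ.fst] R') : indepLaw μ R = indepLaw μ R' := by
  rw [indepLaw, indepLaw, tripleLaw, tripleLaw]
  congr 1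
  refine Measure.compProd_congr ?_
  have := ae_of_ae_map (μ := μ) (f := Prod.fst) measurable_fst.aemeasurable h
  filter_upwards [this] with p hp
  simpa using hp

variable {s : Sense} {Δ : 𝒳 → 𝒳 → ℝ≥0∞} {d : Measure 𝒳 → Measure 𝒳 → ℝ≥0∞}
  {μ : Measure (𝒴 × 𝒳)} [IsFiniteMeasure μ] {D P : ℝ≥0∞}

lemma rdcpFunction_le {γ : Measure (𝒴 × 𝒳 × 𝒳)} [IsFiniteMeasure γ]
    (h : γ.map (fun t => (t.1, t.2.1)) = μ) (hγ : Meets s Δ d D P γ) :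
    rdcpFunction s Δ d μ D P ≤ condMutualInfo γ := by
  obtain ⟨κ, hκ, rfl⟩ := exists_eq_tripleLaw h
  exact iInf_le_of_le κ (iInf_le_of_le hκ (iInf_le_of_le hγ le_rfl))

lemma exists_of_rdcpFunction_lt {R : ℝ≥0∞} (h : rdcpFunction s Δ d μ D P < R) :
    ∃ (κ : Kernel (𝒴 × 𝒳) 𝒳) (_ : IsMarkovKernel κ), Meets s Δ d D P (tripleLaw μ κ) ∧
      condMutualInfo (tripleLaw μ κ) < R := by
  simp only [rdcpFunction, iInf_lt_iff] at h
  obtain ⟨κ, hκ, hm, hlt⟩ := h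
  exact ⟨κ, hκ, hm, hlt⟩

lemma rdcpFunction_anti {D' P' : ℝ≥0∞} (hD : D ≤ D') (hP : P ≤ P') :
    rdcpFunction s Δ d μ D' P' ≤ rdcpFunction s Δ d μ D P :=
  le_iInf fun _ => le_iInf fun _ => le_iInf fun hm => rdcpFunction_le (map_source_tripleLaw _ _)
    ⟨hm.1.mono (.of_forall fun _ => le_rfl) hD, hm.2.mono (.of_forall fun _ => le_rfl) hP⟩

end Disintegration

/-! ### Joint convexity and additivity of the Kullback-Leibler divergence -/

section KullbackLeibler

variable {α β : Type*} [MeasurableSpace α] [MeasurableSpace β]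

/-- On the disjoint union of two copies of the space the divergences simply add. Folding the copies
together is a measurable map, so data processing gives the inequality. -/
lemma klDiv_add_le (μ₁ μ₂ ν₁ ν₂ : Measure α) [IsFiniteMeasure μ₁] [IsFiniteMeasure μ₂]
    [IsFiniteMeasure ν₁] [IsFiniteMeasure ν₂] :
    klDiv (μ₁ + μ₂) (ν₁ + ν₂) ≤ klDiv μ₁ ν₁ + klDiv μ₂ ν₂ := by
  by_cases h₁ : μ₁ ≪ ν₁
  swap; · simp [klDiv_of_not_ac h₁]
  by_cases h₂ : μ₂ ≪ ν₂
  swap; · simp [klDiv_of_not_ac h₂]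
  let ν : Measure (α ⊕ α) := ν₁.map Sum.inl + ν₂.map Sum.inr
  let f : α ⊕ α → ℝ≥0∞ := Sum.elim (μ₁.rnDeriv ν₁) (μ₂.rnDeriv ν₂)
  have hf : Measurable f := (Measure.measurable_rnDeriv _ _).sumElim (Measure.measurable_rnDeriv _ _)
  let μ : Measure (α ⊕ α) := ν.withDensity f
  have hμ : μ = μ₁.map Sum.inl + μ₂.map Sum.inr := by
    ext A hA
    simp only [μ, ν, withDensity_apply _ hA, Measure.restrict_add, lintegral_add_measure,
      Measure.add_apply]
    rw [setLIntegral_map hA hf measurable_inl, setLIntegral_map hA hf measurable_inr,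
      Measure.map_apply measurable_inl hA, Measure.map_apply measurable_inr hA]
    congr 1
    · exact Measure.setLIntegral_rnDeriv h₁ _
    · exact Measure.setLIntegral_rnDeriv h₂ _
  have : IsFiniteMeasure μ := by rw [hμ]; infer_instance
  have hkl : klDiv μ ν = klDiv μ₁ ν₁ + klDiv μ₂ ν₂ := by
    rw [klDiv_eq_lintegral_klFun_of_ac (withDensity_absolutelyContinuous _ _),
      klDiv_eq_lintegral_klFun_of_ac h₁, klDiv_eq_lintegral_klFun_of_ac h₂]
    calc ∫⁻ x, ENNReal.ofReal (klFun (μ.rnDeriv ν x).toReal) ∂ν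
        = ∫⁻ x, ENNReal.ofReal (klFun (f x).toReal) ∂ν := by
          refine lintegral_congr_ae ?_
          filter_upwards [Measure.rnDeriv_withDensity ν hf] with x hx using by rw [hx]
      _ = _ := by
          have hm : Measurable fun x => ENNReal.ofReal (klFun (f x).toReal) := by fun_prop
          rw [lintegral_add_measure, lintegral_map hm measurable_inl,
            lintegral_map hm measurable_inr]
          rfl
  have hg : Measurable (Sum.elim id id : α ⊕ α → α) := measurable_id.sumElim measurable_id
  have hmap : ∀ a b : Measure α,
      (a.map Sum.inl + b.map Sum.inr).map (Sum.elim id id : α ⊕ α → α) = a + b := fun a b => by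
    rw [Measure.map_add _ _ hg, Measure.map_map hg measurable_inl,
      Measure.map_map hg measurable_inr]
    simp
  rw [← hkl, ← hmap μ₁ μ₂, ← hmap ν₁ ν₂, ← hμ]
  exact klDiv_map_le _ _ hg

lemma klDiv_sum_smul_le {ι : Type*} (t : Finset ι) (w : ι → ℝ≥0) (μ ν : ι → Measure α)
    [∀ i, IsFiniteMeasure (μ i)] [∀ i, IsFiniteMeasure (ν i)] :
    klDiv (∑ i ∈ t, w i • μ i) (∑ i ∈ t, w i • ν i) ≤ ∑ i ∈ t, w i * klDiv (μ i) (ν i) := by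
  classical
  induction t using Finset.induction_on with
  | empty => simp
  | insert a t ha ih =>
    rw [Finset.sum_insert ha, Finset.sum_insert ha, Finset.sum_insert ha, ← klDiv_smul_same]
    exact (klDiv_add_le _ _ _ _).trans (by gcongr)

/-- The chain rule leaves the divergence of μ₁ × μ₂ from μ₁ × ν₂. Data processing along the swap, in
both directions, moves the common factor into the kernel, where it cancels. -/
lemma klDiv_prod_eq_add (μ₁ ν₁ : Measure α) (μ₂ ν₂ : Measure β) [IsProbabilityMeasure μ₁]
    [IsProbabilityMeasure ν₁] [IsProbabilityMeasure μ₂] [IsProbabilityMeasure ν₂] :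
    klDiv (μ₁.prod μ₂) (ν₁.prod ν₂) = klDiv μ₁ ν₁ + klDiv μ₂ ν₂ := by
  rw [← Measure.compProd_const, ← Measure.compProd_const, klDiv_compProd_eq_add,
    Measure.compProd_const, Measure.compProd_const]
  congr 1
  have key := klDiv_map_le (μ₂.prod μ₁) (ν₂.prod μ₁) measurable_swap
  have key' := klDiv_map_le (μ₁.prod μ₂) (μ₁.prod ν₂) measurable_swap
  rw [Measure.prod_swap, Measure.prod_swap] at key key'
  rw [le_antisymm key key', ← Measure.compProd_const,
    ← Measure.compProd_const, klDiv_compProd_left]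

lemma klDiv_pi_le (μ ν : Measure α) [IsProbabilityMeasure μ] [IsProbabilityMeasure ν] (n : ℕ) :
    klDiv (Measure.pi fun _ : Fin n => μ) (Measure.pi fun _ : Fin n => ν) ≤ n * klDiv μ ν := by
  induction n with
  | zero => rw [Measure.pi_of_empty, Measure.pi_of_empty, klDiv_self]; simp
  | succ n ih =>
    have h₁ := (measurePreserving_piFinSuccAbove (fun _ : Fin (n + 1) => μ) 0).symm
    have h₂ := (measurePreserving_piFinSuccAbove (fun _ : Fin (n + 1) => ν) 0).symm
    rw [← h₁.map_eq, ← h₂.map_eq]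
    refine (klDiv_map_le _ _ (MeasurableEquiv.measurable _)).trans ?_
    rw [klDiv_prod_eq_add, Nat.cast_add, Nat.cast_one, add_mul, one_mul, add_comm]
    gcongr

end KullbackLeibler

/-! ### Mixtures of triples and convexity of the rate function -/

section Mixtures

/-- Jensen's inequality: one term is split off and the others are renormalised by their total
weight. -/
lemma convexOn_map_sum_le {E ι : Type*} [AddCommMonoid E] [Module ℝ≥0 E] {S : Set E}
    {f : E → ℝ≥0∞} (hf : ConvexOn ℝ≥0 S f) (t : Finset ι) (w : ι → ℝ≥0) (p : ι → E)
    (hw : ∑ i ∈ t, w i = 1) (hp : ∀ i ∈ t, p i ∈ S) :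
    ∑ i ∈ t, w i • p i ∈ S ∧ f (∑ i ∈ t, w i • p i) ≤ ∑ i ∈ t, w i * f (p i) := by
  classical
  induction t using Finset.induction_on generalizing w with
  | empty => simp at hw
  | insert a t ha ih =>
    rw [Finset.sum_insert ha] at hw
    simp only [Finset.sum_insert ha]
    have hpa : p a ∈ S := hp a (Finset.mem_insert_self a t)
    -- A remainder of weight zero cannot be renormalised, but contributes nothing to either side.
    by_cases h0 : ∑ i ∈ t, w i = 0
    · rw [h0, add_zero] at hw
      have hz : ∀ i ∈ t, w i = 0 := fun i hi => (Finset.sum_eq_zero_iff.1 h0) i hi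
      have hz₁ : ∑ i ∈ t, w i • p i = 0 := Finset.sum_eq_zero fun i hi => by simp [hz i hi]
      have hz₂ : ∑ i ∈ t, (w i : ℝ≥0∞) * f (p i) = 0 :=
        Finset.sum_eq_zero fun i hi => by simp [hz i hi]
      rw [hz₁, hz₂, hw]
      simpa using hpa
    · set b := ∑ i ∈ t, w i with hb
      have hsum : ∑ i ∈ t, b⁻¹ * w i = 1 := by
        rw [← Finset.mul_sum, ← hb, inv_mul_cancel₀ h0]
      obtain ⟨hmem, hle⟩ := ih (fun i => b⁻¹ * w i) hsum
        fun i hi => hp i (Finset.mem_insert_of_mem hi)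
      have hrw : ∑ i ∈ t, w i • p i = b • ∑ i ∈ t, (b⁻¹ * w i) • p i := by
        rw [Finset.smul_sum]
        refine Finset.sum_congr rfl fun i _ => ?_
        rw [smul_smul, mul_inv_cancel_left₀ h0]
      rw [hrw]
      refine ⟨hf.1 hpa hmem zero_le zero_le hw,
        (hf.2 hpa hmem zero_le zero_le hw).trans ?_⟩
      rw [ENNReal.smul_def, ENNReal.smul_def, smul_eq_mul, smul_eq_mul]
      gcongr
      calc (b : ℝ≥0∞) * f (∑ i ∈ t, (b⁻¹ * w i) • p i)
          ≤ b * ∑ i ∈ t, ((b⁻¹ * w i : ℝ≥0) : ℝ≥0∞) * f (p i) := by gcongr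
        _ = ∑ i ∈ t, w i * f (p i) := by
          rw [Finset.mul_sum]
          refine Finset.sum_congr rfl fun i _ => ?_
          rw [← mul_assoc, ← ENNReal.coe_mul, mul_inv_cancel_left₀ h0]

variable {α β : Type*} [MeasurableSpace α] [MeasurableSpace β]

/-- The mixture of the kernels `K i` with weights `w i`. -/
noncomputable def mixKernel {ι : Type*} [Fintype ι] (w : ι → ℝ≥0) (K : ι → Kernel α β) :
    Kernel α β where
  toFun a := ∑ i, w i • K i a
  measurable' := by
    refine Measure.measurable_of_measurable_coe _ fun A hA => ?_
    simp only [Measure.finsetSum_apply, Measure.smul_apply]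
    refine Finset.measurable_sum _ fun i _ => ?_
    exact ((K i).measurable_coe hA).const_smul (w i)

lemma mixKernel_apply {ι : Type*} [Fintype ι] (w : ι → ℝ≥0) (K : ι → Kernel α β) (a : α) :
    mixKernel w K a = ∑ i, w i • K i a := rfl

lemma isMarkovKernel_mixKernel {ι : Type*} [Fintype ι] {w : ι → ℝ≥0} (hw : ∑ i, w i = 1)
    (K : ι → Kernel α β) [∀ i, IsMarkovKernel (K i)] : IsMarkovKernel (mixKernel w K) := by
  refine ⟨fun a => ⟨?_⟩⟩
  rw [mixKernel_apply, Measure.finsetSum_apply]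
  simp only [Measure.smul_apply, measure_univ, ENNReal.smul_def, smul_eq_mul, mul_one]
  exact_mod_cast hw

lemma compProd_mixKernel {ι : Type*} [Fintype ι] {w : ι → ℝ≥0} (hw : ∑ i, w i = 1)
    (ρ : Measure α) [SFinite ρ] (K : ι → Kernel α β) [∀ i, IsMarkovKernel (K i)] :
    ρ ⊗ₘ mixKernel w K = ∑ i, w i • (ρ ⊗ₘ K i) := by
  have := isMarkovKernel_mixKernel hw K
  ext A hA
  rw [Measure.compProd_apply hA, Measure.finsetSum_apply]
  simp only [mixKernel_apply, Measure.finsetSum_apply, Measure.smul_apply,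
    Measure.compProd_apply hA, ENNReal.smul_def, smul_eq_mul]
  rw [lintegral_finsetSum]
  · refine Finset.sum_congr rfl fun i _ => ?_
    rw [lintegral_const_mul]
    exact Kernel.measurable_kernel_prodMk_left hA
  · intro i _
    exact (Kernel.measurable_kernel_prodMk_left hA).const_mul _

lemma measure_map_sum_smul {ι : Type*} [Fintype ι] (w : ι → ℝ≥0) (μ : ι → Measure α) {f : α → β}
    (hf : Measurable f) : (∑ i, w i • μ i).map f = ∑ i, w i • (μ i).map f := by
  ext A hA
  simp [Measure.map_apply hf hA, Measure.finsetSum_apply]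

lemma lintegral_sum_smul {ι : Type*} [Fintype ι] (w : ι → ℝ≥0) (μ : ι → Measure α)
    (f : α → ℝ≥0∞) : ∫⁻ a, f a ∂(∑ i, w i • μ i) = ∑ i, w i * ∫⁻ a, f a ∂(μ i) := by
  rw [lintegral_finsetSum_measure]
  simp only [lintegral_smul_measure, ENNReal.smul_def, smul_eq_mul]

variable {𝒴 𝒳 : Type*} [MeasurableSpace 𝒴] [MeasurableSpace 𝒳] [StandardBorelSpace 𝒳] [Nonempty 𝒳]

lemma isProbabilityMeasure_sum_smul {ι : Type*} [Fintype ι] {w : ι → ℝ≥0} (hw : ∑ i, w i = 1)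
    (μ : ι → Measure α) [∀ i, IsProbabilityMeasure (μ i)] :
    IsProbabilityMeasure (∑ i, w i • μ i) := by
  refine ⟨?_⟩
  rw [Measure.finsetSum_apply]
  simp only [Measure.smul_apply, measure_univ, ENNReal.smul_def, smul_eq_mul, mul_one]
  exact_mod_cast hw

section

variable {ι : Type*} [Fintype ι] {w : ι → ℝ≥0} {μ : Measure (𝒴 × 𝒳)}
  [IsProbabilityMeasure μ] {γ : ι → Measure (𝒴 × 𝒳 × 𝒳)} [∀ i, IsProbabilityMeasure (γ i)]

lemma map_source_mixture (hw : ∑ i, w i = 1) (hγ : ∀ i, (γ i).map (fun t => (t.1, t.2.1)) = μ) :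
    (∑ i, w i • γ i).map (fun t => (t.1, t.2.1)) = μ := by
  rw [measure_map_sum_smul _ _ (by fun_prop)]
  simp only [hγ, ← Finset.sum_smul, hw, one_smul]

/-- All components share the law of Y, so the weights do not change under conditioning on Y and the
conditional kernels mix with the same weights. -/
lemma mixture_eq_compProd (hw : ∑ i, w i = 1)
    (hγ : ∀ i, (γ i).map (fun t => (t.1, t.2.1)) = μ) :
    ∑ i, w i • γ i = μ.fst ⊗ₘ mixKernel w fun i => (γ i).condKernel := by
  rw [compProd_mixKernel hw]
  refine Finset.sum_congr rfl fun i _ => ?_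
  rw [← fst_eq_of_map_source (hγ i), (γ i).disintegrate]

lemma condDistortion_mixture (hw : ∑ i, w i = 1)
    (hγ : ∀ i, (γ i).map (fun t => (t.1, t.2.1)) = μ) (Δ : 𝒳 → 𝒳 → ℝ≥0∞) :
    ∀ᵐ y ∂μ.fst, condDistortion Δ (∑ i, w i • γ i) y = ∑ i, w i * condDistortion Δ (γ i) y := by
  have := isMarkovKernel_mixKernel hw fun i => (γ i).condKernel
  have h := condKernel_compProd μ.fst (mixKernel w fun i => (γ i).condKernel)
  filter_upwards [h] with y hy
  simp only [condDistortion, mixture_eq_compProd hw hγ]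
  rw [hy, mixKernel_apply, lintegral_sum_smul]

/-- The first argument of `d` is p_{X|Y} in every component, so convexity in the second argument
alone suffices. -/
lemma condPerception_mixture_le {d : Measure 𝒳 → Measure 𝒳 → ℝ≥0∞} (hd : ConvexInSecond d)
    (hw : ∑ i, w i = 1) (hγ : ∀ i, (γ i).map (fun t => (t.1, t.2.1)) = μ) :
    ∀ᵐ y ∂μ.fst, condPerception d (∑ i, w i • γ i) y ≤ ∑ i, w i * condPerception d (γ i) y := by
  have := isMarkovKernel_mixKernel hw fun i => (γ i).condKernel
  have hp := isProbabilityMeasure_sum_smul hw γ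
  have h := condKernel_compProd μ.fst (mixKernel w fun i => (γ i).condKernel)
  have h₁ := sourceGiven_ae_eq (map_source_mixture hw hγ)
  have h₂ : ∀ᵐ y ∂μ.fst, ∀ i, sourceGiven (γ i) y = μ.condKernel y :=
    Filter.eventually_all.2 fun i => sourceGiven_ae_eq (hγ i)
  filter_upwards [h, h₁, h₂] with y hy hy₁ hy₂
  have hr : reconGiven (∑ i, w i • γ i) y = ∑ i, w i • reconGiven (γ i) y := by
    simp only [reconGiven, Kernel.snd_apply, mixture_eq_compProd hw hγ]
    rw [hy, mixKernel_apply, measure_map_sum_smul _ _ measurable_snd]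
  simp only [condPerception]
  rw [hr, hy₁]
  simp only [hy₂]
  exact (convexOn_map_sum_le (hd (μ.condKernel y)) Finset.univ w
    (fun i => reconGiven (γ i) y) hw fun i _ => (inferInstance :
      IsProbabilityMeasure (reconGiven (γ i) y))).2

lemma reconGiven_mixture (hw : ∑ i, w i = 1)
    (hγ : ∀ i, (γ i).map (fun t => (t.1, t.2.1)) = μ) :
    reconGiven (∑ i, w i • γ i) =ᵐ[μ.fst] mixKernel w fun i => reconGiven (γ i) := by
  have := isMarkovKernel_mixKernel hw fun i => (γ i).condKernel
  filter_upwards [condKernel_compProd μ.fst (mixKernel w fun i => (γ i).condKernel)] with y hy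
  simp only [reconGiven, Kernel.snd_apply, mixKernel_apply, mixture_eq_compProd hw hγ]
  rw [hy, mixKernel_apply, measure_map_sum_smul _ _ measurable_snd]

/-- With the source fixed, the reference laws mix with the same weights as the triples; joint
convexity of the divergence does the rest. -/
lemma condMutualInfo_mixture_le (hw : ∑ i, w i = 1)
    (hγ : ∀ i, (γ i).map (fun t => (t.1, t.2.1)) = μ) :
    condMutualInfo (∑ i, w i • γ i) ≤ ∑ i, w i * condMutualInfo (γ i) := by
  have hp := isProbabilityMeasure_sum_smul hw γ
  have := isMarkovKernel_mixKernel hw fun i => reconGiven (γ i)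
  have hind : indepLaw μ (reconGiven (∑ i, w i • γ i)) =
      ∑ i, w i • indepLaw μ (reconGiven (γ i)) := by
    rw [indepLaw_congr (reconGiven_mixture hw hγ)]
    have : (mixKernel w fun i => reconGiven (γ i)).prodMkRight 𝒳 =
        mixKernel w fun i => (reconGiven (γ i)).prodMkRight 𝒳 := rfl
    rw [indepLaw, tripleLaw, this, compProd_mixKernel hw, measure_map_sum_smul _ _ (by fun_prop)]
    rfl
  have hfin : ∀ i, IsFiniteMeasure (indepLaw μ (reconGiven (γ i))) := fun i => by
    rw [indepLaw]; infer_instance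
  rw [condMutualInfo_eq (map_source_mixture hw hγ), hind]
  simp only [condMutualInfo_eq (hγ _), div_eq_mul_inv, ← mul_assoc, ← Finset.sum_mul]
  gcongr
  exact klDiv_sum_smul_le _ _ _ _

end

lemma convexOn_rdcpFunction (s : Sense) (Δ : 𝒳 → 𝒳 → ℝ≥0∞) {d : Measure 𝒳 → Measure 𝒳 → ℝ≥0∞}
    (hd : ConvexInSecond d) (μ : Measure (𝒴 × 𝒳)) [IsProbabilityMeasure μ] :
    ConvexOn ℝ≥0 Set.univ fun q : ℝ≥0∞ × ℝ≥0∞ => rdcpFunction s Δ d μ q.1 q.2 := by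
  refine ⟨convex_univ, ?_⟩
  rintro ⟨D₁, P₁⟩ - ⟨D₂, P₂⟩ - a b - - hab
  simp only [Prod.smul_mk, Prod.mk_add_mk]
  simp only [ENNReal.smul_def, smul_eq_mul]
  -- The infima need not be attained; channels within ε of them are mixed.
  refine ENNReal.le_of_forall_pos_le_add fun ε hε htop => ?_
  -- Since 0 * ∞ = 0, a finite right-hand side makes the rate finite only at an endpoint of positive
  -- weight.
  rcases eq_or_ne a 0 with rfl | ha
  · obtain rfl : b = 1 := by simpa using hab
    simp
  rcases eq_or_ne b 0 with rfl | hb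
  · obtain rfl : a = 1 := by simpa using hab
    simp
  have ha' : (a : ℝ≥0∞) ≠ 0 := by simpa
  have hb' : (b : ℝ≥0∞) ≠ 0 := by simpa
  have h₁ : rdcpFunction s Δ d μ D₁ P₁ ≠ ∞ := fun h => by
    simp [h, ENNReal.mul_top ha'] at htop
  have h₂ : rdcpFunction s Δ d μ D₂ P₂ ≠ ∞ := fun h => by
    simp [h, ENNReal.mul_top hb'] at htop
  have hε' : (ε : ℝ≥0∞) ≠ 0 := by simpa using hε.ne'
  obtain ⟨κ₁, hκ₁, hm₁, hI₁⟩ := exists_of_rdcpFunction_lt (ENNReal.lt_add_right h₁ hε')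
  obtain ⟨κ₂, hκ₂, hm₂, hI₂⟩ := exists_of_rdcpFunction_lt (ENNReal.lt_add_right h₂ hε')
  let w : Fin 2 → ℝ≥0 := ![a, b]
  let γ : Fin 2 → Measure (𝒴 × 𝒳 × 𝒳) := ![tripleLaw μ κ₁, tripleLaw μ κ₂]
  have hw : ∑ i, w i = 1 := by simpa [w, Fin.sum_univ_two] using hab
  have hprob : ∀ i, IsProbabilityMeasure (γ i) := by
    intro i
    fin_cases i
    · exact instIsProbabilityMeasureTripleLaw μ κ₁
    · exact instIsProbabilityMeasureTripleLaw μ κ₂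
  have hγ : ∀ i, (γ i).map (fun t => (t.1, t.2.1)) = μ := by
    intro i
    fin_cases i
    · exact map_source_tripleLaw μ κ₁
    · exact map_source_tripleLaw μ κ₂
  have hp := isProbabilityMeasure_sum_smul hw γ
  have hfst := fst_eq_of_map_source (map_source_mixture hw hγ)
  have hf₁ := fst_eq_of_map_source (map_source_tripleLaw μ κ₁)
  have hf₂ := fst_eq_of_map_source (map_source_tripleLaw μ κ₂)
  rw [Meets, hf₁] at hm₁
  rw [Meets, hf₂] at hm₂
  have hmeets : Meets s Δ d (a * D₁ + b * D₂) (a * P₁ + b * P₂) (∑ i, w i • γ i) := by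
    rw [Meets, hfst]
    constructor
    · refine ((hm₁.1.const_mul a).add (hm₂.1.const_mul b)).congr ?_
      filter_upwards [condDistortion_mixture hw hγ Δ] with y hy
      exact hy.trans (Fin.sum_univ_two fun i => (w i : ℝ≥0∞) * condDistortion Δ (γ i) y)
    · refine ((hm₁.2.const_mul a).add (hm₂.2.const_mul b)).mono ?_ le_rfl
      filter_upwards [condPerception_mixture_le hd hw hγ] with y hy
      exact hy.trans_eq (Fin.sum_univ_two fun i => (w i : ℝ≥0∞) * condPerception d (γ i) y)
  refine (rdcpFunction_le (map_source_mixture hw hγ) hmeets).trans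
    ((condMutualInfo_mixture_le hw hγ).trans ?_)
  refine (Fin.sum_univ_two fun i => (w i : ℝ≥0∞) * condMutualInfo (γ i)).trans_le ?_
  calc (a : ℝ≥0∞) * condMutualInfo (tripleLaw μ κ₁) + b * condMutualInfo (tripleLaw μ κ₂)
      ≤ a * (rdcpFunction s Δ d μ D₁ P₁ + ε) + b * (rdcpFunction s Δ d μ D₂ P₂ + ε) := by gcongr
    _ = a * rdcpFunction s Δ d μ D₁ P₁ + b * rdcpFunction s Δ d μ D₂ P₂ + (a + b : ℝ≥0) * ε := by
      push_cast; ring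
    _ = _ := by rw [hab, ENNReal.coe_one, one_mul]

lemma map_source_eq_map_recon_of_condPerception_zero {s : Sense}
    {d : Measure 𝒳 → Measure 𝒳 → ℝ≥0∞} (hd : IsDivergence d) (γ : Measure (𝒴 × 𝒳 × 𝒳))
    [IsProbabilityMeasure γ] (h : s.AtMost γ.fst (condPerception d γ) 0) :
    γ.map (fun t => (t.1, t.2.1)) = γ.map (fun t => (t.1, t.2.2)) := by
  have hae : sourceGiven γ =ᵐ[γ.fst] reconGiven γ := by
    filter_upwards [h.ae_eq_zero] with y hy
    exact (hd _ _).1 hy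
  rw [map_source, map_recon, Measure.compProd_congr hae]

lemma map_eq_of_condPerception_zero {s : Sense} {d : Measure 𝒳 → Measure 𝒳 → ℝ≥0∞}
    (hd : IsDivergence d) (γ : Measure (𝒴 × 𝒳 × 𝒳)) [IsProbabilityMeasure γ]
    (h : s.AtMost γ.fst (condPerception d γ) 0) :
    γ.map (fun t => t.2.1) = γ.map (fun t => t.2.2) := by
  have := congrArg (Measure.map Prod.snd) (map_source_eq_map_recon_of_condPerception_zero hd γ h)
  rwa [Measure.map_map measurable_snd (by fun_prop),
    Measure.map_map measurable_snd (by fun_prop)] at this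

end Mixtures

/-! ### Exact sampling from a density by rejection -/

section RejectionSampling

/-! Greedy rejection sampling: from independent samples of law `η` one samples the law of density
`f` with respect to `η`. The `i`-th sample is accepted so that the mass accepted up to then has
density `min f (level η f i)`. -/

variable {𝒰 : Type*} [MeasurableSpace 𝒰]

/-- The level up to which the density `f` has been exhausted before the `i`-th sample. -/
noncomputable def level (η : Measure 𝒰) (f : 𝒰 → ℝ≥0∞) : ℕ → ℝ≥0∞
  | 0 => 0
  | i + 1 => level η f i + ∫⁻ u, (f u - level η f i) ∂η

/-- The probability that none of the first `i` samples is accepted. -/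
noncomputable def residual (η : Measure 𝒰) (f : 𝒰 → ℝ≥0∞) (i : ℕ) : ℝ≥0∞ :=
  ∫⁻ u, (f u - level η f i) ∂η

/-- The density of the `i`-th sample on the event that it is the accepted one. -/
noncomputable def share (η : Measure 𝒰) (f : 𝒰 → ℝ≥0∞) (i : ℕ) (u : 𝒰) : ℝ≥0∞ :=
  min (f u - level η f i) (residual η f i)

variable {η : Measure 𝒰} {f : 𝒰 → ℝ≥0∞}

lemma level_succ (i : ℕ) : level η f (i + 1) = level η f i + residual η f i := rfl

lemma measurable_share (hf : Measurable f) (i : ℕ) : Measurable (share η f i) := by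
  unfold share; fun_prop

lemma level_mono : Monotone (level η f) :=
  monotone_nat_of_le_succ fun i => by rw [level_succ]; exact le_self_add

lemma residual_anti : Antitone (residual η f) := fun _ _ hij =>
  lintegral_mono fun _ => tsub_le_tsub_left (level_mono hij) _

lemma share_add (i : ℕ) (u : 𝒰) :
    share η f i u + (f u - level η f (i + 1)) = f u - level η f i := by
  rw [level_succ, ← tsub_tsub, share, add_comm]
  exact tsub_add_min

/-- The shares telescope: each is what the remainder of `f` above the level loses in one round. -/
lemma sum_share_add (m : ℕ) (u : 𝒰) :
    ∑ i ∈ Finset.range m, share η f i u + (f u - level η f m) = f u := by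
  induction m with
  | zero => simp [level]
  | succ m ih => rw [Finset.sum_range_succ, add_assoc, share_add, ih]

lemma lintegral_share_add (hf : Measurable f) (i : ℕ) :
    ∫⁻ u, share η f i u ∂η + residual η f (i + 1) = residual η f i := by
  rw [residual, residual, ← lintegral_add_left (measurable_share hf i)]
  exact lintegral_congr fun u => share_add i u

/-- The level is the sum of the earlier residuals, none of which is below the present one. -/
lemma mul_residual_le_level (i : ℕ) : i * residual η f i ≤ level η f i := by
  induction i with
  | zero => simp
  | succ i ih =>
    rw [level_succ, Nat.cast_add, Nat.cast_one, add_mul, one_mul]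
    have := residual_anti (η := η) (f := f) (Nat.le_succ i)
    exact add_le_add ((mul_le_mul_right this _).trans ih) this

lemma residual_zero (h1 : ∫⁻ u, f u ∂η = 1) : residual η f 0 = 1 := by
  simpa [residual, level] using h1

lemma residual_le_one (h1 : ∫⁻ u, f u ∂η = 1) (i : ℕ) : residual η f i ≤ 1 :=
  (residual_anti (Nat.zero_le i)).trans_eq (residual_zero h1)

lemma level_ne_top (h1 : ∫⁻ u, f u ∂η = 1) (i : ℕ) : level η f i ≠ ∞ := by
  induction i with
  | zero => simp [level]
  | succ i ih =>
    rw [level_succ]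
    exact ENNReal.add_ne_top.2 ⟨ih, ((residual_le_one h1 i).trans_lt ENNReal.one_lt_top).ne⟩

/-- Either the residual is already at most δ, or the level has reached m * δ and only the part of
`f` above that height is left. -/
lemma residual_le (hf : Measurable f) (m : ℕ) (δ : ℝ≥0∞) :
    residual η f m ≤ δ + ∫⁻ u in {u | m * δ < f u}, f u ∂η := by
  rcases le_total (residual η f m) δ with h | h
  · exact h.trans le_self_add
  · refine le_add_left ?_
    rw [← lintegral_indicator (measurableSet_lt measurable_const hf)]
    refine lintegral_mono fun u => ?_
    have hl : m * δ ≤ level η f m :=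
      (mul_le_mul_right h _).trans (mul_residual_le_level m)
    by_cases hu : m * δ < f u
    · rw [Set.indicator_of_mem (s := {u | m * δ < f u}) hu]
      exact tsub_le_self
    · rw [tsub_eq_zero_of_le ((not_lt.1 hu).trans hl)]
      exact zero_le

lemma tendsto_residual (hf : Measurable f) (h1 : ∫⁻ u, f u ∂η = 1) :
    Filter.Tendsto (residual η f) Filter.atTop (nhds 0) := by
  refine ENNReal.tendsto_nhds_zero.2 fun ε hε => ?_
  have hδ0 : ε / 2 ≠ 0 := (ENNReal.half_pos hε.ne').ne'
  have hlim : Filter.Tendsto (fun m : ℕ => ∫⁻ u in {u | m * (ε / 2) < f u}, f u ∂η) Filter.atTop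
      (nhds 0) := by
    have hset : ∀ m : ℕ, MeasurableSet {u | m * (ε / 2) < f u} := fun m =>
      measurableSet_lt measurable_const hf
    simp_rw [← lintegral_indicator (hset _)]
    rw [← lintegral_zero (μ := η)]
    refine tendsto_lintegral_of_dominated_convergence f (fun m => hf.indicator (hset m))
      (fun m => .of_forall fun u => Set.indicator_le_self _ _ _) (by simp [h1]) ?_
    filter_upwards [ae_lt_top hf (by simp [h1])] with u hu
    refine tendsto_const_nhds.congr' ?_
    have : ∀ᶠ m : ℕ in Filter.atTop, f u ≤ m * (ε / 2) := by
      obtain ⟨n, hn⟩ := ENNReal.exists_nat_mul_gt hδ0 hu.ne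
      filter_upwards [Filter.eventually_ge_atTop n] with m hm
      exact hn.le.trans (by gcongr)
    filter_upwards [this] with m hm
    rw [Set.indicator_of_notMem]
    simpa using hm
  filter_upwards [ENNReal.tendsto_nhds_zero.1 hlim (ε / 2) (ENNReal.half_pos hε.ne')] with m hm
  exact (residual_le hf m (ε / 2)).trans ((add_le_add_right hm _).trans_eq (ENNReal.add_halves ε))

lemma sum_lintegral_share_add (hf : Measurable f) (h1 : ∫⁻ u, f u ∂η = 1) (m : ℕ) :
    ∑ i ∈ Finset.range m, ∫⁻ u, share η f i u ∂η + residual η f m = 1 := by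
  induction m with
  | zero => simp [residual_zero h1]
  | succ m ih => rw [Finset.sum_range_succ, add_assoc, lintegral_share_add hf, ih]

lemma tsum_lintegral_share (hf : Measurable f) (h1 : ∫⁻ u, f u ∂η = 1) :
    ∑' i, ∫⁻ u, share η f i u ∂η = 1 := by
  have h := (ENNReal.tendsto_nat_tsum fun i => ∫⁻ u, share η f i u ∂η).add (tendsto_residual hf h1)
  simp only [sum_lintegral_share_add hf h1, add_zero] at h
  exact tendsto_nhds_unique h tendsto_const_nhds

lemma tsum_share_le (u : 𝒰) : ∑' i, share η f i u ≤ f u :=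
  ENNReal.tsum_le_of_sum_range_le fun m => le_self_add.trans_eq (sum_share_add m u)

/-- The sum is at most `f` pointwise, and both functions have integral one. -/
lemma tsum_share_ae_eq (hf : Measurable f) (h1 : ∫⁻ u, f u ∂η = 1) :
    (fun u => ∑' i, share η f i u) =ᵐ[η] f := by
  have h : ∫⁻ u, ∑' i, share η f i u ∂η = 1 := by
    rw [lintegral_tsum fun i => (measurable_share hf i).aemeasurable, tsum_lintegral_share hf h1]
  exact ae_eq_of_ae_le_of_lintegral_le (.of_forall tsum_share_le) (by simp [h]) hf.aemeasurable
    (by rw [h1, h])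

/-- The set of pairs of a sample and an auxiliary uniform variable for which the `i`-th sample is
accepted. -/
def acceptSet (η : Measure 𝒰) (f : 𝒰 → ℝ≥0∞) (i : ℕ) : Set (𝒰 × I) :=
  {q | ENNReal.ofReal q.2 * residual η f i < f q.1 - level η f i}

/-- The index of the first accepted sample. -/
noncomputable def stopIndex (η : Measure 𝒰) (f : 𝒰 → ℝ≥0∞) (ω : ℕ → 𝒰 × I) : ℕ :=
  sInf {i | ω i ∈ acceptSet η f i}

/-- The event that the `k`-th sample is the first accepted one. -/
def stopSet (η : Measure 𝒰) (f : 𝒰 → ℝ≥0∞) (k : ℕ) : Set (ℕ → 𝒰 × I) :=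
  {ω | (∀ j < k, ω j ∉ acceptSet η f j) ∧ ω k ∈ acceptSet η f k}

lemma stopIndex_of_mem {k : ℕ} {ω : ℕ → 𝒰 × I} (h : ω ∈ stopSet η f k) : stopIndex η f ω = k := by
  refine le_antisymm (Nat.sInf_le h.2) (le_csInf ⟨k, h.2⟩ fun j hj => ?_)
  by_contra hlt
  exact h.1 j (not_le.1 hlt) hj

lemma measurableSet_acceptSet (hf : Measurable f) (i : ℕ) : MeasurableSet (acceptSet η f i) :=
  measurableSet_lt (by fun_prop) (by fun_prop)

lemma measurableSet_stopSet (hf : Measurable f) (k : ℕ) : MeasurableSet (stopSet η f k) := by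
  have : stopSet η f k = (⋂ j, ⋂ (_ : j < k), {ω | ω j ∈ acceptSet η f j}ᶜ) ∩
      {ω | ω k ∈ acceptSet η f k} := by
    ext ω; simp [stopSet]
  have hm : ∀ j, MeasurableSet {ω : ℕ → 𝒰 × I | ω j ∈ acceptSet η f j} := fun j =>
    measurable_pi_apply j (measurableSet_acceptSet hf j)
  rw [this]
  exact (MeasurableSet.iInter fun j => .iInter fun _ => (hm j).compl).inter (hm k)

lemma pairwise_disjoint_stopSet : Pairwise (Function.onFun Disjoint (stopSet η f)) := by
  intro i j hij
  refine Set.disjoint_left.2 fun ω hi hj => hij ?_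
  rw [← stopIndex_of_mem hi, stopIndex_of_mem hj]

lemma volume_ofReal_mul_lt {a b : ℝ≥0∞} (hb0 : b ≠ 0) (hb : b ≠ ∞) :
    b * volume {v : I | ENNReal.ofReal v * b < a} = min a b := by
  have hset : {v : I | ENNReal.ofReal v * b < a} = {v : I | ENNReal.ofReal v < a / b} := by
    ext v
    exact (ENNReal.lt_div_iff_mul_lt (.inl hb0) (.inl hb)).symm
  rcases lt_or_ge 1 (a / b) with h | h
  · have : {v : I | ENNReal.ofReal v < a / b} = Set.univ := by
      ext v
      simp only [Set.mem_ofPred_eq, Set.mem_univ, iff_true]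
      exact lt_of_le_of_lt (ENNReal.ofReal_le_one.2 v.2.2) h
    rw [hset, this, measure_univ, mul_one, min_eq_right]
    rw [ENNReal.lt_div_iff_mul_lt (.inl hb0) (.inl hb), one_mul] at h
    exact h.le
  · have hx : (a / b).toReal ∈ I := ⟨ENNReal.toReal_nonneg, ENNReal.toReal_le_of_le_ofReal
      zero_le_one (by simpa using h)⟩
    have hne : a / b ≠ ∞ := (h.trans_lt ENNReal.one_lt_top).ne
    have : {v : I | ENNReal.ofReal v < a / b} = Set.Iio ⟨(a / b).toReal, hx⟩ := by
      ext v
      simp only [Set.mem_ofPred_eq, Set.mem_Iio]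
      rw [ENNReal.ofReal_lt_iff_lt_toReal v.2.1 hne, Subtype.mk_lt_mk.symm]
    rw [hset, this, unitInterval.volume_Iio]
    simp only [ENNReal.ofReal_toReal hne]
    rw [ENNReal.mul_div_cancel hb0 hb, min_eq_left]
    rw [ENNReal.div_le_iff hb0 hb, one_mul] at h
    exact h

variable [IsProbabilityMeasure η]

/-- A sample u is accepted with probability min ((f u - level) / residual) 1. Multiplied by the
residual, the probability of reaching the i-th sample, this is the share. -/
lemma residual_mul_accept (hf : Measurable f) (h1 : ∫⁻ u, f u ∂η = 1) (i : ℕ) {B : Set 𝒰}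
    (hB : MeasurableSet B) :
    residual η f i * (η.prod volume) (acceptSet η f i ∩ Prod.fst ⁻¹' B) =
      ∫⁻ u in B, share η f i u ∂η := by
  rcases eq_or_ne (residual η f i) 0 with h0 | h0
  · simp [h0, share]
  have htop : residual η f i ≠ ∞ := ((residual_le_one h1 i).trans_lt ENNReal.one_lt_top).ne
  rw [Measure.prod_apply ((measurableSet_acceptSet hf i).inter (measurable_fst hB)),
    ← lintegral_const_mul', ← lintegral_indicator hB]
  · refine lintegral_congr fun u => ?_
    by_cases hu : u ∈ B
    · rw [Set.indicator_of_mem hu, share, ← volume_ofReal_mul_lt h0 htop]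
      congr 2
      ext v
      simp [acceptSet, hu]
    · rw [Set.indicator_of_notMem hu]
      have : Prod.mk u ⁻¹' (acceptSet η f i ∩ Prod.fst ⁻¹' B) = ∅ := by
        ext v; simp [hu]
      simp [this]
  · exact htop

lemma residual_mul_compl (hf : Measurable f) (h1 : ∫⁻ u, f u ∂η = 1) (i : ℕ) :
    residual η f i * (η.prod volume) (acceptSet η f i)ᶜ = residual η f (i + 1) := by
  have h := residual_mul_accept hf h1 i MeasurableSet.univ
  simp only [Set.preimage_univ, Set.inter_univ, Measure.restrict_univ] at h
  have htop : residual η f i ≠ ∞ := ((residual_le_one h1 i).trans_lt ENNReal.one_lt_top).ne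
  have hsum := lintegral_share_add (η := η) hf i
  have hadd : residual η f i * (η.prod volume) (acceptSet η f i) +
      residual η f i * (η.prod volume) (acceptSet η f i)ᶜ = residual η f i := by
    rw [← mul_add, measure_add_measure_compl (measurableSet_acceptSet hf i), measure_univ, mul_one]
  rw [h] at hadd
  have hfin : ∫⁻ u, share η f i u ∂η ≠ ∞ := ne_top_of_le_ne_top htop (hsum ▸ le_self_add)
  exact (ENNReal.add_right_inj hfin).1 (hadd.trans hsum.symm)

/-- The law of the sequence of samples and auxiliary uniform variables. -/
noncomputable def sampleLaw (η : Measure 𝒰) : Measure (ℕ → 𝒰 × I) :=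
  Measure.infinitePi fun _ => η.prod (volume : Measure I)

instance : IsProbabilityMeasure (sampleLaw η) := by unfold sampleLaw; infer_instance

/-- The event is a box: rejection in the coordinates before k, acceptance of a sample in B in
coordinate k. The rejection probabilities multiply to the residual. -/
lemma sampleLaw_stopSet (hf : Measurable f) (h1 : ∫⁻ u, f u ∂η = 1) (k : ℕ) {B : Set 𝒰}
    (hB : MeasurableSet B) :
    sampleLaw η (stopSet η f k ∩ {ω | (ω k).1 ∈ B}) = ∫⁻ u in B, share η f k u ∂η := by
  let t : ℕ → Set (𝒰 × I) := fun j =>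
    if j < k then (acceptSet η f j)ᶜ else acceptSet η f j ∩ Prod.fst ⁻¹' B
  have ht : ∀ j, MeasurableSet (t j) := fun j => by
    by_cases hj : j < k
    · simpa [t, hj] using measurableSet_acceptSet hf j
    · simpa [t, hj] using (measurableSet_acceptSet hf j).inter (measurable_fst hB)
  have hset : stopSet η f k ∩ {ω | (ω k).1 ∈ B} = Set.pi (Finset.range (k + 1)) t := by
    ext ω
    simp only [stopSet, Set.mem_inter_iff, Set.mem_ofPred_eq, Set.mem_pi, Finset.coe_range,
      Set.mem_Iio]
    constructor
    · rintro ⟨⟨h₁, h₂⟩, h₃⟩ j hj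
      rcases Nat.lt_succ_iff_lt_or_eq.1 hj with hjk | rfl
      · simpa [t, hjk] using h₁ j hjk
      · simpa [t] using ⟨h₂, h₃⟩
    · intro h
      have hk := h k (Nat.lt_succ_self k)
      simp only [t, lt_self_iff_false, if_false] at hk
      refine ⟨⟨fun j hj => ?_, hk.1⟩, hk.2⟩
      have := h j (hj.trans (Nat.lt_succ_self k))
      simpa [t, hj] using this
  have hprod : ∀ i, ∏ j ∈ Finset.range i, (η.prod (volume : Measure I)) (acceptSet η f j)ᶜ =
      residual η f i := fun i => by
    induction i with
    | zero => simp [residual_zero h1]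
    | succ i ih => rw [Finset.prod_range_succ, ih, residual_mul_compl hf h1]
  rw [hset, sampleLaw, Measure.infinitePi_pi _ fun j _ => ht j, Finset.prod_range_succ]
  have h₁ : ∏ j ∈ Finset.range k, (η.prod (volume : Measure I)) (t j) = residual η f k := by
    rw [← hprod k]
    exact Finset.prod_congr rfl fun j hj => by simp [t, Finset.mem_range.1 hj]
  rw [h₁]
  simp only [t, lt_self_iff_false, if_false]
  exact residual_mul_accept hf h1 k hB

/-- The shares have total mass one. Hence the default value of `sInf ∅` in the stopping index
matters only on a null set. -/
lemma ae_exists_mem_stopSet (hf : Measurable f) (h1 : ∫⁻ u, f u ∂η = 1) :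
    ∀ᵐ ω ∂sampleLaw η, ω ∈ ⋃ k, stopSet η f k := by
  have h : sampleLaw η (⋃ k, stopSet η f k) = 1 := by
    rw [measure_iUnion pairwise_disjoint_stopSet fun k => measurableSet_stopSet hf k,
      ← tsum_lintegral_share hf h1]
    refine tsum_congr fun k => ?_
    have := sampleLaw_stopSet hf h1 k MeasurableSet.univ
    simpa using this
  exact (prob_compl_eq_zero_iff (MeasurableSet.iUnion fun k => measurableSet_stopSet hf k)).2 h

/-- The joint law of the first accepted sample and of its index. -/
lemma lintegral_stopIndex (hf : Measurable f) (h1 : ∫⁻ u, f u ∂η = 1) {G : 𝒰 → ℕ → ℝ≥0∞}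
    (hG : ∀ k, Measurable fun u => G u k) :
    ∫⁻ ω, G (ω (stopIndex η f ω)).1 (stopIndex η f ω) ∂sampleLaw η =
      ∑' k, ∫⁻ u, share η f k u * G u k ∂η := by
  have h : sampleLaw η = (sampleLaw η).restrict (⋃ k, stopSet η f k) := by
    rw [Measure.restrict_eq_self_of_ae_mem (ae_exists_mem_stopSet hf h1)]
  rw [h, lintegral_iUnion (fun k => measurableSet_stopSet hf k) pairwise_disjoint_stopSet]
  refine tsum_congr fun k => ?_
  have hmap : ((sampleLaw η).restrict (stopSet η f k)).map (fun ω => (ω k).1) =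
      η.withDensity (share η f k) := by
    ext B hB
    rw [Measure.map_apply (by fun_prop) hB, Measure.restrict_apply
      ((show Measurable fun ω : ℕ → 𝒰 × I => (ω k).1 by fun_prop) hB), Set.inter_comm,
      withDensity_apply _ hB]
    exact sampleLaw_stopSet hf h1 k hB
  calc ∫⁻ ω in stopSet η f k, G (ω (stopIndex η f ω)).1 (stopIndex η f ω) ∂sampleLaw η
      = ∫⁻ ω in stopSet η f k, G (ω k).1 k ∂sampleLaw η :=
        setLIntegral_congr_fun (measurableSet_stopSet hf k) fun ω hω => by
          simp only [stopIndex_of_mem hω]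
    _ = ∫⁻ u, G u k ∂η.withDensity (share η f k) := by
        rw [← hmap, lintegral_map (hG k) (by fun_prop)]
    _ = ∫⁻ u, share η f k u * G u k ∂η := by
        rw [lintegral_withDensity_eq_lintegral_mul _ (measurable_share hf k) (hG k)]
        rfl

end RejectionSampling

/-! ### Expected logarithm and measurability of the accepted index -/

section StoppingIndex

variable {𝒰 : Type*} [MeasurableSpace 𝒰] {η : Measure 𝒰} {f : 𝒰 → ℝ≥0∞}

/-- The primitive of `x ↦ log (1 + x)` that vanishes at `0`. -/
noncomputable def logPrimitive (x : ℝ) : ℝ := (1 + x) * Real.log (1 + x) - x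

/-- A rectangle under the increasing function log (1 + x) on [l, l + g], with the height of the left
endpoint. -/
lemma mul_log_le_logPrimitive_sub {l g : ℝ} (hl : 0 ≤ l) (hg : 0 ≤ g) :
    g * Real.log (1 + l) ≤ logPrimitive (l + g) - logPrimitive l := by
  have h := Real.one_sub_inv_le_log_of_pos (x := (1 + (l + g)) / (1 + l)) (by positivity)
  rw [Real.log_div (by positivity) (by positivity), inv_div] at h
  have h' := mul_le_mul_of_nonneg_left h (by positivity : 0 ≤ 1 + (l + g))
  have h'' : (1 + (l + g)) * (1 - (1 + l) / (1 + (l + g))) = g := by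
    field_simp; ring
  rw [h''] at h'
  unfold logPrimitive
  nlinarith

lemma logPrimitive_nonneg {x : ℝ} (hx : 0 ≤ x) : 0 ≤ logPrimitive x := by
  have h := mul_log_le_logPrimitive_sub le_rfl hx
  simpa [logPrimitive] using h

lemma logPrimitive_mono {x y : ℝ} (hx : 0 ≤ x) (hxy : x ≤ y) : logPrimitive x ≤ logPrimitive y := by
  have h := mul_log_le_logPrimitive_sub hx (sub_nonneg.2 hxy)
  rw [add_sub_cancel] at h
  have : 0 ≤ (y - x) * Real.log (1 + x) :=
    mul_nonneg (sub_nonneg.2 hxy) (Real.log_nonneg (by linarith))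
  linarith

/-- For x > 0 this says x log ((1 + x) / (2x)) + log ((1 + x) / 2) ≤ 0; the bounds log t ≤ t - 1 for
both logarithms add up to zero. -/
lemma logPrimitive_add_one_le {x : ℝ} (hx : 0 ≤ x) :
    logPrimitive x + 1 ≤ klFun x + (1 + x) * Real.log 2 := by
  rw [klFun_apply, logPrimitive]
  rcases hx.eq_or_lt with rfl | hx
  · simp [Real.log_nonneg]
  have h₁ := Real.log_le_sub_one_of_pos (x := (1 + x) / (2 * x)) (by positivity)
  have h₂ := Real.log_le_sub_one_of_pos (x := (1 + x) / 2) (by positivity)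
  rw [Real.log_div (by positivity) (by positivity), Real.log_mul (by norm_num) hx.ne'] at h₁
  rw [Real.log_div (by positivity) (by positivity)] at h₂
  have h₁' := mul_le_mul_of_nonneg_left h₁ hx.le
  have : x * ((1 + x) / (2 * x) - 1) = (1 + x) / 2 - x := by field_simp
  rw [this] at h₁'
  linarith

/-- Where the share is nonzero, `f` exceeds the level and has so far been exhausted exactly up to
it. -/
lemma sum_share_eq_level {i : ℕ} {u : 𝒰} (hu : f u ≠ ∞) (h : share η f i u ≠ 0) :
    ∑ j ∈ Finset.range i, share η f j u = level η f i := by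
  have hlt : level η f i < f u := by
    by_contra hle
    exact h (by simp [share, tsub_eq_zero_of_le (not_lt.1 hle)])
  have h₁ := sum_share_add (η := η) (f := f) i u
  have h₂ := add_tsub_cancel_of_le hlt.le
  exact (ENNReal.add_left_inj (ne_top_of_le_ne_top hu tsub_le_self)).1 (h₁.trans h₂.symm)

/-- By `sum_share_eq_level` this is a left Riemann sum of log (1 + x) over [0, f u], whose nodes are
the partial sums of the shares. -/
lemma sum_share_mul_log_le (hfin : ∀ u, f u ≠ ∞) (m : ℕ) (u : 𝒰) :
    ∑ i ∈ Finset.range m, share η f i u * ENNReal.ofReal (Real.log (1 + (level η f i).toReal)) ≤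
      ENNReal.ofReal (logPrimitive (f u).toReal) := by
  have hle : ∀ m, ∑ i ∈ Finset.range m, share η f i u ≤ f u := fun m =>
    le_self_add.trans_eq (sum_share_add m u)
  have hne : ∀ m, ∑ i ∈ Finset.range m, share η f i u ≠ ∞ := fun m =>
    ne_top_of_le_ne_top (hfin u) (hle m)
  suffices h : ∑ i ∈ Finset.range m,
      share η f i u * ENNReal.ofReal (Real.log (1 + (level η f i).toReal)) ≤
      ENNReal.ofReal (logPrimitive (∑ i ∈ Finset.range m, share η f i u).toReal) from
    h.trans (ENNReal.ofReal_le_ofReal (logPrimitive_mono ENNReal.toReal_nonneg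
      (ENNReal.toReal_mono (hfin u) (hle m))))
  induction m with
  | zero => simp
  | succ m ih =>
    have hg : share η f m u ≠ ∞ := by
      have := hne (m + 1)
      rw [Finset.sum_range_succ] at this
      exact (ENNReal.add_ne_top.1 this).2
    rw [Finset.sum_range_succ, Finset.sum_range_succ]
    refine (add_le_add_left ih _).trans ?_
    rcases eq_or_ne (share η f m u) 0 with h0 | h0
    · simp [h0]
    rw [← sum_share_eq_level (hfin u) h0, ENNReal.toReal_add (hne m) hg]
    set c := (∑ i ∈ Finset.range m, share η f i u).toReal
    have hc : 0 ≤ c := ENNReal.toReal_nonneg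
    rw [← ENNReal.ofReal_toReal hg, ← ENNReal.ofReal_mul ENNReal.toReal_nonneg,
      ← ENNReal.ofReal_add (logPrimitive_nonneg hc)
        (mul_nonneg ENNReal.toReal_nonneg (Real.log_nonneg (by linarith)))]
    refine ENNReal.ofReal_le_ofReal ?_
    rw [ENNReal.toReal_ofReal ENNReal.toReal_nonneg]
    have := mul_log_le_logPrimitive_sub hc (ENNReal.toReal_nonneg (a := share η f m u))
    linarith

/-- The share of round i integrates to the drop of the residual from round i to i + 1, so this is a
lower Riemann sum of -log over [0, 1], an integral equal to one. -/
lemma sum_lintegral_share_mul_log_residual_le (hf : Measurable f) (h1 : ∫⁻ u, f u ∂η = 1) (m : ℕ) :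
    ∑ i ∈ Finset.range m,
      (∫⁻ u, share η f i u ∂η) * ENNReal.ofReal (-Real.log (residual η f i).toReal) ≤ 1 := by
  have htop : ∀ i, residual η f i ≠ ∞ := fun i =>
    ((residual_le_one h1 i).trans_lt ENNReal.one_lt_top).ne
  have hle1 : ∀ i, (residual η f i).toReal ≤ 1 := fun i =>
    ENNReal.toReal_le_of_le_ofReal zero_le_one (by simpa using residual_le_one h1 i)
  -- The primitive of -log with χ 0 = 0 and χ 1 = 1; in the induction it accounts for the interval
  -- not yet covered.
  let χ : ℝ → ℝ := fun x => x - x * Real.log x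
  have hχ0 : ∀ x, 0 ≤ x → x ≤ 1 → 0 ≤ χ x := fun x h0 h1 => by
    have := mul_nonpos_of_nonneg_of_nonpos h0 (Real.log_nonpos h0 h1)
    simp only [χ]; linarith
  suffices h : ∑ i ∈ Finset.range m,
      (∫⁻ u, share η f i u ∂η) * ENNReal.ofReal (-Real.log (residual η f i).toReal) +
        ENNReal.ofReal (χ (residual η f m).toReal) ≤ 1 from le_self_add.trans h
  induction m with
  | zero => simp [residual_zero h1, χ]
  | succ m ih =>
    rw [Finset.sum_range_succ, add_assoc]
    refine le_trans (add_le_add_right ?_ _) ih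
    have hs := lintegral_share_add (η := η) hf m
    have hg : ∫⁻ u, share η f m u ∂η ≠ ∞ := ne_top_of_le_ne_top (htop m) (hs ▸ le_self_add)
    have hs' := congrArg ENNReal.toReal hs
    rw [ENNReal.toReal_add hg (htop _)] at hs'
    rw [← ENNReal.ofReal_toReal hg, ← ENNReal.ofReal_mul ENNReal.toReal_nonneg,
      ← ENNReal.ofReal_add (mul_nonneg ENNReal.toReal_nonneg (neg_nonneg.2
        (Real.log_nonpos ENNReal.toReal_nonneg (hle1 m))))
        (hχ0 _ ENNReal.toReal_nonneg (hle1 _))]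
    refine ENNReal.ofReal_le_ofReal ?_
    set x := (residual η f m).toReal
    set y := (residual η f (m + 1)).toReal
    have hgx : (∫⁻ u, share η f m u ∂η).toReal = x - y := by linarith
    rw [hgx]
    simp only [χ]
    have hy : 0 ≤ y := ENNReal.toReal_nonneg
    have hyx : y ≤ x := by
      have : 0 ≤ (∫⁻ u, share η f m u ∂η).toReal := ENNReal.toReal_nonneg
      linarith
    rcases hy.eq_or_lt with hy0 | hy0
    · rw [← hy0]; simp only [zero_mul, sub_zero]; nlinarith [hyx]
    have hx0 : 0 < x := hy0.trans_le hyx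
    have h := Real.log_le_sub_one_of_pos (x := x / y) (by positivity)
    rw [Real.log_div hx0.ne' hy0.ne'] at h
    have h' := mul_le_mul_of_nonneg_left h hy
    have : y * (x / y - 1) = x - y := by field_simp
    rw [this] at h'
    linarith

/-- The expected logarithm of the stopping index of greedy rejection sampling. -/
lemma tsum_share_mul_log_le (hf : Measurable f) (h1 : ∫⁻ u, f u ∂η = 1) (hfin : ∀ u, f u ≠ ∞)
    [IsProbabilityMeasure η] :
    ∑' i, (∫⁻ u, share η f i u ∂η) * ENNReal.ofReal (Real.log (i + 1)) ≤
      ∫⁻ u, ENNReal.ofReal (klFun (f u).toReal) ∂η + 2 * ENNReal.ofReal (Real.log 2) := by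
  have htop : ∀ i, residual η f i ≠ ∞ := fun i =>
    ((residual_le_one h1 i).trans_lt ENNReal.one_lt_top).ne
  -- From i * residual ≤ level and residual ≤ 1 one gets i + 1 ≤ (1 + level) / residual.
  have hterm : ∀ i : ℕ, (∫⁻ u, share η f i u ∂η) * ENNReal.ofReal (Real.log (i + 1)) ≤
      (∫⁻ u, share η f i u ∂η) * ENNReal.ofReal (Real.log (1 + (level η f i).toReal)) +
      (∫⁻ u, share η f i u ∂η) * ENNReal.ofReal (-Real.log (residual η f i).toReal) := fun i => by
    rcases eq_or_ne (residual η f i) 0 with h0 | h0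
    · simp [share, h0]
    have hpos : 0 < (residual η f i).toReal := ENNReal.toReal_pos h0 (htop i)
    have hle1 : (residual η f i).toReal ≤ 1 :=
      ENNReal.toReal_le_of_le_ofReal zero_le_one (by simpa using residual_le_one h1 i)
    have hl := ENNReal.toReal_mono (level_ne_top h1 i) (mul_residual_le_level (η := η) (f := f) i)
    rw [ENNReal.toReal_mul, ENNReal.toReal_natCast] at hl
    rw [← mul_add, ← ENNReal.ofReal_add (Real.log_nonneg (by
      have : 0 ≤ (level η f i).toReal := ENNReal.toReal_nonneg
      linarith)) (neg_nonneg.2 (Real.log_nonpos ENNReal.toReal_nonneg hle1))]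
    gcongr
    rw [← sub_eq_add_neg, ← Real.log_div (by positivity) hpos.ne']
    refine Real.log_le_log (by positivity) ?_
    rw [le_div_iff₀ hpos]
    linarith
  refine ENNReal.tsum_le_of_sum_range_le fun m => ?_
  calc ∑ i ∈ Finset.range m, (∫⁻ u, share η f i u ∂η) * ENNReal.ofReal (Real.log (i + 1))
      ≤ ∑ i ∈ Finset.range m,
          (∫⁻ u, share η f i u ∂η) * ENNReal.ofReal (Real.log (1 + (level η f i).toReal)) +
        ∑ i ∈ Finset.range m,
          (∫⁻ u, share η f i u ∂η) * ENNReal.ofReal (-Real.log (residual η f i).toReal) := by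
        rw [← Finset.sum_add_distrib]
        exact Finset.sum_le_sum fun i _ => hterm i
    _ ≤ ∫⁻ u, ENNReal.ofReal (logPrimitive (f u).toReal) ∂η + 1 := by
        refine add_le_add ?_ (sum_lintegral_share_mul_log_residual_le hf h1 m)
        rw [Finset.sum_congr rfl fun i _ => (lintegral_mul_const
          (ENNReal.ofReal (Real.log (1 + (level η f i).toReal)))
          (measurable_share (η := η) hf i)).symm,
          ← lintegral_finsetSum _ fun i _ => (measurable_share hf i).mul_const _]
        exact lintegral_mono fun u => sum_share_mul_log_le hfin m u
    _ = ∫⁻ u, (ENNReal.ofReal (logPrimitive (f u).toReal) + 1) ∂η := by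
        rw [lintegral_add_right _ measurable_const]; simp
    -- As 1 + f has integral two, the price of passing to `klFun` is 2 log 2, that is, two bits.
    _ ≤ ∫⁻ u, (ENNReal.ofReal (klFun (f u).toReal) + (1 + f u) * ENNReal.ofReal (Real.log 2)) ∂η := by
        refine lintegral_mono fun u => ?_
        have hu : 0 ≤ (f u).toReal := ENNReal.toReal_nonneg
        have hlog : 0 ≤ Real.log 2 := Real.log_nonneg (by norm_num)
        have hfu : 1 + f u = ENNReal.ofReal (1 + (f u).toReal) := by
          rw [ENNReal.ofReal_add zero_le_one hu, ENNReal.ofReal_one, ENNReal.ofReal_toReal (hfin u)]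
        rw [hfu, ← ENNReal.ofReal_mul (by positivity),
          ← ENNReal.ofReal_add (klFun_nonneg hu) (by positivity), ← ENNReal.ofReal_one,
          ← ENNReal.ofReal_add (logPrimitive_nonneg hu) zero_le_one]
        exact ENNReal.ofReal_le_ofReal (logPrimitive_add_one_le hu)
    _ = _ := by
        rw [lintegral_add_right _ (by fun_prop), lintegral_mul_const _ (by fun_prop),
          lintegral_add_right _ hf, h1]
        simp [one_add_one_eq_two]

variable {𝒮 : Type*} [MeasurableSpace 𝒮] {F : 𝒮 × 𝒰 → ℝ≥0∞} [SFinite η]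

lemma measurable_level (hF : Measurable F) (i : ℕ) :
    Measurable fun p => level η (fun u => F (p, u)) i := by
  induction i with
  | zero => simp [level]
  | succ i ih =>
    simp only [level]
    refine ih.add (Measurable.lintegral_prod_right' (f := fun q : 𝒮 × 𝒰 =>
      F q - level η (fun u => F (q.1, u)) i) ?_)
    exact hF.sub (ih.comp measurable_fst)

lemma measurable_residual (hF : Measurable F) (i : ℕ) :
    Measurable fun p => residual η (fun u => F (p, u)) i :=
  Measurable.lintegral_prod_right' (f := fun q : 𝒮 × 𝒰 => F q - level η (fun u => F (q.1, u)) i)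
    (hF.sub ((measurable_level hF i).comp measurable_fst))

lemma measurable_stopIndex (hF : Measurable F) :
    Measurable fun q : 𝒮 × (ℕ → 𝒰 × I) => stopIndex η (fun u => F (q.1, u)) q.2 := by
  have hacc : ∀ i, MeasurableSet {q : 𝒮 × (ℕ → 𝒰 × I) |
      q.2 i ∈ acceptSet η (fun u => F (q.1, u)) i} := fun i => by
    refine measurableSet_lt (f := fun q : 𝒮 × (ℕ → 𝒰 × I) =>
      ENNReal.ofReal (q.2 i).2 * residual η (fun u => F (q.1, u)) i)
      (g := fun q => F (q.1, (q.2 i).1) - level η (fun u => F (q.1, u)) i) ?_ ?_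
    · exact (ENNReal.measurable_ofReal.comp (by fun_prop)).mul
        ((measurable_residual hF i).comp measurable_fst)
    · exact (hF.comp (by fun_prop : Measurable fun q : 𝒮 × (ℕ → 𝒰 × I) => (q.1, (q.2 i).1))).sub
        ((measurable_level hF i).comp measurable_fst)
  refine measurable_of_Ici fun k => ?_
  -- For k = 0 every point qualifies, also those without an accepted sample, where `sInf ∅ = 0`. For
  -- k > 0 an accepted sample has to exist.
  have hset : (fun q : 𝒮 × (ℕ → 𝒰 × I) => stopIndex η (fun u => F (q.1, u)) q.2) ⁻¹' Set.Ici k =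
      if k = 0 then Set.univ else
      (⋂ i, ⋂ (_ : i < k), {q | q.2 i ∈ acceptSet η (fun u => F (q.1, u)) i}ᶜ) ∩
      ⋃ i, {q | q.2 i ∈ acceptSet η (fun u => F (q.1, u)) i} := by
    split_ifs with hk
    · ext q; simp [hk]
    ext q
    simp only [Set.mem_preimage, Set.mem_Ici, Set.mem_inter_iff, Set.mem_iInter, Set.mem_compl_iff,
      Set.mem_iUnion, Set.mem_ofPred_eq]
    constructor
    · intro h
      have hne : {i | q.2 i ∈ acceptSet η (fun u => F (q.1, u)) i}.Nonempty := by
        refine Nat.nonempty_of_pos_sInf (lt_of_lt_of_le (Nat.pos_of_ne_zero hk) h)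
      exact ⟨fun i hi hmem => absurd (h.trans (Nat.sInf_le hmem)) (not_le.2 hi), hne⟩
    · rintro ⟨h₁, i, hi⟩
      refine le_csInf ⟨i, hi⟩ fun j hj => ?_
      by_contra hlt
      exact h₁ j (not_le.1 hlt) hj
  rw [hset]
  split_ifs
  · exact MeasurableSet.univ
  · exact (MeasurableSet.iInter fun i => .iInter fun _ => (hacc i).compl).inter
      (MeasurableSet.iUnion hacc)

end StoppingIndex

/-! ### A prefix code for the accepted index -/

section RiceCode

lemma uniquelyDecodable_of_prefixFree {α : Type*} {S : Set (List α)} (h0 : [] ∉ S)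
    (h : ∀ a ∈ S, ∀ b ∈ S, ∀ s t : List α, a ++ s = b ++ t → a = b) : UniquelyDecodable S := by
  intro L₁
  induction L₁ with
  | nil =>
    intro L₂ _ h₂ heq
    cases L₂ with
    | nil => rfl
    | cons b L₂ =>
      have hb := h₂ b (by simp)
      simp only [List.flatten_nil, List.flatten_cons] at heq
      have : b = [] := (List.append_eq_nil_iff.1 heq.symm).1
      exact absurd (this ▸ hb) h0
  | cons a L₁ ih =>
    intro L₂ h₁ h₂ heq
    have ha := h₁ a (by simp)
    cases L₂ with
    | nil =>
      simp only [List.flatten_nil, List.flatten_cons] at heq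
      have : a = [] := (List.append_eq_nil_iff.1 heq).1
      exact absurd (this ▸ ha) h0
    | cons b L₂ =>
      simp only [List.flatten_cons] at heq
      obtain rfl := h a ha b (h₂ b (by simp)) _ _ heq
      rw [ih L₂ (fun w hw => h₁ w (by simp [hw])) (fun w hw => h₂ w (by simp [hw]))
        (List.append_cancel_left heq)]

/-- The `n` lowest binary digits of `v`. -/
def lowBits (n v : ℕ) : List Bool := List.ofFn fun i : Fin n => v.testBit i

lemma length_lowBits (n v : ℕ) : (lowBits n v).length = n := by simp [lowBits]

lemma lowBits_inj {n v v' : ℕ} (hv : v < 2 ^ n) (hv' : v' < 2 ^ n)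
    (h : lowBits n v = lowBits n v') : v = v' := by
  refine Nat.eq_of_testBit_eq fun i => ?_
  by_cases hi : i < n
  · exact congrFun (List.ofFn_injective h) ⟨i, hi⟩
  · have hpow : 2 ^ n ≤ 2 ^ i := Nat.pow_le_pow_right (by norm_num) (not_lt.1 hi)
    rw [Nat.testBit_lt_two_pow (hv.trans_le hpow), Nat.testBit_lt_two_pow (hv'.trans_le hpow)]

/-- A prefix code of the natural numbers: with `b = ⌊log₂ (k + 1)⌋`, the Golomb-Rice code of `b`
with parameter `j`, followed by the lowest `b` binary digits of `k + 1`. -/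
def riceCode (j k : ℕ) : List Bool :=
  List.replicate (Nat.log 2 (k + 1) / 2 ^ j) true ++
    false :: (lowBits j (Nat.log 2 (k + 1) % 2 ^ j) ++
      lowBits (Nat.log 2 (k + 1)) (k + 1 - 2 ^ Nat.log 2 (k + 1)))

lemma length_riceCode (j k : ℕ) :
    (riceCode j k).length = Nat.log 2 (k + 1) / 2 ^ j + 1 + j + Nat.log 2 (k + 1) := by
  simp [riceCode, length_lowBits]
  ring

lemma replicate_true_append_inj {a a' : ℕ} {r r' : List Bool}
    (h : List.replicate a true ++ false :: r = List.replicate a' true ++ false :: r') :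
    a = a' ∧ r = r' := by
  induction a generalizing a' with
  | zero =>
    cases a' with
    | zero => simpa using h
    | succ a' => simp [List.replicate_succ] at h
  | succ a ih =>
    cases a' with
    | zero => simp [List.replicate_succ] at h
    | succ a' =>
      simp only [List.replicate_succ, List.cons_append, List.cons.injEq, true_and] at h
      obtain ⟨h₁, h₂⟩ := ih h
      exact ⟨by rw [h₁], h₂⟩

/-- Decoding from the left: the first `false` ends the quotient, the next j bits are the remainder,
and together they give b, hence the length of the last field. -/
lemma riceCode_append_inj {j k k' : ℕ} {s t : List Bool}
    (h : riceCode j k ++ s = riceCode j k' ++ t) : k = k' := by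
  simp only [riceCode, List.append_assoc, List.cons_append] at h
  obtain ⟨hq, h⟩ := replicate_true_append_inj h
  obtain ⟨hr, h⟩ := List.append_inj h (by simp [length_lowBits])
  have hr' := lowBits_inj (Nat.mod_lt _ (by positivity)) (Nat.mod_lt _ (by positivity)) hr
  have hb : Nat.log 2 (k + 1) = Nat.log 2 (k' + 1) := by
    rw [← Nat.div_add_mod (Nat.log 2 (k + 1)) (2 ^ j), hq, hr', Nat.div_add_mod]
  have h := (List.append_inj h (by simp [length_lowBits, hb])).1
  have hlow : ∀ k : ℕ, 2 ^ Nat.log 2 (k + 1) ≤ k + 1 := fun k => Nat.pow_log_le_self 2 (by omega)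
  have hup : ∀ k : ℕ, k + 1 < 2 ^ Nat.log 2 (k + 1) * 2 := fun k => by
    rw [← pow_succ]; exact Nat.lt_pow_succ_log_self (by norm_num) _
  have h₁ := hlow k
  have h₂ := hup k
  have h₃ := hlow k'
  have h₄ := hup k'
  rw [← hb] at h h₃ h₄
  have := lowBits_inj (by omega) (by omega) h
  omega

lemma riceCode_injective (j : ℕ) : Function.Injective (riceCode j) := fun k k' h =>
  riceCode_append_inj (s := []) (t := []) (by rw [h])

lemma uniquelyDecodable_of_subset_riceCode {j : ℕ} {S : Set (List Bool)}
    (hS : S ⊆ Set.range (riceCode j)) : UniquelyDecodable S := by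
  refine uniquelyDecodable_of_prefixFree (fun h => ?_) fun a ha b hb s t hab => ?_
  · obtain ⟨k, hk⟩ := hS h
    simp [riceCode] at hk
  · obtain ⟨k, rfl⟩ := hS ha
    obtain ⟨k', rfl⟩ := hS hb
    rw [riceCode_append_inj hab]

lemma length_riceCode_le (j k : ℕ) :
    ((riceCode j k).length : ℝ) ≤ (1 + 1 / 2 ^ j) * Real.logb 2 (k + 1) + 1 + j := by
  rw [length_riceCode]
  have h₁ : (Nat.log 2 (k + 1) : ℝ) ≤ Real.logb 2 (k + 1) := by
    have := Real.natLog_le_logb (k + 1) 2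
    push_cast at this
    exact this
  have h₂ : ((Nat.log 2 (k + 1) / 2 ^ j : ℕ) : ℝ) ≤ Real.logb 2 (k + 1) / 2 ^ j := by
    refine Nat.cast_div_le.trans ?_
    push_cast
    gcongr
  push_cast
  have h₃ : (1 + 1 / 2 ^ j) * Real.logb 2 (k + 1) =
      Real.logb 2 (k + 1) + Real.logb 2 (k + 1) / 2 ^ j := by ring
  rw [h₃]
  linarith

/-- Here a + 2 stands for the bound on the expected binary logarithm of the accepted index plus one.
With 2 ^ j ≤ a + 2 < 2 ^ (j + 1) and a + 2 = 2 ^ j (1 + u), the left side is a + 4 + u + j. -/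
lemma exists_rice_parameter {a : ℝ} (ha : 0 ≤ a) :
    ∃ j : ℕ, (1 + 1 / 2 ^ j) * (a + 2) + 1 + j ≤ a + Real.logb 2 (a + 1) + 5 := by
  obtain ⟨j, hj₁, hj₂⟩ := exists_nat_pow_near (x := a + 2) (y := 2) (by linarith) (by norm_num)
  refine ⟨j, ?_⟩
  have hj : 1 ≤ j := by
    by_contra h
    have : j = 0 := by omega
    subst this
    norm_num at hj₂
    linarith
  have hpow : (2 : ℝ) ≤ 2 ^ j := by
    calc (2 : ℝ) = 2 ^ 1 := by norm_num
      _ ≤ 2 ^ j := pow_le_pow_right₀ (by norm_num) hj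
  set T : ℝ := 2 ^ j
  have hT : 0 < T := by positivity
  set u : ℝ := (a + 2) / T - 1 with hu
  have hu0 : 0 ≤ u := by rw [hu, sub_nonneg, le_div_iff₀ hT]; linarith
  have hu1 : u ≤ 1 := by
    rw [hu, sub_le_iff_le_add, div_le_iff₀ hT]
    rw [pow_succ] at hj₂
    linarith
  have haT : a + 2 = T * (1 + u) := by rw [hu]; field_simp; ring
  have hb : (2 : ℝ) ^ u ≤ 1 + u := by
    have := rpow_one_add_le_one_add_mul_self (s := 1) (by norm_num) hu0 hu1
    norm_num at this
    linarith
  -- By 2 ^ u ≤ 1 + u on [0, 1], the number 2 ^ (u + j - 1) is at most (a + 2) / 2 ≤ a + 1.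
  have hlog : u + j - 1 ≤ Real.logb 2 (a + 1) := by
    rw [Real.le_logb_iff_rpow_le (by norm_num) (by linarith)]
    have : (2 : ℝ) ^ (u + j - 1) = 2 ^ u * T / 2 := by
      rw [Real.rpow_sub (by norm_num), Real.rpow_add (by norm_num), Real.rpow_natCast, Real.rpow_one]
    rw [this]
    have h₁ : (2 : ℝ) ^ u * T ≤ (1 + u) * T := by gcongr
    nlinarith
  have : (1 + 1 / T) * (a + 2) = a + 2 + (1 + u) := by
    rw [haT]; field_simp
  rw [this]
  linarith

end RiceCode

/-! ### Channel simulation by variable-length codecs -/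

section Simulation

variable {𝒮 𝒰 : Type*} [MeasurableSpace 𝒮] [MeasurableSpace 𝒰] {η : Measure 𝒰}
  [IsProbabilityMeasure η] {F : 𝒮 × 𝒰 → ℝ≥0∞} {μ : Measure 𝒮} [IsProbabilityMeasure μ]

/-- One uniform variable carries all samples and, independently of them, a spare uniform variable,
which only the fixed-length codec needs. -/
lemma exists_sampler [StandardBorelSpace 𝒰] (η : Measure 𝒰) [IsProbabilityMeasure η] :
    ∃ θ : I → (ℕ → 𝒰 × I) × I, Measurable θ ∧
      (volume : Measure I).map θ = (sampleLaw η).prod volume := by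
  have : Nonempty 𝒰 := nonempty_of_isProbabilityMeasure η
  exact Measure.exists_measurable_map_eq _

lemma measurable_eval_nat {α : Type*} [MeasurableSpace α] :
    Measurable fun q : (ℕ → α) × ℕ => q.1 q.2 :=
  measurable_from_prod_countable_left fun k => measurable_pi_apply k

/-- The index of the first accepted sample, for a family of densities. -/
noncomputable def stopTime (η : Measure 𝒰) (F : 𝒮 × 𝒰 → ℝ≥0∞) (p : 𝒮) (ω : ℕ → 𝒰 × I) : ℕ :=
  stopIndex η (fun u => F (p, u)) ω

/-- The first accepted sample, for a family of densities. -/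
noncomputable def stopSample (η : Measure 𝒰) (F : 𝒮 × 𝒰 → ℝ≥0∞) (p : 𝒮) (ω : ℕ → 𝒰 × I) : 𝒰 :=
  (ω (stopTime η F p ω)).1

lemma measurable_stopTime (hF : Measurable F) :
    Measurable fun q : 𝒮 × (ℕ → 𝒰 × I) => stopTime η F q.1 q.2 :=
  measurable_stopIndex hF

lemma measurable_stopSample (hF : Measurable F) :
    Measurable fun q : 𝒮 × (ℕ → 𝒰 × I) => stopSample η F q.1 q.2 :=
  (measurable_eval_nat.comp (measurable_snd.prodMk (measurable_stopTime hF))).fst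

lemma stopTime_eq (p : 𝒮) (ω : ℕ → 𝒰 × I) :
    stopTime η F p ω = stopIndex η (fun u => F (p, u)) ω := rfl

lemma stopSample_eq (p : 𝒮) (ω : ℕ → 𝒰 × I) :
    stopSample η F p ω = (ω (stopTime η F p ω)).1 := rfl

attribute [irreducible] stopTime stopSample

lemma measurable_stopTime_comp {α : Type*} [MeasurableSpace α] (hF : Measurable F) {g : α → 𝒮}
    {h : α → ℕ → 𝒰 × I} (hg : Measurable g) (hh : Measurable h) :
    Measurable fun a => stopTime η F (g a) (h a) :=
  (measurable_stopTime hF).comp (hg.prodMk hh)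

/-- Fubini reduces the claim to a fixed source value and a fixed spare variable, where
`lintegral_stopIndex` gives the joint law of accepted sample and index. -/
lemma lintegral_sampler {θ : I → (ℕ → 𝒰 × I) × I} (hθ : Measurable θ)
    (hθη : (volume : Measure I).map θ = (sampleLaw η).prod volume) (hF : Measurable F)
    (h1 : ∀ᵐ p ∂μ, ∫⁻ u, F (p, u) ∂η = 1) {G : 𝒮 → 𝒰 → ℕ → I → ℝ≥0∞}
    (hG : ∀ k, Measurable fun q : 𝒮 × 𝒰 × I => G q.1 q.2.1 k q.2.2) :
    ∫⁻ t, G t.1 (stopSample η F t.1 (θ t.2).1) (stopTime η F t.1 (θ t.2).1) (θ t.2).2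
        ∂(μ.prod (volume : Measure I)) =
      ∫⁻ p, ∫⁻ v, ∑' k, ∫⁻ u, share η (fun u => F (p, u)) k u * G p u k v ∂η
        ∂(volume : Measure I) ∂μ := by
  have hT := measurable_stopTime (η := η) hF
  have hS := measurable_stopSample (η := η) hF
  have hG' : Measurable fun q : (𝒮 × 𝒰 × I) × ℕ => G q.1.1 q.1.2.1 q.2 q.1.2.2 :=
    measurable_from_prod_countable_left hG
  have hG₂ : Measurable fun q : 𝒮 × (ℕ → 𝒰 × I) × I =>
      G q.1 (stopSample η F q.1 q.2.1) (stopTime η F q.1 q.2.1) q.2.2 := by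
    have h : Measurable fun q : 𝒮 × (ℕ → 𝒰 × I) × I =>
        ((q.1, stopSample η F q.1 q.2.1, q.2.2), stopTime η F q.1 q.2.1) := by
      have h' : Measurable fun q : 𝒮 × (ℕ → 𝒰 × I) × I => (q.1, q.2.1) := by fun_prop
      have hT' := hT.comp h'
      have hS' := hS.comp h'
      exact (measurable_fst.prodMk (hS'.prodMk measurable_snd.snd)).prodMk hT'
    exact hG'.comp h
  have hG₃ : Measurable fun t : 𝒮 × I =>
      G t.1 (stopSample η F t.1 (θ t.2).1) (stopTime η F t.1 (θ t.2).1) (θ t.2).2 := by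
    have h : Measurable fun t : 𝒮 × I => (t.1, θ t.2) := by fun_prop
    exact hG₂.comp h
  rw [lintegral_prod _ hG₃.aemeasurable]
  refine lintegral_congr_ae ?_
  filter_upwards [h1] with p hp
  have hFp : Measurable fun u => F (p, u) := hF.comp measurable_prodMk_left
  have hGp : Measurable fun q : (ℕ → 𝒰 × I) × I =>
      G p (stopSample η F p q.1) (stopTime η F p q.1) q.2 := hG₂.comp measurable_prodMk_left
  calc ∫⁻ w, G p (stopSample η F p (θ w).1) (stopTime η F p (θ w).1) (θ w).2
      = ∫⁻ q, G p (stopSample η F p q.1) (stopTime η F p q.1) q.2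
          ∂(sampleLaw η).prod volume := by
        rw [← hθη, lintegral_map hGp hθ]
    _ = ∫⁻ v, ∫⁻ ω, G p (stopSample η F p ω) (stopTime η F p ω) v ∂sampleLaw η :=
        lintegral_prod_symm _ hGp.aemeasurable
    _ = _ := by
        refine lintegral_congr fun v => ?_
        simp only [stopSample_eq, stopTime_eq]
        refine lintegral_stopIndex hFp hp (G := fun u k => G p u k v) fun k => ?_
        have h : Measurable fun u : 𝒰 => (p, u, v) := by fun_prop
        exact (hG k).comp h

variable {𝒴 𝒳 : Type*} [MeasurableSpace 𝒴] [MeasurableSpace 𝒳]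

lemma lintegral_tsum_share_mul {f : 𝒰 → ℝ≥0∞} (hf : Measurable f) (h1 : ∫⁻ u, f u ∂η = 1)
    {g : 𝒰 → ℝ≥0∞} (hg : Measurable g) :
    ∑' k, ∫⁻ u, share η f k u * g u ∂η = ∫⁻ u, f u * g u ∂η := by
  have hm : ∀ k, AEMeasurable (fun u => share η f k u * g u) η := fun k =>
    ((measurable_share hf k).mul hg).aemeasurable
  rw [← lintegral_tsum hm]
  refine lintegral_congr_ae ?_
  filter_upwards [tsum_share_ae_eq hf h1] with u hu
  rw [ENNReal.tsum_mul_right, ← hu]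

/-- The Rice length is bounded by an affine function of log₂ (k + 1); the excess 2 log 2 in the
expected natural logarithm becomes the term (1 + 1 / 2 ^ j) * 2. -/
lemma tsum_share_mul_length_le {f : 𝒰 → ℝ≥0∞} (hf : Measurable f) (h1 : ∫⁻ u, f u ∂η = 1)
    (hfin : ∀ u, f u ≠ ∞) (j : ℕ) :
    ∑' k, ∫⁻ u, share η f k u * ((riceCode j k).length : ℝ≥0∞) ∂η ≤
      ENNReal.ofReal ((1 + 1 / 2 ^ j) / Real.log 2) * ∫⁻ u, ENNReal.ofReal (klFun (f u).toReal) ∂η +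
        ENNReal.ofReal ((1 + 1 / 2 ^ j) * 2 + 1 + j) := by
  have hlog2 : 0 < Real.log 2 := Real.log_pos (by norm_num)
  set C : ℝ := (1 + 1 / 2 ^ j) / Real.log 2 with hC
  have hC0 : 0 ≤ C := by positivity
  have hlen : ∀ k : ℕ, ((riceCode j k).length : ℝ≥0∞) ≤
      ENNReal.ofReal C * ENNReal.ofReal (Real.log (k + 1)) + ENNReal.ofReal (1 + j) := fun k => by
    have hlog : 0 ≤ Real.log ((k : ℝ) + 1) := Real.log_nonneg (by linarith [k.cast_nonneg (α := ℝ)])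
    rw [← ENNReal.ofReal_mul hC0, ← ENNReal.ofReal_add (by positivity) (by positivity),
      ← ENNReal.ofReal_natCast]
    refine ENNReal.ofReal_le_ofReal ((length_riceCode_le j k).trans_eq ?_)
    rw [Real.logb, hC]
    ring
  have hshare : ∀ k, ∫⁻ u, share η f k u * ((riceCode j k).length : ℝ≥0∞) ∂η =
      (∫⁻ u, share η f k u ∂η) * (riceCode j k).length := fun k =>
    lintegral_mul_const _ (measurable_share hf k)
  calc ∑' k, ∫⁻ u, share η f k u * ((riceCode j k).length : ℝ≥0∞) ∂η
      ≤ ∑' k : ℕ, (ENNReal.ofReal C * ((∫⁻ u, share η f k u ∂η) * ENNReal.ofReal (Real.log (k + 1)))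
          + (∫⁻ u, share η f k u ∂η) * ENNReal.ofReal (1 + j)) := by
        refine ENNReal.tsum_le_tsum fun k => ?_
        rw [hshare]
        refine (mul_le_mul_right (hlen k) _).trans_eq ?_
        ring
    _ ≤ ENNReal.ofReal C * (∫⁻ u, ENNReal.ofReal (klFun (f u).toReal) ∂η +
          2 * ENNReal.ofReal (Real.log 2)) + ENNReal.ofReal (1 + j) := by
        rw [ENNReal.tsum_add, ENNReal.tsum_mul_left, ENNReal.tsum_mul_right,
          tsum_lintegral_share hf h1, one_mul]
        gcongr
        exact tsum_share_mul_log_le hf h1 hfin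
    _ = _ := by
        have h2 : ENNReal.ofReal C * (2 * ENNReal.ofReal (Real.log 2)) =
            ENNReal.ofReal ((1 + 1 / 2 ^ j) * 2) := by
          rw [← ENNReal.ofReal_ofNat, ← ENNReal.ofReal_mul (by norm_num), ← ENNReal.ofReal_mul hC0]
          congr 1
          rw [hC]; field_simp
        rw [mul_add, h2, add_assoc, ← ENNReal.ofReal_add (by positivity) (by positivity), add_assoc]

/-- Exact simulation of the law of density `F` by a variable-length codec. -/
lemma exists_codec_of_density [StandardBorelSpace 𝒰] {μ : Measure (𝒴 × 𝒳)} [IsProbabilityMeasure μ]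
    {φ : 𝒴 × 𝒰 → 𝒳} (hφ : Measurable φ) {F : (𝒴 × 𝒳) × 𝒰 → ℝ≥0∞} (hF : Measurable F)
    (hfin : ∀ q, F q ≠ ∞) (h1 : ∀ᵐ p ∂μ, ∫⁻ u, F (p, u) ∂η = 1) {a : ℝ} (ha : 0 ≤ a)
    (hkl : ∫⁻ q, ENNReal.ofReal (klFun (F q).toReal) ∂(μ.prod η) ≤
      ENNReal.ofReal (a * Real.log 2)) :
    ∃ c : SharedCodec 𝒴 𝒳 (List Bool), c.IsUniquelyDecodable ∧
      c.rate μ ≤ ENNReal.ofReal (a + Real.logb 2 (a + 1) + 5) ∧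
      c.law μ = ((μ.prod η).withDensity F).map fun q => (q.1.1, q.1.2, φ (q.1.1, q.2)) := by
  obtain ⟨θ, hθ, hθη⟩ := exists_sampler η
  obtain ⟨j, hj⟩ := exists_rice_parameter ha
  have hK : Measurable fun t : (𝒴 × 𝒳) × I => stopTime η F t.1 (θ t.2).1 := by
    exact measurable_stopTime_comp hF measurable_fst (hθ.comp measurable_snd).fst
  have hD : Measurable fun t : (𝒴 × List Bool) × I =>
      (t.1.1, ((θ t.2).1 (Function.invFun (riceCode j) t.1.2)).1) := by
    have h : Measurable fun t : (𝒴 × List Bool) × I =>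
        ((θ t.2).1, Function.invFun (riceCode j) t.1.2) :=
      (hθ.comp measurable_snd).fst.prodMk
        ((Measurable.of_discrete (f := Function.invFun (riceCode j))).comp measurable_fst.snd)
    exact measurable_fst.fst.prodMk (measurable_eval_nat.comp h).fst
  -- The parameter j depends on `a` alone, so one prefix code serves all y and w. The decoder
  -- regenerates the samples from w and picks the one whose index it receives.
  let c : SharedCodec 𝒴 𝒳 (List Bool) :=
    { enc := fun t => riceCode j (stopTime η F t.1 (θ t.2).1)
      dec := fun t => φ (t.1.1, ((θ t.2).1 (Function.invFun (riceCode j) t.1.2)).1)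
      measurable_enc := (measurable_from_nat (f := riceCode j)).comp hK
      measurable_dec := hφ.comp hD }
  refine ⟨c, fun y w => uniquelyDecodable_of_subset_riceCode (j := j) ?_, ?_, ?_⟩
  · rintro _ ⟨x, rfl⟩
    exact ⟨_, rfl⟩
  · have hlog2 : 0 < Real.log 2 := Real.log_pos (by norm_num)
    have hr : c.rate μ = ∫⁻ p, ∫⁻ _v : I, ∑' k, ∫⁻ u, share η (fun u => F (p, u)) k u *
        ((riceCode j k).length : ℝ≥0∞) ∂η ∂volume ∂μ :=
      lintegral_sampler hθ hθη hF h1 (G := fun _ _ k _ => ((riceCode j k).length : ℝ≥0∞))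
        fun k => measurable_const
    rw [hr]
    simp only [lintegral_const, measure_univ, mul_one]
    calc ∫⁻ p, ∑' k, ∫⁻ u, share η (fun u => F (p, u)) k u *
          ((riceCode j k).length : ℝ≥0∞) ∂η ∂μ
        ≤ ∫⁻ p, (ENNReal.ofReal ((1 + 1 / 2 ^ j) / Real.log 2) *
            ∫⁻ u, ENNReal.ofReal (klFun (F (p, u)).toReal) ∂η +
            ENNReal.ofReal ((1 + 1 / 2 ^ j) * 2 + 1 + j)) ∂μ := by
          refine lintegral_mono_ae ?_
          filter_upwards [h1] with p hp
          exact tsum_share_mul_length_le (hF.comp measurable_prodMk_left) hp (fun u => hfin _) j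
      _ = ENNReal.ofReal ((1 + 1 / 2 ^ j) / Real.log 2) *
            ∫⁻ q, ENNReal.ofReal (klFun (F q).toReal) ∂(μ.prod η) +
            ENNReal.ofReal ((1 + 1 / 2 ^ j) * 2 + 1 + j) := by
          have hm : Measurable fun q => ENNReal.ofReal (klFun (F q).toReal) := by fun_prop
          rw [lintegral_add_right _ measurable_const, lintegral_const_mul _
            hm.lintegral_prod_right', lintegral_prod _ hm.aemeasurable]
          simp
      _ ≤ ENNReal.ofReal ((1 + 1 / 2 ^ j) / Real.log 2) * ENNReal.ofReal (a * Real.log 2) +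
            ENNReal.ofReal ((1 + 1 / 2 ^ j) * 2 + 1 + j) := by gcongr
      _ ≤ _ := by
          rw [← ENNReal.ofReal_mul (by positivity), ← ENNReal.ofReal_add (by positivity)
            (by positivity)]
          refine ENNReal.ofReal_le_ofReal (le_trans (le_of_eq ?_) hj)
          field_simp
          ring
  · ext A hA
    have hψ : Measurable fun q : (𝒴 × 𝒳) × 𝒰 => (q.1.1, q.1.2, φ (q.1.1, q.2)) :=
      measurable_fst.fst.prodMk (measurable_fst.snd.prodMk
        (hφ.comp (measurable_fst.fst.prodMk measurable_snd)))
    have hm : Measurable fun q : (𝒴 × 𝒳) × 𝒰 =>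
        A.indicator (fun _ => (1 : ℝ≥0∞)) (q.1.1, q.1.2, φ (q.1.1, q.2)) :=
      (measurable_const.indicator hA).comp hψ
    have hl : c.law μ A = ∫⁻ p, ∫⁻ _v : I, ∑' k, ∫⁻ u, share η (fun u => F (p, u)) k u *
        A.indicator (fun _ => 1) (p.1, p.2, φ (p.1, u)) ∂η ∂volume ∂μ := by
      have hG : ∀ _ : ℕ, Measurable fun q : (𝒴 × 𝒳) × 𝒰 × I =>
          A.indicator (fun _ => (1 : ℝ≥0∞)) (q.1.1, q.1.2, φ (q.1.1, q.2.1)) := fun _ => by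
        have h : Measurable fun q : (𝒴 × 𝒳) × 𝒰 × I => (q.1, q.2.1) := by fun_prop
        exact hm.comp h
      rw [← lintegral_sampler hθ hθη hF h1
        (G := fun p u _ _ => A.indicator (fun _ => 1) (p.1, p.2, φ (p.1, u))) hG]
      have hlaw : Measurable fun t : (𝒴 × 𝒳) × I => (t.1.1, t.1.2, c.dec ((t.1.1, c.enc t), t.2)) :=
        measurable_fst.fst.prodMk (measurable_fst.snd.prodMk (c.measurable_dec.comp
          ((measurable_fst.fst.prodMk c.measurable_enc).prodMk measurable_snd)))
      rw [SharedCodec.law, ← lintegral_indicator_one hA, lintegral_map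
        (measurable_one.indicator hA) hlaw]
      refine lintegral_congr fun t => ?_
      simp only [c]
      rw [Function.leftInverse_invFun (riceCode_injective j), ← stopSample_eq]
      rfl
    rw [hl, Measure.map_apply hψ hA, withDensity_apply _ (hψ hA), ← lintegral_indicator (hψ hA),
      lintegral_prod _ (hF.indicator (hψ hA)).aemeasurable]
    simp only [lintegral_const, measure_univ, mul_one]
    refine lintegral_congr_ae ?_
    filter_upwards [h1] with p hp
    have hFp : Measurable fun u => F (p, u) := hF.comp measurable_prodMk_left
    have hmp : Measurable fun u => A.indicator (fun _ => (1 : ℝ≥0∞)) (p.1, p.2, φ (p.1, u)) :=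
      hm.comp measurable_prodMk_left
    rw [lintegral_tsum_share_mul hFp hp hmp]
    refine lintegral_congr fun u => ?_
    by_cases hu : (p.1, p.2, φ (p.1, u)) ∈ A
    · have hu' : (p, u) ∈ (fun q : (𝒴 × 𝒳) × 𝒰 => (q.1.1, q.1.2, φ (q.1.1, q.2))) ⁻¹' A := hu
      rw [Set.indicator_of_mem hu', Set.indicator_of_mem hu, mul_one]
    · have hu' : (p, u) ∉ (fun q : (𝒴 × 𝒳) × 𝒰 => (q.1.1, q.1.2, φ (q.1.1, q.2))) ⁻¹' A := hu
      rw [Set.indicator_of_notMem hu', Set.indicator_of_notMem hu, mul_zero]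

/-- A version of the density of a law with source marginal `μ` with respect to the law of
`(Y, X, φ (Y, U))`. -/
lemma exists_density {μ : Measure (𝒴 × 𝒳)} [IsProbabilityMeasure μ] {φ : 𝒴 × 𝒰 → 𝒳}
    (hφ : Measurable φ) {γ : Measure (𝒴 × 𝒳 × 𝒳)} [IsProbabilityMeasure γ]
    (hγ : γ.map (fun t => (t.1, t.2.1)) = μ)
    (hac : γ ≪ (μ.prod η).map fun q => (q.1.1, q.1.2, φ (q.1.1, q.2))) :
    ∃ F : (𝒴 × 𝒳) × 𝒰 → ℝ≥0∞, Measurable F ∧ (∀ q, F q ≠ ∞) ∧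
      (∀ᵐ p ∂μ, ∫⁻ u, F (p, u) ∂η = 1) ∧
      γ = ((μ.prod η).withDensity F).map (fun q => (q.1.1, q.1.2, φ (q.1.1, q.2))) ∧
      ∫⁻ q, ENNReal.ofReal (klFun (F q).toReal) ∂(μ.prod η) =
        klDiv γ ((μ.prod η).map fun q => (q.1.1, q.1.2, φ (q.1.1, q.2))) ∧
      (∀ q, F q = ENNReal.ofReal ((γ.rnDeriv ((μ.prod η).map fun q => (q.1.1, q.1.2, φ (q.1.1, q.2)))
        (q.1.1, q.1.2, φ (q.1.1, q.2))).toReal)) := by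
  set ψ : (𝒴 × 𝒳) × 𝒰 → 𝒴 × 𝒳 × 𝒳 := fun q => (q.1.1, q.1.2, φ (q.1.1, q.2)) with hψdef
  have hψ : Measurable ψ := measurable_fst.fst.prodMk (measurable_fst.snd.prodMk
    (hφ.comp (measurable_fst.fst.prodMk measurable_snd)))
  set ν := (μ.prod η).map ψ
  have : IsProbabilityMeasure ν := Measure.isProbabilityMeasure_map hψ.aemeasurable
  -- The detour through the reals makes the density finite everywhere instead of almost everywhere.
  let f : 𝒴 × 𝒳 × 𝒳 → ℝ≥0∞ := fun t => ENNReal.ofReal (γ.rnDeriv ν t).toReal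
  have hf : Measurable f := by fun_prop
  have hfae : f =ᵐ[ν] γ.rnDeriv ν := by
    filter_upwards [γ.rnDeriv_lt_top ν] with t ht
    exact ENNReal.ofReal_toReal ht.ne
  have hγf : γ = ν.withDensity f := by
    rw [withDensity_congr_ae hfae, Measure.withDensity_rnDeriv_eq _ _ hac]
  have hlaw : γ = ((μ.prod η).withDensity fun q => f (ψ q)).map ψ := by
    ext A hA
    rw [Measure.map_apply hψ hA, withDensity_apply _ (hψ hA), hγf, withDensity_apply _ hA,
      setLIntegral_map hA hf hψ]
  refine ⟨fun q => f (ψ q), hf.comp hψ, fun q => ENNReal.ofReal_ne_top, ?_, hlaw, ?_, fun q => rfl⟩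
  -- For a set B of source values, the density integrates to the γ-mass of B, which is μ B because γ
  -- has source marginal μ.
  · have hmeas : Measurable fun p => ∫⁻ u, f (ψ (p, u)) ∂η := (hf.comp hψ).lintegral_prod_right'
    refine ae_eq_of_forall_setLIntegral_eq_of_sigmaFinite hmeas measurable_const
      fun B hB _ => ?_
    rw [setLIntegral_one]
    have hm : Measurable fun q => f (ψ q) := hf.comp hψ
    calc ∫⁻ p in B, ∫⁻ u, f (ψ (p, u)) ∂η ∂μ
        = ∫⁻ q in Prod.fst ⁻¹' B, f (ψ q) ∂(μ.prod η) := by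
          rw [← lintegral_indicator hB, ← lintegral_indicator (measurable_fst hB),
            lintegral_prod _ (hm.indicator (measurable_fst hB)).aemeasurable]
          refine lintegral_congr fun p => ?_
          by_cases hp : p ∈ B
          · simp [Set.indicator, hp]
          · simp [Set.indicator, hp]
      _ = γ ((fun t => (t.1, t.2.1)) ⁻¹' B) := by
          have hB' : MeasurableSet ((fun t : 𝒴 × 𝒳 × 𝒳 => (t.1, t.2.1)) ⁻¹' B) :=
            (show Measurable fun t : 𝒴 × 𝒳 × 𝒳 => (t.1, t.2.1) by fun_prop) hB
          conv_rhs => rw [hlaw]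
          rw [Measure.map_apply hψ hB', withDensity_apply _ (hψ hB')]
          rfl
      _ = μ B := by rw [← hγ, Measure.map_apply (by fun_prop) hB]
  · rw [klDiv_eq_lintegral_klFun_of_ac hac, lintegral_map (by fun_prop) hψ]
    refine lintegral_congr fun q => ?_
    simp only [f]
    rw [ENNReal.toReal_ofReal ENNReal.toReal_nonneg]

lemma exists_codec_of_klDiv_le [StandardBorelSpace 𝒰] {μ : Measure (𝒴 × 𝒳)}
    [IsProbabilityMeasure μ] {φ : 𝒴 × 𝒰 → 𝒳} (hφ : Measurable φ) {γ : Measure (𝒴 × 𝒳 × 𝒳)}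
    [IsProbabilityMeasure γ] (hγ : γ.map (fun t => (t.1, t.2.1)) = μ) {a : ℝ} (ha : 0 ≤ a)
    (hkl : klDiv γ ((μ.prod η).map fun q => (q.1.1, q.1.2, φ (q.1.1, q.2))) ≤
      ENNReal.ofReal (a * Real.log 2)) :
    ∃ c : SharedCodec 𝒴 𝒳 (List Bool), c.IsUniquelyDecodable ∧
      c.rate μ ≤ ENNReal.ofReal (a + Real.logb 2 (a + 1) + 5) ∧ c.law μ = γ := by
  have hac := (klDiv_ne_top_iff.1 (ne_top_of_le_ne_top ENNReal.ofReal_ne_top hkl)).1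
  obtain ⟨F, hF, hfin, h1, hlaw, hF', -⟩ := exists_density (η := η) hφ hγ hac
  obtain ⟨c, hc₁, hc₂, hc₃⟩ := exists_codec_of_density hφ hF hfin h1 ha (hF'.trans_le hkl)
  exact ⟨c, hc₁, hc₂, hc₃.trans hlaw.symm⟩

variable [StandardBorelSpace 𝒳] [Nonempty 𝒳]

/-- X̂ given Y is a function of Y and a uniform variable, so proposals of one fixed law serve all
values of Y. -/
lemma indepLaw_eq_map {μ : Measure (𝒴 × 𝒳)} [SFinite μ] {R : Kernel 𝒴 𝒳} [IsMarkovKernel R]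
    {φ : 𝒴 → I → 𝒳} (hφ : Measurable (Function.uncurry φ))
    (hR : ∀ y, (volume : Measure I).map (φ y) = R y) :
    indepLaw μ R = (μ.prod (volume : Measure I)).map
      fun q => (q.1.1, q.1.2, Function.uncurry φ (q.1.1, q.2)) := by
  have hψ : Measurable fun q : (𝒴 × 𝒳) × I =>
      (q.1.1, q.1.2, Function.uncurry φ (q.1.1, q.2)) :=
    measurable_fst.fst.prodMk (measurable_fst.snd.prodMk
      (hφ.comp (measurable_fst.fst.prodMk measurable_snd)))
  ext A hA
  rw [indepLaw, tripleLaw_apply hA, Measure.map_apply hψ hA, Measure.prod_apply (hψ hA)]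
  refine lintegral_congr fun p => ?_
  rw [Kernel.prodMkRight_apply, ← hR, Measure.map_apply]
  · rfl
  · exact hφ.comp measurable_prodMk_left
  · exact (show Measurable fun z => (p.1, p.2, z) by fun_prop) hA

lemma toReal_condMutualInfo_mul_log {γ : Measure (𝒴 × 𝒳 × 𝒳)} [IsFiniteMeasure γ]
    {μ : Measure (𝒴 × 𝒳)} [IsFiniteMeasure μ] (h : γ.map (fun t => (t.1, t.2.1)) = μ)
    (hI : condMutualInfo γ ≠ ∞) :
    klDiv γ (indepLaw μ (reconGiven γ)) =
      ENNReal.ofReal ((condMutualInfo γ).toReal * Real.log 2) := by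
  have hlog2 : 0 < Real.log 2 := Real.log_pos (by norm_num)
  have h0 : ENNReal.ofReal (Real.log 2) ≠ 0 := by simpa using hlog2
  rw [ENNReal.ofReal_mul ENNReal.toReal_nonneg, ENNReal.ofReal_toReal hI, condMutualInfo_eq h,
    ENNReal.div_mul_cancel h0 ENNReal.ofReal_ne_top]

/-- One-shot simulation of a triple by a variable-length codec. -/
lemma exists_codec_law_eq {μ : Measure (𝒴 × 𝒳)} [IsProbabilityMeasure μ]
    {γ : Measure (𝒴 × 𝒳 × 𝒳)} [IsProbabilityMeasure γ] (hγ : γ.map (fun t => (t.1, t.2.1)) = μ)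
    (hI : condMutualInfo γ ≠ ∞) :
    ∃ c : SharedCodec 𝒴 𝒳 (List Bool), c.IsUniquelyDecodable ∧
      c.rate μ ≤ ENNReal.ofReal ((condMutualInfo γ).toReal +
        Real.logb 2 ((condMutualInfo γ).toReal + 1) + 5) ∧ c.law μ = γ := by
  obtain ⟨φ, hφ, hR⟩ := (reconGiven γ).exists_measurable_map_eq_unitInterval
  refine exists_codec_of_klDiv_le (η := (volume : Measure I)) hφ hγ ENNReal.toReal_nonneg ?_
  rw [← indepLaw_eq_map hφ hR, toReal_condMutualInfo_mul_log hγ hI]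

lemma exists_oneShot_codec {s : Sense} {Δ : 𝒳 → 𝒳 → ℝ≥0∞} {d : Measure 𝒳 → Measure 𝒳 → ℝ≥0∞}
    {μ : Measure (𝒴 × 𝒳)} [IsProbabilityMeasure μ] {D P : ℝ≥0∞} {R : ℝ}
    (hfin : rdcpFunction s Δ d μ D P ≠ ∞)
    (hR : (rdcpFunction s Δ d μ D P).toReal +
      Real.logb 2 ((rdcpFunction s Δ d μ D P).toReal + 1) + 5 < R) :
    ∃ c : SharedCodec 𝒴 𝒳 (List Bool), c.IsUniquelyDecodable ∧
      c.rate μ ≤ ENNReal.ofReal R ∧ Meets s Δ d D P (c.law μ) := by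
  set r := (rdcpFunction s Δ d μ D P).toReal with hr
  have hr0 : 0 ≤ r := ENNReal.toReal_nonneg
  have hcont : ContinuousAt (fun x : ℝ => x + Real.logb 2 (x + 1) + 5) r := by
    have : ContinuousAt (fun x : ℝ => Real.log (x + 1)) r :=
      (continuousAt_id.add continuousAt_const).log (by simp; linarith)
    exact (continuousAt_id.add (this.div_const _)).add continuousAt_const
  -- The infimum need not be attained. As R exceeds the bound strictly, a channel with slightly more
  -- information than r is good enough.
  obtain ⟨b, hb, hbR⟩ : ∃ b > r, ∀ x ∈ Set.Ico r b, x + Real.logb 2 (x + 1) + 5 < R := by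
    have hev := hcont.eventually (gt_mem_nhds hR)
    exact exists_Ico_subset_of_mem_nhds hev ⟨r + 1, by linarith⟩
  have hlt : rdcpFunction s Δ d μ D P < ENNReal.ofReal b := by
    rwa [ENNReal.lt_ofReal_iff_toReal_lt hfin]
  obtain ⟨κ, hκ, hm, hI⟩ := exists_of_rdcpFunction_lt hlt
  have hne : condMutualInfo (tripleLaw μ κ) ≠ ∞ := (hI.trans ENNReal.ofReal_lt_top).ne
  obtain ⟨c, hc₁, hc₂, hc₃⟩ := exists_codec_law_eq (map_source_tripleLaw μ κ) hne
  refine ⟨c, hc₁, hc₂.trans (ENNReal.ofReal_le_ofReal (hbR _ ⟨?_, ?_⟩).le), ?_⟩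
  · exact ENNReal.toReal_mono hne (rdcpFunction_le (map_source_tripleLaw μ κ) hm)
  · rwa [ENNReal.lt_ofReal_iff_toReal_lt hne] at hI
  · simpa only [hc₃] using hm

end Simulation

/-! ### Independent copies and variable-length block codes -/

section BlockLaw

variable {𝒴 𝒳 : Type*} [MeasurableSpace 𝒴] [MeasurableSpace 𝒳]

lemma map_pi_prod_pi {α β δ : Type*} [MeasurableSpace α] [MeasurableSpace β] [MeasurableSpace δ]
    (a : Measure α) (b : Measure β) [SigmaFinite a] [SigmaFinite b] (n : ℕ)
    {f : (Fin n → α) × (Fin n → β) → δ} (hf : Measurable f) :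
    ((Measure.pi fun _ : Fin n => a).prod (Measure.pi fun _ : Fin n => b)).map f =
      (Measure.pi fun _ : Fin n => a.prod b).map fun q => f (fun i => (q i).1, fun i => (q i).2) := by
  rw [← (measurePreserving_arrowProdEquivProdArrow α β (Fin n) (fun _ => a) (fun _ => b)).map_eq,
    Measure.map_map hf (MeasurableEquiv.measurable _)]
  rfl

/-- The law of `(Y^n, X^n, X̂^n)` for `n` independent triples of law `γ`. -/
noncomputable def blockLaw (γ : Measure (𝒴 × 𝒳 × 𝒳)) (n : ℕ) :
    Measure ((Fin n → 𝒴) × (Fin n → 𝒳) × (Fin n → 𝒳)) :=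
  (Measure.pi fun _ : Fin n => γ).map
    fun t => (fun i => (t i).1, fun i => (t i).2.1, fun i => (t i).2.2)

instance (γ : Measure (𝒴 × 𝒳 × 𝒳)) [IsProbabilityMeasure γ] (n : ℕ) :
    IsProbabilityMeasure (blockLaw γ n) :=
  Measure.isProbabilityMeasure_map (Measurable.aemeasurable (by fun_prop))

variable {γ : Measure (𝒴 × 𝒳 × 𝒳)} [IsProbabilityMeasure γ] {μ : Measure (𝒴 × 𝒳)}
  [IsProbabilityMeasure μ]

lemma map_source_blockLaw (hγ : γ.map (fun t => (t.1, t.2.1)) = μ) (n : ℕ) :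
    (blockLaw γ n).map (fun t => (t.1, t.2.1)) = iidSource μ n := by
  have hs : ∀ _ : Fin n, SigmaFinite (γ.map fun t => (t.1, t.2.1)) := fun _ => by
    rw [hγ]; infer_instance
  rw [blockLaw, Measure.map_map (by fun_prop) (by fun_prop), iidSource]
  conv_rhs => rw [← hγ]
  rw [← Measure.pi_map_pi (μ := fun _ : Fin n => γ) (f := fun _ t => (t.1, t.2.1))
    (fun _ => Measurable.aemeasurable (by fun_prop)), Measure.map_map (by fun_prop) (by fun_prop)]
  rfl

lemma letterLaw_blockLaw (γ : Measure (𝒴 × 𝒳 × 𝒳)) [IsProbabilityMeasure γ] {n : ℕ} (i : Fin n) :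
    letterLaw (blockLaw γ n) i = γ := by
  rw [letterLaw, blockLaw, Measure.map_map (by fun_prop) (by fun_prop)]
  exact (measurePreserving_eval (fun _ : Fin n => γ) i).map_eq

variable [StandardBorelSpace 𝒳] [Nonempty 𝒳]

/-- Given Y^n, the i-th pair depends on Y_i alone: with (X, X̂) written as a function of Y and a
uniform variable, only the i-th coordinate of the noise matters. -/
lemma letterBlockLaw_blockLaw (γ : Measure (𝒴 × 𝒳 × 𝒳)) [IsProbabilityMeasure γ] {n : ℕ}
    (i : Fin n) :
    letterBlockLaw (blockLaw γ n) i = (Measure.pi fun _ : Fin n => γ.fst) ⊗ₘ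
      γ.condKernel.comap (fun y : Fin n → 𝒴 => y i) (by fun_prop) := by
  obtain ⟨χ, hχ, hχγ⟩ := γ.condKernel.exists_measurable_map_eq_unitInterval
  have hχy : ∀ y, Measurable (χ y) := fun y => hχ.comp measurable_prodMk_left
  have hm : Measurable fun q : 𝒴 × I => (q.1, Function.uncurry χ q) := by fun_prop
  have hγ : γ = (γ.fst.prod (volume : Measure I)).map fun q => (q.1, Function.uncurry χ q) := by
    conv_lhs => rw [← γ.disintegrate γ.condKernel]
    ext A hA
    rw [Measure.compProd_apply hA, Measure.map_apply hm hA, Measure.prod_apply (hm hA)]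
    refine lintegral_congr fun y => ?_
    rw [← hχγ, Measure.map_apply (hχy y) (measurable_prodMk_left hA)]
    rfl
  have hs : ∀ _ : Fin n, SigmaFinite
      ((γ.fst.prod (volume : Measure I)).map fun q => (q.1, Function.uncurry χ q)) := fun _ => by
    rw [← hγ]; infer_instance
  have hf : Measurable fun q : (Fin n → 𝒴) × (Fin n → I) =>
      (q.1, Function.uncurry χ (q.1 i, q.2 i)) := by fun_prop
  have h₁ : letterBlockLaw (blockLaw γ n) i =
      ((Measure.pi fun _ : Fin n => γ.fst).prod (Measure.pi fun _ : Fin n => (volume : Measure I))).map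
        fun q => (q.1, Function.uncurry χ (q.1 i, q.2 i)) := by
    rw [map_pi_prod_pi _ _ _ hf, letterBlockLaw, blockLaw,
      Measure.map_map (by fun_prop) (by fun_prop)]
    conv_lhs => rw [hγ]
    rw [← Measure.pi_map_pi (f := fun _ q => (q.1, Function.uncurry χ q))
      (fun _ => hm.aemeasurable), Measure.map_map (by fun_prop) (by fun_prop)]
    rfl
  rw [h₁]
  ext A hA
  rw [Measure.map_apply hf hA, Measure.prod_apply (hf hA), Measure.compProd_apply hA]
  refine lintegral_congr fun y => ?_
  rw [Kernel.comap_apply, ← hχγ, Measure.map_apply (hχy _) (measurable_prodMk_left hA),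
    ← (measurePreserving_eval (fun _ : Fin n => (volume : Measure I)) i).measure_preimage]
  · rfl
  · exact (hχy _ (measurable_prodMk_left hA)).nullMeasurableSet

lemma meets_letterBlockLaw {s : Sense} {Δ : 𝒳 → 𝒳 → ℝ≥0∞} {d : Measure 𝒳 → Measure 𝒳 → ℝ≥0∞}
    {D P : ℝ≥0∞} (h : Meets s Δ d D P γ) {n : ℕ} (i : Fin n) :
    Meets s Δ d D P (letterBlockLaw (blockLaw γ n) i) := by
  rw [meets_compProd_iff (letterBlockLaw_blockLaw γ i)]
  rw [meets_compProd_iff (γ.disintegrate γ.condKernel).symm] at h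
  have he := measurePreserving_eval (fun _ : Fin n => γ.fst) i
  exact ⟨h.1.comp he, h.2.comp he⟩

lemma map_iidSource_prod_pi {φ : 𝒴 × I → 𝒳} (hφ : Measurable φ) (n : ℕ) :
    ((iidSource μ n).prod (Measure.pi fun _ : Fin n => (volume : Measure I))).map
      (fun q => (q.1.1, q.1.2, fun i => φ (q.1.1 i, q.2 i))) =
    blockLaw ((μ.prod (volume : Measure I)).map fun q => (q.1.1, q.1.2, φ (q.1.1, q.2))) n := by
  have hψ : Measurable fun q : (𝒴 × 𝒳) × I => (q.1.1, q.1.2, φ (q.1.1, q.2)) := by fun_prop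
  have hs : ∀ _ : Fin n, SigmaFinite
      ((μ.prod (volume : Measure I)).map fun q => (q.1.1, q.1.2, φ (q.1.1, q.2))) := fun _ => by
    have := Measure.isProbabilityMeasure_map (μ := μ.prod (volume : Measure I)) hψ.aemeasurable
    infer_instance
  have h₁ : (iidSource μ n).prod (Measure.pi fun _ : Fin n => (volume : Measure I)) =
      ((Measure.pi fun _ : Fin n => μ).prod (Measure.pi fun _ : Fin n => (volume : Measure I))).map
        (Prod.map (fun p => (fun i => (p i).1, fun i => (p i).2)) id) := by
    rw [← Measure.map_prod_map _ _ (by fun_prop) measurable_id, Measure.map_id, iidSource]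
  rw [h₁, Measure.map_map (by fun_prop) (by fun_prop), map_pi_prod_pi _ _ _ (by fun_prop),
    blockLaw, ← Measure.pi_map_pi (f := fun _ (q : (𝒴 × 𝒳) × I) => (q.1.1, q.1.2, φ (q.1.1, q.2)))
      (fun _ => hψ.aemeasurable), Measure.map_map (by fun_prop) (by fun_prop)]
  rfl

/-- Both block laws are images of n-fold products under the same regrouping of coordinates, so data
processing and `klDiv_pi_le` apply. -/
lemma klDiv_blockLaw_le {φ : 𝒴 × I → 𝒳} (hφ : Measurable φ) (n : ℕ) :
    klDiv (blockLaw γ n) (((iidSource μ n).prod (Measure.pi fun _ : Fin n => (volume : Measure I))).map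
      fun q => (q.1.1, q.1.2, fun i => φ (q.1.1 i, q.2 i))) ≤
    n * klDiv γ ((μ.prod (volume : Measure I)).map fun q => (q.1.1, q.1.2, φ (q.1.1, q.2))) := by
  have hψ : Measurable fun q : (𝒴 × 𝒳) × I => (q.1.1, q.1.2, φ (q.1.1, q.2)) := by fun_prop
  have := Measure.isProbabilityMeasure_map (μ := μ.prod (volume : Measure I)) hψ.aemeasurable
  rw [map_iidSource_prod_pi hφ]
  exact (klDiv_map_le _ _ (by fun_prop)).trans (klDiv_pi_le _ _ _)

lemma eventually_add_logb_le {a R : ℝ} (ha : 0 ≤ a) (haR : a < R) :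
    ∀ᶠ n : ℕ in Filter.atTop, n * a + Real.logb 2 (n * a + 1) + 5 ≤ n * R := by
  have hlog2 : 0 < Real.log 2 := Real.log_pos (by norm_num)
  have hc : 0 < (R - a) * Real.log 2 / (2 * (a + 1)) := by
    have : 0 < R - a := sub_pos.2 haR
    positivity
  have ht : Filter.Tendsto (fun n : ℕ => (n : ℝ) * (a + 1)) Filter.atTop Filter.atTop :=
    tendsto_natCast_atTop_atTop.atTop_mul_const (by linarith)
  have h₁ := ht.eventually (Real.isLittleO_log_id_atTop.bound hc)
  have h₂ := (tendsto_natCast_atTop_atTop (R := ℝ)).eventually_ge_atTop (5 * 2 / (R - a))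
  filter_upwards [h₁, h₂, Filter.eventually_ge_atTop 1] with n hn₁ hn₂ hn₃
  have hn : (1 : ℝ) ≤ n := by exact_mod_cast hn₃
  have hpos : 0 < R - a := sub_pos.2 haR
  have hle : Real.logb 2 (n * a + 1) ≤ n * (R - a) / 2 := by
    rw [Real.logb, div_le_iff₀ hlog2]
    calc Real.log (n * a + 1) ≤ Real.log (n * (a + 1)) :=
          Real.log_le_log (by positivity) (by nlinarith)
      _ ≤ ‖Real.log (n * (a + 1))‖ := le_abs_self _
      _ ≤ (R - a) * Real.log 2 / (2 * (a + 1)) * ‖id ((n : ℝ) * (a + 1))‖ := hn₁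
      _ = n * (R - a) / 2 * Real.log 2 := by
        rw [id, Real.norm_of_nonneg (by positivity)]
        field_simp
  have h5 : 5 ≤ n * (R - a) / 2 := by
    rw [div_le_iff₀ hpos] at hn₂
    linarith
  linarith

/-- One-shot simulation of n independent copies of a near-optimal triple; `eventually_add_logb_le`
absorbs the logarithmic overhead into nR. The block law is reproduced exactly, so each letter
satisfies the constraints given Y_i and given Y^n. -/
lemma exists_block_codec {s : Sense} {Δ : 𝒳 → 𝒳 → ℝ≥0∞} {d : Measure 𝒳 → Measure 𝒳 → ℝ≥0∞}
    {D P : ℝ≥0∞} {R : ℝ≥0} (hR : rdcpFunction s Δ d μ D P < R) :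
    ∃ N : ℕ, ∀ n ≥ N, ∃ c : SharedCodec (Fin n → 𝒴) (Fin n → 𝒳) (List Bool),
      c.IsUniquelyDecodable ∧ c.rate (iidSource μ n) ≤ n * R ∧
      ∀ i, Meets s Δ d D P (letterLaw (c.law (iidSource μ n)) i) ∧
        Meets s Δ d D P (letterBlockLaw (c.law (iidSource μ n)) i) := by
  obtain ⟨κ, hκ, hm, hI⟩ := exists_of_rdcpFunction_lt hR
  set γ := tripleLaw μ κ
  have hγ : γ.map (fun t => (t.1, t.2.1)) = μ := map_source_tripleLaw μ κ
  have hne : condMutualInfo γ ≠ ∞ := (hI.trans ENNReal.coe_lt_top).ne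
  set a := (condMutualInfo γ).toReal
  have ha : 0 ≤ a := ENNReal.toReal_nonneg
  have haR : a < R := by
    have := (ENNReal.toReal_lt_toReal hne ENNReal.coe_ne_top).2 hI
    simpa using this
  obtain ⟨φ, hφ, hφR⟩ := (reconGiven γ).exists_measurable_map_eq_unitInterval
  have hkl := toReal_condMutualInfo_mul_log hγ hne
  rw [indepLaw_eq_map hφ hφR] at hkl
  obtain ⟨N, hN⟩ := Filter.eventually_atTop.1 (eventually_add_logb_le ha haR)
  refine ⟨N, fun n hn => ?_⟩
  have hkln := (klDiv_blockLaw_le (γ := γ) (μ := μ) hφ n).trans_eq (congrArg _ hkl)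
  rw [← ENNReal.ofReal_natCast, ← ENNReal.ofReal_mul (Nat.cast_nonneg n), ← mul_assoc] at hkln
  have hφn : Measurable fun q : (Fin n → 𝒴) × (Fin n → I) =>
      fun i => Function.uncurry φ (q.1 i, q.2 i) := by fun_prop
  obtain ⟨c, hc₁, hc₂, hc₃⟩ := exists_codec_of_klDiv_le
    (η := Measure.pi fun _ : Fin n => (volume : Measure I)) hφn (map_source_blockLaw hγ n)
    (by positivity) hkln
  refine ⟨c, hc₁, hc₂.trans ?_, fun i => ?_⟩
  · refine (ENNReal.ofReal_le_ofReal (hN n hn)).trans_eq ?_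
    rw [ENNReal.ofReal_mul (Nat.cast_nonneg n), ENNReal.ofReal_natCast, ENNReal.ofReal_coe_nnreal]
  · simp only [hc₃]
    exact ⟨by simpa only [letterLaw_blockLaw] using hm, meets_letterBlockLaw hm i⟩

end BlockLaw

/-! ### Truncated rejection sampling with finitely many messages -/

section FixedLength

/-- The samples from the m-th on contribute the probability that the sampler gets that far. -/
lemma tsum_lintegral_share_add {𝒰 : Type*} [MeasurableSpace 𝒰] {η : Measure 𝒰} {f : 𝒰 → ℝ≥0∞}
    (hf : Measurable f) (h1 : ∫⁻ u, f u ∂η = 1) (m : ℕ) :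
    ∑' i, ∫⁻ u, share η f (i + m) u ∂η = residual η f m := by
  have h := sum_lintegral_share_add hf h1 m
  have h' : ∑ i ∈ Finset.range m, ∫⁻ u, share η f i u ∂η +
      ∑' i, ∫⁻ u, share η f (i + m) u ∂η = 1 := by
    rw [← tsum_lintegral_share hf h1]
    exact Summable.sum_add_tsum_nat_add' (f := fun i => ∫⁻ u, share η f i u ∂η) ENNReal.summable
  refine (ENNReal.add_right_inj ?_).1 (h'.trans h.symm)
  exact ne_top_of_le_ne_top ENNReal.one_ne_top (h ▸ le_self_add)

variable {𝒴 𝒳 𝒰 : Type*} [MeasurableSpace 𝒴] [MeasurableSpace 𝒳] [MeasurableSpace 𝒰]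
  {η : Measure 𝒰} [IsProbabilityMeasure η] {μ : Measure (𝒴 × 𝒳)} [IsProbabilityMeasure μ]

/-- The codec that sends the index of the accepted sample if it is less than `k`; otherwise the
decoder uses fresh randomness. -/
lemma exists_truncated_codec [StandardBorelSpace 𝒰] {φ : 𝒴 × 𝒰 → 𝒳} (hφ : Measurable φ)
    {χ : 𝒴 × I → 𝒳} (hχ : Measurable χ) {F : (𝒴 × 𝒳) × 𝒰 → ℝ≥0∞} (hF : Measurable F)
    (h1 : ∀ᵐ p ∂μ, ∫⁻ u, F (p, u) ∂η = 1) (k : ℕ) :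
    ∃ c : SharedCodec 𝒴 𝒳 (Fin (k + 1)), ∀ h : 𝒴 × 𝒳 × 𝒳 → ℝ≥0∞, Measurable h →
      ∫⁻ t, h t ∂c.law μ =
        ∫⁻ p, ∫⁻ u, (∑ i ∈ Finset.range k, share η (fun u => F (p, u)) i u) *
          h (p.1, p.2, φ (p.1, u)) ∂η ∂μ +
        ∫⁻ p, residual η (fun u => F (p, u)) k * (∫⁻ v, h (p.1, p.2, χ (p.1, v))) ∂μ := by
  obtain ⟨θ, hθ, hθη⟩ := exists_sampler η
  have hK : Measurable fun t : (𝒴 × 𝒳) × I => stopTime η F t.1 (θ t.2).1 := by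
    exact measurable_stopTime_comp hF measurable_fst (hθ.comp measurable_snd).fst
  have hD : Measurable fun t : (𝒴 × Fin (k + 1)) × I =>
      (t.1.1, ((θ t.2).1 (t.1.2 : ℕ)).1) := by
    have h : Measurable fun t : (𝒴 × Fin (k + 1)) × I => ((θ t.2).1, (t.1.2 : ℕ)) :=
      (hθ.comp measurable_snd).fst.prodMk
        ((Measurable.of_discrete (f := fun j : Fin (k + 1) => (j : ℕ))).comp measurable_fst.snd)
    exact measurable_fst.fst.prodMk (measurable_eval_nat.comp h).fst
  have hset : MeasurableSet {t : (𝒴 × Fin (k + 1)) × I | (t.1.2 : ℕ) < k} :=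
    measurableSet_lt ((Measurable.of_discrete (f := fun j : Fin (k + 1) => (j : ℕ))).comp
      measurable_fst.snd) measurable_const
  -- The extra message `k` announces that samples 0, ..., k - 1 were all rejected; χ is then fed
  -- with the spare uniform variable.
  let c : SharedCodec 𝒴 𝒳 (Fin (k + 1)) :=
    { enc := fun t => ⟨min (stopTime η F t.1 (θ t.2).1) k, by omega⟩
      dec := fun t => if (t.1.2 : ℕ) < k then φ (t.1.1, ((θ t.2).1 (t.1.2 : ℕ)).1)
        else χ (t.1.1, (θ t.2).2)
      measurable_enc := (measurable_from_nat (f := fun j => (⟨min j k, by omega⟩ : Fin (k + 1)))).comp hK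
      measurable_dec := Measurable.ite hset (hφ.comp hD)
        (hχ.comp (measurable_fst.fst.prodMk (hθ.comp measurable_snd).snd)) }
  refine ⟨c, fun h hh => ?_⟩
  have hlaw : Measurable fun t : (𝒴 × 𝒳) × I => (t.1.1, t.1.2, c.dec ((t.1.1, c.enc t), t.2)) :=
    measurable_fst.fst.prodMk (measurable_fst.snd.prodMk (c.measurable_dec.comp
      ((measurable_fst.fst.prodMk c.measurable_enc).prodMk measurable_snd)))
  let G : 𝒴 × 𝒳 → 𝒰 → ℕ → I → ℝ≥0∞ := fun p u i v =>
    if i < k then h (p.1, p.2, φ (p.1, u)) else h (p.1, p.2, χ (p.1, v))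
  have hG : ∀ i, Measurable fun q : (𝒴 × 𝒳) × 𝒰 × I => G q.1 q.2.1 i q.2.2 := fun i => by
    by_cases hi : i < k
    · simp only [G, hi, if_true]; fun_prop
    · simp only [G, hi, if_false]; fun_prop
  have hstep : ∫⁻ t, h t ∂c.law μ = ∫⁻ t, G t.1 (stopSample η F t.1 (θ t.2).1)
      (stopTime η F t.1 (θ t.2).1) (θ t.2).2 ∂(μ.prod (volume : Measure I)) := by
    rw [SharedCodec.law, lintegral_map hh hlaw]
    refine lintegral_congr fun t => ?_
    by_cases hi : stopTime η F t.1 (θ t.2).1 < k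
    · simp [c, G, hi, stopSample_eq, min_eq_left hi.le]
    · simp [c, G, hi]
  have hφm : Measurable fun q : (𝒴 × 𝒳) × 𝒰 => h (q.1.1, q.1.2, φ (q.1.1, q.2)) := by fun_prop
  have hχm : Measurable fun q : (𝒴 × 𝒳) × I => h (q.1.1, q.1.2, χ (q.1.1, q.2)) := by fun_prop
  have hmr : Measurable fun p : 𝒴 × 𝒳 => residual η (fun u => F (p, u)) k *
      ∫⁻ v, h (p.1, p.2, χ (p.1, v)) :=
    (measurable_residual (η := η) hF k).mul
      (hχm.lintegral_prod_right' (ν := (volume : Measure I)))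
  rw [hstep, lintegral_sampler hθ hθη hF h1 hG, ← lintegral_add_right _ hmr]
  refine lintegral_congr_ae ?_
  filter_upwards [h1] with p hp
  have hFp : Measurable fun u => F (p, u) := hF.comp measurable_prodMk_left
  have hφp : Measurable fun u => h (p.1, p.2, φ (p.1, u)) := hφm.comp measurable_prodMk_left
  have hχp : Measurable fun v => h (p.1, p.2, χ (p.1, v)) := hχm.comp measurable_prodMk_left
  have hv : ∀ v, ∑' i, ∫⁻ u, share η (fun u => F (p, u)) i u * G p u i v ∂η =
      ∫⁻ u, (∑ i ∈ Finset.range k, share η (fun u => F (p, u)) i u) *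
          h (p.1, p.2, φ (p.1, u)) ∂η +
        residual η (fun u => F (p, u)) k * h (p.1, p.2, χ (p.1, v)) := fun v => by
    rw [← Summable.sum_add_tsum_nat_add' (k := k) ENNReal.summable]
    congr 1
    · simp_rw [Finset.sum_mul]
      have hs : ∀ i ∈ Finset.range k, Measurable fun u => share η (fun u => F (p, u)) i u *
          h (p.1, p.2, φ (p.1, u)) := fun i _ => (measurable_share hFp i).mul hφp
      rw [lintegral_finsetSum _ hs]
      refine Finset.sum_congr rfl fun i hi => ?_
      simp [G, Finset.mem_range.1 hi]
    · rw [← tsum_lintegral_share_add hFp hp, ← ENNReal.tsum_mul_right]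
      refine tsum_congr fun i => ?_
      rw [← lintegral_mul_const _ (measurable_share hFp _)]
      simp [G]
  simp_rw [hv]
  rw [lintegral_add_left measurable_const, lintegral_const_mul _ hχp]
  simp

/-- Simulation of the law of density `F` by `k + 1` messages. The law of `(Y, X̂)` is exact; that
of the triple is off by at most the probability that the first `k` samples are rejected. -/
lemma exists_fixedLength_codec_of_density [StandardBorelSpace 𝒰] [StandardBorelSpace 𝒳]
    [Nonempty 𝒳] {φ : 𝒴 × 𝒰 → 𝒳} (hφ : Measurable φ)
    {F : (𝒴 × 𝒳) × 𝒰 → ℝ≥0∞} (hF : Measurable F)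
    (h1 : ∀ᵐ p ∂μ, ∫⁻ u, F (p, u) ∂η = 1) {γ : Measure (𝒴 × 𝒳 × 𝒳)}
    (hγ : γ = ((μ.prod η).withDensity F).map (fun q => (q.1.1, q.1.2, φ (q.1.1, q.2)))) (k : ℕ) :
    ∃ c : SharedCodec 𝒴 𝒳 (Fin (k + 1)),
      (c.law μ).map (fun t => (t.1, t.2.2)) = γ.map (fun t => (t.1, t.2.2)) ∧
      ∀ h : 𝒴 × 𝒳 × 𝒳 → ℝ≥0∞, Measurable h → ∀ b, (∀ t, h t ≤ b) →
        ∫⁻ t, h t ∂c.law μ ≤ ∫⁻ t, h t ∂γ + b * ∫⁻ p, residual η (fun u => F (p, u)) k ∂μ := by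
  have hψ : Measurable fun q : (𝒴 × 𝒳) × 𝒰 => (q.1.1, q.1.2, φ (q.1.1, q.2)) := by fun_prop
  have hE : Measurable fun q : (𝒴 × 𝒳) × 𝒰 => F q - level η (fun u => F (q.1, u)) k :=
    hF.sub ((measurable_level hF k).comp measurable_fst)
  have hγh : ∀ h : 𝒴 × 𝒳 × 𝒳 → ℝ≥0∞, Measurable h →
      ∫⁻ t, h t ∂γ = ∫⁻ p, ∫⁻ u, F (p, u) * h (p.1, p.2, φ (p.1, u)) ∂η ∂μ := fun h hh => by
    have hm : Measurable fun q : (𝒴 × 𝒳) × 𝒰 => h (q.1.1, q.1.2, φ (q.1.1, q.2)) := hh.comp hψ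
    rw [hγ, lintegral_map hh hψ, lintegral_withDensity_eq_lintegral_mul _ hF hm,
      lintegral_prod _ (hF.mul hm).aemeasurable]
    rfl
  -- The part of the law of (Y, X̂) not covered by the first k samples. Its mass given Y is the
  -- probability of failure, so a decoder that draws from its conditional law after a failure,
  -- knowing only Y, puts back exactly what is missing.
  let τ : Measure (𝒴 × 𝒳) := ((μ.prod η).withDensity
    fun q => F q - level η (fun u => F (q.1, u)) k).map fun q => (q.1.1, φ (q.1.1, q.2))
  have hψ' : Measurable fun q : (𝒴 × 𝒳) × 𝒰 => (q.1.1, φ (q.1.1, q.2)) := by fun_prop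
  have hτh : ∀ h : 𝒴 × 𝒳 → ℝ≥0∞, Measurable h →
      ∫⁻ t, h t ∂τ = ∫⁻ p, ∫⁻ u, (F (p, u) - level η (fun u => F (p, u)) k) *
        h (p.1, φ (p.1, u)) ∂η ∂μ := fun h hh => by
    have hm : Measurable fun q : (𝒴 × 𝒳) × 𝒰 => h (q.1.1, φ (q.1.1, q.2)) := hh.comp hψ'
    rw [lintegral_map hh hψ', lintegral_withDensity_eq_lintegral_mul _ hE hm,
      lintegral_prod _ (hE.mul hm).aemeasurable]
    rfl
  have hτ1 : ∀ g : 𝒴 → ℝ≥0∞, Measurable g →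
      ∫⁻ y, g y ∂τ.fst = ∫⁻ p, residual η (fun u => F (p, u)) k * g p.1 ∂μ := fun g hg => by
    rw [Measure.fst, lintegral_map hg measurable_fst, hτh (fun q => g q.1) (hg.comp measurable_fst)]
    refine lintegral_congr fun p => ?_
    have hEp : Measurable fun u => F (p, u) - level η (fun u => F (p, u)) k :=
      hE.comp measurable_prodMk_left
    exact lintegral_mul_const (g p.1) hEp
  have : IsFiniteMeasure τ := by
    refine ⟨?_⟩
    have := hτh 1 measurable_one
    simp only [Pi.one_apply, lintegral_one, mul_one] at this
    rw [this]
    refine lt_of_le_of_lt (lintegral_mono_ae (g := 1) ?_) (by simp)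
    filter_upwards [h1] with p hp using residual_le_one hp k
  obtain ⟨χ, hχ, hχτ⟩ := τ.condKernel.exists_measurable_map_eq_unitInterval
  obtain ⟨c, hc⟩ := exists_truncated_codec hφ hχ hF h1 k
  refine ⟨c, ?_, fun h hh b hb => ?_⟩
  · refine Measure.ext_of_lintegral _ fun h hh => ?_
    have hq : Measurable fun t : 𝒴 × 𝒳 × 𝒳 => (t.1, t.2.2) := by fun_prop
    have hhq : Measurable fun t : 𝒴 × 𝒳 × 𝒳 => h (t.1, t.2.2) := hh.comp hq
    have hχh : Measurable fun y => ∫⁻ v, h (y, Function.uncurry χ (y, v)) := by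
      have : Measurable fun q : 𝒴 × I => h (q.1, Function.uncurry χ q) :=
        hh.comp (measurable_fst.prodMk hχ)
      exact this.lintegral_prod_right'
    rw [lintegral_map hh hq, lintegral_map hh hq, hc _ hhq, hγh _ hhq, ← hτ1 _ hχh]
    have hcond : ∫⁻ y, ∫⁻ v, h (y, Function.uncurry χ (y, v)) ∂volume ∂τ.fst = ∫⁻ t, h t ∂τ := by
      conv_rhs => rw [← τ.disintegrate τ.condKernel]
      rw [Measure.lintegral_compProd hh]
      refine lintegral_congr fun y => ?_
      have hhy : Measurable fun x => h (y, x) := hh.comp measurable_prodMk_left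
      have hχy : Measurable (χ y) := hχ.comp measurable_prodMk_left
      rw [← hχτ, lintegral_map hhy hχy]
      rfl
    have hm : Measurable fun q : (𝒴 × 𝒳) × 𝒰 => (F q - level η (fun u => F (q.1, u)) k) *
        h (q.1.1, φ (q.1.1, q.2)) := hE.mul (hh.comp hψ')
    rw [hcond, hτh _ hh, ← lintegral_add_right _ hm.lintegral_prod_right']
    refine lintegral_congr fun p => ?_
    have hmp : Measurable fun u => (F (p, u) - level η (fun u => F (p, u)) k) *
        h (p.1, φ (p.1, u)) := hm.comp measurable_prodMk_left
    rw [← lintegral_add_right _ hmp]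
    refine lintegral_congr fun u => ?_
    simp only
    rw [← add_mul, sum_share_add (f := fun u => F (p, u)) k u]
  · rw [hc h hh, hγh h hh, ← lintegral_const_mul _ (measurable_residual hF k)]
    refine add_le_add (lintegral_mono fun p => lintegral_mono fun u => ?_)
      (lintegral_mono fun p => ?_)
    · gcongr
      exact le_self_add.trans_eq (sum_share_add (f := fun u => F (p, u)) k u)
    · rw [mul_comm]
      gcongr
      calc ∫⁻ v, h (p.1, p.2, Function.uncurry χ (p.1, v)) ≤ ∫⁻ _ : I, b :=
            lintegral_mono fun v => hb _
        _ = b := by simp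

/-- `residual_le`, integrated over the source: up to δ, the probability of failure is the
γ-probability that the density exceeds k * δ. -/
lemma exists_fixedLength_codec [StandardBorelSpace 𝒰] [StandardBorelSpace 𝒳] [Nonempty 𝒳]
    {φ : 𝒴 × 𝒰 → 𝒳} (hφ : Measurable φ) {γ : Measure (𝒴 × 𝒳 × 𝒳)} [IsProbabilityMeasure γ]
    (hγ : γ.map (fun t => (t.1, t.2.1)) = μ) {ν : Measure (𝒴 × 𝒳 × 𝒳)}
    (hν : ν = (μ.prod η).map fun q => (q.1.1, q.1.2, φ (q.1.1, q.2))) (hac : γ ≪ ν)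
    (k : ℕ) (δ : ℝ≥0∞) :
    ∃ c : SharedCodec 𝒴 𝒳 (Fin (k + 1)),
      (c.law μ).map (fun t => (t.1, t.2.2)) = γ.map (fun t => (t.1, t.2.2)) ∧
      ∀ h : 𝒴 × 𝒳 × 𝒳 → ℝ≥0∞, Measurable h → ∀ b, (∀ t, h t ≤ b) →
        ∫⁻ t, h t ∂c.law μ ≤ ∫⁻ t, h t ∂γ + b * (δ + γ {t | k * δ < γ.rnDeriv ν t}) := by
  have hψ : Measurable fun q : (𝒴 × 𝒳) × 𝒰 => (q.1.1, q.1.2, φ (q.1.1, q.2)) := by fun_prop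
  have : IsProbabilityMeasure ν := by
    rw [hν]; exact Measure.isProbabilityMeasure_map hψ.aemeasurable
  obtain ⟨F, hF, -, h1, hlaw, -, hFeq⟩ := exists_density (η := η) hφ hγ (hν ▸ hac)
  obtain ⟨c, hc₁, hc₂⟩ := exists_fixedLength_codec_of_density hφ hF h1 hlaw k
  refine ⟨c, hc₁, fun h hh b hb => (hc₂ h hh b hb).trans ?_⟩
  gcongr
  rw [← hν] at hFeq
  have hS : MeasurableSet {t | k * δ < ENNReal.ofReal (γ.rnDeriv ν t).toReal} :=
    measurableSet_lt measurable_const (by fun_prop)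
  have hS' : MeasurableSet {q | k * δ < F q} := measurableSet_lt measurable_const hF
  have hγS : γ {t | k * δ < γ.rnDeriv ν t} =
      γ {t | k * δ < ENNReal.ofReal (γ.rnDeriv ν t).toReal} := by
    refine measure_congr (hac.ae_le ?_)
    filter_upwards [γ.rnDeriv_lt_top ν] with t ht
    change (k * δ < γ.rnDeriv ν t) = (k * δ < ENNReal.ofReal (γ.rnDeriv ν t).toReal)
    rw [ENNReal.ofReal_toReal ht.ne]
  have hγF : γ {t | k * δ < ENNReal.ofReal (γ.rnDeriv ν t).toReal} =
      ∫⁻ p, ∫⁻ u in {u | k * δ < F (p, u)}, F (p, u) ∂η ∂μ := by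
    have hpre : (fun q : (𝒴 × 𝒳) × 𝒰 => (q.1.1, q.1.2, φ (q.1.1, q.2))) ⁻¹'
        {t | k * δ < ENNReal.ofReal (γ.rnDeriv ν t).toReal} = {q | k * δ < F q} := by
      ext q
      simp only [Set.mem_preimage, Set.mem_ofPred_eq, hFeq q]
    calc γ {t | k * δ < ENNReal.ofReal (γ.rnDeriv ν t).toReal}
        = ((μ.prod η).withDensity F) {q | k * δ < F q} := by
          rw [← hpre, ← Measure.map_apply hψ hS, ← hlaw]
      _ = ∫⁻ p, ∫⁻ u, {q | k * δ < F q}.indicator F (p, u) ∂η ∂μ := by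
          rw [withDensity_apply _ hS', ← lintegral_indicator hS',
            lintegral_prod _ (hF.indicator hS').aemeasurable]
      _ = _ := by
          refine lintegral_congr fun p => ?_
          have hSp : MeasurableSet {u | k * δ < F (p, u)} :=
            measurableSet_lt measurable_const (hF.comp measurable_prodMk_left)
          rw [← lintegral_indicator hSp]
          rfl
  rw [hγS, hγF]
  calc ∫⁻ p, residual η (fun u => F (p, u)) k ∂μ
      ≤ ∫⁻ p, (δ + ∫⁻ u in {u | k * δ < F (p, u)}, F (p, u) ∂η) ∂μ :=
        lintegral_mono fun p => residual_le (hF.comp measurable_prodMk_left) k δ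
    _ = _ := by rw [lintegral_add_left measurable_const]; simp

end FixedLength
-- Product densities and the weak law of large numbers
section LawOfLargeNumbers

variable {α : Type*} [MeasurableSpace α]

lemma lintegral_pi_prod (a : Measure α) [IsProbabilityMeasure a] {n : ℕ} {f : Fin n → α → ℝ≥0∞}
    (hf : ∀ i, Measurable (f i)) :
    ∫⁻ x, ∏ i, f i (x i) ∂(Measure.pi fun _ : Fin n => a) = ∏ i, ∫⁻ x, f i x ∂a := by
  have hind : iIndepFun (fun (i : Fin n) (x : Fin n → α) => f i (x i))
      (Measure.pi fun _ : Fin n => a) := iIndepFun_pi fun i => (hf i).aemeasurable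
  have h := lintegral_prod_eq_prod_lintegral_of_indepFun Finset.univ _ hind fun i => by fun_prop
  rw [h]
  refine Finset.prod_congr rfl fun i _ => ?_
  rw [← (measurePreserving_eval (fun _ : Fin n => a) i).lintegral_comp (hf i)]

lemma pi_withDensity {ν γ : Measure α} [IsProbabilityMeasure ν] [IsProbabilityMeasure γ]
    {f : α → ℝ≥0∞} (hf : Measurable f) (hγ : γ = ν.withDensity f) (n : ℕ) :
    (Measure.pi fun _ : Fin n => γ) =
      (Measure.pi fun _ : Fin n => ν).withDensity fun t => ∏ i, f (t i) := by
  refine Measure.pi_eq fun s hs => ?_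
  have hms : MeasurableSet (Set.univ.pi s) := MeasurableSet.univ_pi hs
  rw [withDensity_apply _ hms, ← lintegral_indicator hms]
  have h : ∀ t : Fin n → α, (Set.univ.pi s).indicator (fun t => ∏ i, f (t i)) t =
      ∏ i, (s i).indicator f (t i) := fun t => by
    by_cases ht : t ∈ Set.univ.pi s
    · rw [Set.indicator_of_mem ht]
      exact Finset.prod_congr rfl fun i _ => (Set.indicator_of_mem (ht i trivial) _).symm
    · rw [Set.indicator_of_notMem ht]
      simp only [Set.mem_pi, Set.mem_univ, true_implies, not_forall] at ht
      obtain ⟨i, hi⟩ := ht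
      exact (Finset.prod_eq_zero (Finset.mem_univ i) (Set.indicator_of_notMem hi _)).symm
  simp_rw [h]
  rw [lintegral_pi_prod ν fun i => hf.indicator (hs i)]
  refine Finset.prod_congr rfl fun i _ => ?_
  rw [hγ, withDensity_apply _ (hs i), lintegral_indicator (hs i)]

/-- The weak law of large numbers, for the upper tail. -/
lemma tendsto_pi_sum_gt (γ : Measure α) [IsProbabilityMeasure γ] {X : α → ℝ} (hX : Measurable X)
    (hint : Integrable X γ) {c : ℝ} (hc : ∫ x, X x ∂γ < c) :
    Filter.Tendsto (fun n : ℕ => (Measure.pi fun _ : Fin n => γ) {t | n * c < ∑ i, X (t i)})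
      Filter.atTop (nhds 0) := by
  -- The strong law on the infinite product gives convergence in measure there; the tail event
  -- involves only the first n coordinates.
  let Q : Measure (ℕ → α) := Measure.infinitePi fun _ => γ
  have heval : ∀ i : ℕ, MeasurePreserving (fun ω : ℕ → α => ω i) Q γ := fun i =>
    ⟨measurable_pi_apply i, Measure.infinitePi_map_eval _ i⟩
  have hXi : ∀ i : ℕ, Measurable fun ω : ℕ → α => X (ω i) := fun i =>
    hX.comp (measurable_pi_apply i)
  have hmean : Q[fun ω => X (ω 0)] = ∫ x, X x ∂γ := by
    rw [← (heval 0).map_eq, integral_map (heval 0).measurable.aemeasurable hX.aestronglyMeasurable]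
  have hind : iIndepFun (fun (i : ℕ) (ω : ℕ → α) => X (ω i)) Q :=
    iIndepFun_infinitePi (X := fun _ => X) fun _ => hX
  have hident : ∀ i, IdentDistrib (fun ω : ℕ → α => X (ω i)) (fun ω => X (ω 0)) Q Q := fun i => by
    refine ⟨(hXi i).aemeasurable, (hXi 0).aemeasurable, ?_⟩
    have h : ∀ j, Q.map (fun ω => X (ω j)) = γ.map X := fun j => by
      rw [← (heval j).map_eq, Measure.map_map hX (by fun_prop)]
      rfl
    rw [h, h]
  have hslln := strong_law_ae_real (fun i (ω : ℕ → α) => X (ω i))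
    ((heval 0).integrable_comp_of_integrable hint) (fun i j hij => hind.indepFun hij) hident
  rw [hmean] at hslln
  have hmeas := tendstoInMeasure_of_tendsto_ae (fun n =>
    ((Finset.measurable_sum _ fun i _ => hXi i).div_const _).aestronglyMeasurable) hslln
  have hlim := hmeas (ENNReal.ofReal (c - ∫ x, X x ∂γ)) (by simpa using hc)
  refine tendsto_of_tendsto_of_tendsto_of_le_of_le' tendsto_const_nhds hlim
    (.of_forall fun _ => zero_le) ?_
  filter_upwards [Filter.eventually_ge_atTop 1] with n hn
  have hmap : Q.map (fun ω (i : Fin n) => ω (i : ℕ)) = Measure.pi fun _ : Fin n => γ := by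
    rw [Measure.map_infinitePi_infinitePi_of_inj (f := fun i : Fin n => (i : ℕ)) Fin.val_injective,
      Measure.infinitePi_eq_pi]
  rw [← hmap, Measure.map_apply (by fun_prop) (measurableSet_lt (by fun_prop) (by fun_prop))]
  refine measure_mono fun ω hω => ?_
  have hn0 : (0 : ℝ) < n := by exact_mod_cast hn
  simp only [Set.mem_preimage, Set.mem_ofPred_eq] at hω ⊢
  rw [edist_dist, Real.dist_eq]
  refine ENNReal.ofReal_le_ofReal (le_trans ?_ (le_abs_self _))
  rw [Fin.sum_univ_eq_sum_range (fun i => X (ω i)) n, mul_comm, ← lt_div_iff₀ hn0] at hω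
  linarith

end LawOfLargeNumbers

/-! ### Fixed-length block codes -/

section FixedLengthBlocks

variable {𝒴 𝒳 : Type*} [MeasurableSpace 𝒴] [MeasurableSpace 𝒳] {γ : Measure (𝒴 × 𝒳 × 𝒳)}
  [IsProbabilityMeasure γ] {μ : Measure (𝒴 × 𝒳)} [IsProbabilityMeasure μ]

lemma blockLaw_withDensity {ν : Measure (𝒴 × 𝒳 × 𝒳)} [IsProbabilityMeasure ν]
    {f : 𝒴 × 𝒳 × 𝒳 → ℝ≥0∞} (hf : Measurable f) (hγ : γ = ν.withDensity f) (n : ℕ) :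
    blockLaw γ n = (blockLaw ν n).withDensity fun t => ∏ i, f (t.1 i, t.2.1 i, t.2.2 i) := by
  have he : Measurable fun t : Fin n → 𝒴 × 𝒳 × 𝒳 =>
      ((fun i => (t i).1, fun i => (t i).2.1, fun i => (t i).2.2) :
        (Fin n → 𝒴) × (Fin n → 𝒳) × (Fin n → 𝒳)) := by fun_prop
  ext A hA
  rw [blockLaw, Measure.map_apply he hA, withDensity_apply _ hA, blockLaw,
    setLIntegral_map hA (by fun_prop) he, pi_withDensity hf hγ, withDensity_apply _ (he hA)]

/-- The density of a block is the product of the densities of its letters. Where it exceeds x no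
factor vanishes, and its logarithm is the sum of the terms `llr`. -/
lemma blockLaw_rnDeriv_gt_le {ν : Measure (𝒴 × 𝒳 × 𝒳)} [IsProbabilityMeasure ν] (hac : γ ≪ ν)
    (n : ℕ) (z : ℝ) {x : ℝ≥0∞} (hx : ENNReal.ofReal (Real.exp z) ≤ x) :
    blockLaw γ n {t | x < (blockLaw γ n).rnDeriv (blockLaw ν n) t} ≤
      (Measure.pi fun _ : Fin n => γ) {t | z < ∑ i, llr γ ν (t i)} := by
  have hγ : γ = ν.withDensity (γ.rnDeriv ν) := (Measure.withDensity_rnDeriv_eq _ _ hac).symm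
  have hf : Measurable (γ.rnDeriv ν) := Measure.measurable_rnDeriv _ _
  have hb := blockLaw_withDensity hf hγ n
  have hg : Measurable fun t : (Fin n → 𝒴) × (Fin n → 𝒳) × (Fin n → 𝒳) =>
      ∏ i, γ.rnDeriv ν (t.1 i, t.2.1 i, t.2.2 i) := by fun_prop
  have hacb : blockLaw γ n ≪ blockLaw ν n := by
    rw [hb]; exact withDensity_absolutelyContinuous _ _
  have hrn : (blockLaw γ n).rnDeriv (blockLaw ν n) =ᵐ[blockLaw ν n]
      fun t => ∏ i, γ.rnDeriv ν (t.1 i, t.2.1 i, t.2.2 i) := by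
    conv_lhs => rw [hb]
    exact Measure.rnDeriv_withDensity _ hg
  have he : Measurable fun t : Fin n → 𝒴 × 𝒳 × 𝒳 =>
      ((fun i => (t i).1, fun i => (t i).2.1, fun i => (t i).2.2) :
        (Fin n → 𝒴) × (Fin n → 𝒳) × (Fin n → 𝒳)) := by fun_prop
  calc blockLaw γ n {t | x < (blockLaw γ n).rnDeriv (blockLaw ν n) t}
      = blockLaw γ n {t | x < ∏ i, γ.rnDeriv ν (t.1 i, t.2.1 i, t.2.2 i)} := by
        refine measure_congr (hacb.ae_le ?_)
        filter_upwards [hrn] with t ht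
        change (x < _) = (x < _)
        rw [ht]
    _ = (Measure.pi fun _ : Fin n => γ) {t | x < ∏ i, γ.rnDeriv ν (t i)} := by
        rw [blockLaw, Measure.map_apply he (measurableSet_lt measurable_const hg)]
        rfl
    _ ≤ _ := by
        refine measure_mono_ae ?_
        have hfin : ∀ᵐ t ∂(Measure.pi fun _ : Fin n => γ), ∀ i, γ.rnDeriv ν (t i) < ∞ :=
          ae_all_iff.2 fun i => (measurePreserving_eval (fun _ : Fin n => γ)
            i).quasiMeasurePreserving.ae (hac.ae_le (γ.rnDeriv_lt_top ν))
        filter_upwards [hfin] with t ht hlt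
        change x < ∏ i, γ.rnDeriv ν (t i) at hlt
        change z < ∑ i, llr γ ν (t i)
        have h0 : ∀ i, γ.rnDeriv ν (t i) ≠ 0 := fun i hi => by
          rw [Finset.prod_eq_zero (Finset.mem_univ i) hi] at hlt
          exact not_lt_zero hlt
        have hpos : ∀ i, 0 < (γ.rnDeriv ν (t i)).toReal := fun i =>
          ENNReal.toReal_pos (h0 i) (ht i).ne
        have hlt' : Real.exp z < ∏ i, (γ.rnDeriv ν (t i)).toReal := by
          rw [← ENNReal.toReal_prod]
          refine (ENNReal.ofReal_lt_iff_lt_toReal (Real.exp_pos z).le ?_).1 (hx.trans_lt hlt)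
          exact (ENNReal.prod_lt_top fun i _ => ht i).ne
        simp only [llr]
        rw [← Real.log_prod fun i _ => (hpos i).ne']
        exact (Real.lt_log_iff_exp_lt (Finset.prod_pos fun i _ => hpos i)).2 hlt'

lemma map_source_law {𝓜 : Type*} [MeasurableSpace 𝓜] (c : SharedCodec 𝒴 𝒳 𝓜) :
    (c.law μ).map (fun t => (t.1, t.2.1)) = μ := by
  have hlaw : Measurable fun t : (𝒴 × 𝒳) × I => (t.1.1, t.1.2, c.dec ((t.1.1, c.enc t), t.2)) :=
    measurable_fst.fst.prodMk (measurable_fst.snd.prodMk (c.measurable_dec.comp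
      ((measurable_fst.fst.prodMk c.measurable_enc).prodMk measurable_snd)))
  rw [SharedCodec.law, Measure.map_map (by fun_prop) hlaw]
  exact (Measure.map_fst_prod (μ := μ) (ν := (volume : Measure I))).trans (by simp)

lemma letterLaw_map_congr {n : ℕ} {Γ Γ' : Measure ((Fin n → 𝒴) × (Fin n → 𝒳) × (Fin n → 𝒳))}
    (h : Γ.map (fun t => (t.1, t.2.2)) = Γ'.map (fun t => (t.1, t.2.2))) (i : Fin n) :
    (letterLaw Γ i).map (fun t => (t.1, t.2.2)) = (letterLaw Γ' i).map (fun t => (t.1, t.2.2)) := by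
  have key : ∀ Λ : Measure ((Fin n → 𝒴) × (Fin n → 𝒳) × (Fin n → 𝒳)),
      (letterLaw Λ i).map (fun t => (t.1, t.2.2)) =
        (Λ.map (fun t => (t.1, t.2.2))).map fun p => (p.1 i, p.2 i) := fun Λ => by
    rw [letterLaw, Measure.map_map (by fun_prop) (by fun_prop),
      Measure.map_map (by fun_prop) (by fun_prop)]
    rfl
  rw [key, key, h]

lemma map_source_letterLaw {n : ℕ} {Γ : Measure ((Fin n → 𝒴) × (Fin n → 𝒳) × (Fin n → 𝒳))}
    (h : Γ.map (fun t => (t.1, t.2.1)) = iidSource μ n) (i : Fin n) :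
    (letterLaw Γ i).map (fun t => (t.1, t.2.1)) = μ := by
  have key : (letterLaw Γ i).map (fun t => (t.1, t.2.1)) =
        (Γ.map (fun t => (t.1, t.2.1))).map fun p => (p.1 i, p.2 i) := by
    rw [letterLaw, Measure.map_map (by fun_prop) (by fun_prop),
      Measure.map_map (by fun_prop) (by fun_prop)]
    rfl
  rw [key, h, iidSource, Measure.map_map (by fun_prop) (by fun_prop)]
  exact (measurePreserving_eval (fun _ : Fin n => μ) i).map_eq

variable [StandardBorelSpace 𝒳] [Nonempty 𝒳]

lemma setLIntegral_condDistortion {Δ : 𝒳 → 𝒳 → ℝ≥0∞} (hΔ : Measurable (Function.uncurry Δ))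
    (γ : Measure (𝒴 × 𝒳 × 𝒳)) [IsFiniteMeasure γ] {A : Set 𝒴} (hA : MeasurableSet A) :
    ∫⁻ y in A, condDistortion Δ γ y ∂γ.fst =
      ∫⁻ t, A.indicator (fun _ => Δ t.2.1 t.2.2) t.1 ∂γ := by
  have hm : Measurable fun t : 𝒴 × 𝒳 × 𝒳 => A.indicator (fun _ => Δ t.2.1 t.2.2) t.1 := by
    have h : Measurable fun t : 𝒴 × 𝒳 × 𝒳 => Δ t.2.1 t.2.2 := hΔ.comp measurable_snd
    exact h.indicator (measurable_fst hA)
  conv_rhs => rw [← γ.disintegrate γ.condKernel]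
  rw [Measure.lintegral_compProd hm, ← lintegral_indicator hA]
  refine lintegral_congr fun y => ?_
  by_cases hy : y ∈ A
  · simp [hy, condDistortion]
  · simp [hy]

lemma measurable_condDistortion {Δ : 𝒳 → 𝒳 → ℝ≥0∞} (hΔ : Measurable (Function.uncurry Δ))
    (γ : Measure (𝒴 × 𝒳 × 𝒳)) [IsFiniteMeasure γ] : Measurable (condDistortion Δ γ) :=
  hΔ.lintegral_kernel (κ := γ.condKernel)

/-- A perturbation of the law of the triple that is small enough costs an arbitrarily small excess
distortion. -/
lemma exists_perturbation_atMost [StandardBorelSpace 𝒴] {s : Sense}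
    (hs : s = Sense.average ∨ Finite 𝒴) {Δ : 𝒳 → 𝒳 → ℝ≥0∞}
    (hΔ : Measurable (Function.uncurry Δ)) {D : ℝ≥0∞}
    (h : s.AtMost γ.fst (condDistortion Δ γ) D) (ε : ℝ≥0∞) :
    ∃ β : ℝ≥0∞, β ≠ 0 ∧ β ≤ 1 ∧ ∀ (γ' : Measure (𝒴 × 𝒳 × 𝒳)) [IsFiniteMeasure γ'],
      γ'.fst = γ.fst →
      (∀ A : Set 𝒴, MeasurableSet A → ∫⁻ t, A.indicator (fun _ => Δ t.2.1 t.2.2) t.1 ∂γ' ≤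
        ∫⁻ t, A.indicator (fun _ => Δ t.2.1 t.2.2) t.1 ∂γ + β * ε) →
      s.AtMost γ'.fst (condDistortion Δ γ') (D + ε) := by
  cases s with
  | average =>
    refine ⟨1, one_ne_zero, le_rfl, fun γ' _ hfst hle => ?_⟩
    refine ⟨_, measurable_condDistortion hΔ γ', .of_forall fun _ => le_rfl, ?_⟩
    have h₁ := hle Set.univ MeasurableSet.univ
    rw [← setLIntegral_condDistortion hΔ _ MeasurableSet.univ,
      ← setLIntegral_condDistortion hΔ _ MeasurableSet.univ, setLIntegral_univ,
      setLIntegral_univ, one_mul] at h₁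
    exact h₁.trans (by gcongr; exact h.lintegral_le)
  | almostSure =>
    have hfin : Finite 𝒴 := hs.resolve_left (by simp)
    have : Fintype 𝒴 := Fintype.ofFinite 𝒴
    classical
    let S : Finset 𝒴 := Finset.univ.filter fun y => γ.fst {y} ≠ 0
    have hS : S.Nonempty := by
      by_contra hS
      have h0 : ∀ y, γ.fst {y} = 0 := fun y => by
        by_contra hy
        exact hS ⟨y, by simp [S, hy]⟩
      have : γ.fst Set.univ = 0 := by
        rw [← Set.biUnion_of_singleton (Set.univ : Set 𝒴)]
        exact (measure_biUnion_null_iff Set.countable_univ).2 fun y _ => h0 y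
      simp at this
    obtain ⟨y₀, hy₀, hmin⟩ := S.exists_min_image (fun y => γ.fst {y}) hS
    -- The least positive mass of a value of Y: an excess of this mass times ε, localised at one y,
    -- is at most ε after division by the mass of y.
    refine ⟨γ.fst {y₀}, (Finset.mem_filter.1 hy₀).2, prob_le_one, fun γ' _ hfst hle => ?_⟩
    have h' : ∀ᵐ y ∂γ.fst, condDistortion Δ γ y ≤ D := h
    change ∀ᵐ y ∂γ'.fst, condDistortion Δ γ' y ≤ D + ε
    rw [hfst]
    have hpos : ∀ᵐ y ∂γ.fst, γ.fst {y} ≠ 0 := by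
      rw [ae_iff]
      have : {y | ¬ γ.fst {y} ≠ 0} = ⋃ y ∈ {y | ¬ γ.fst {y} ≠ 0}, {y} := by
        rw [Set.biUnion_of_singleton]
      rw [this]
      refine (measure_biUnion_null_iff (Set.to_countable _)).2 fun y hy => ?_
      simpa using hy
    filter_upwards [h', hpos] with y hy hy0
    have h₁ := hle {y} (MeasurableSet.singleton y)
    rw [← setLIntegral_condDistortion hΔ _ (MeasurableSet.singleton y),
      ← setLIntegral_condDistortion hΔ _ (MeasurableSet.singleton y), hfst,
      lintegral_singleton, lintegral_singleton] at h₁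
    have h₂ : condDistortion Δ γ' y * γ.fst {y} ≤ (D + ε) * γ.fst {y} := by
      refine h₁.trans ?_
      rw [add_mul, mul_comm (γ.fst {y₀})]
      exact add_le_add (mul_le_mul_left hy _)
        (mul_le_mul_right (hmin y (by simp [S, hy0])) ε)
    exact (ENNReal.mul_le_mul_iff_left hy0 (measure_ne_top _ _)).1 h₂

/-- With k + 1 = ⌊2 ^ (nR)⌋, one message being reserved for failure, k is at least half of 2 ^ (nR)
once that power is at least 4; then 2 ^ (n (R - c)) ≥ 2 / δ suffices. -/
lemma eventually_exp_le_floor {c R : ℝ} (hc : 0 ≤ c) (hcR : c < R) {δ : ℝ} (hδ : 0 < δ) :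
    ∀ᶠ n : ℕ in Filter.atTop, ∃ k : ℕ, ((k + 1 : ℕ) : ℝ) ≤ 2 ^ ((n : ℝ) * R) ∧
      Real.exp (n * (c * Real.log 2)) ≤ k * δ := by
  have hlog2 : 0 < Real.log 2 := Real.log_pos (by norm_num)
  have h : ∀ {a : ℝ}, 0 < a → Filter.Tendsto (fun n : ℕ => (2 : ℝ) ^ ((n : ℝ) * a))
      Filter.atTop Filter.atTop := fun {a} ha => by
    have h₁ : Filter.Tendsto (fun n : ℕ => (n : ℝ) * (a * Real.log 2)) Filter.atTop Filter.atTop :=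
      tendsto_natCast_atTop_atTop.atTop_mul_const (by positivity)
    refine (Real.tendsto_exp_atTop.comp h₁).congr fun n => ?_
    rw [Real.rpow_def_of_pos (by norm_num), Function.comp]
    ring_nf
  filter_upwards [(h (sub_pos.2 hcR)).eventually_ge_atTop (2 / δ),
    (h (hc.trans_lt hcR)).eventually_ge_atTop 4] with n hn₁ hn₂
  have hfl := Nat.lt_floor_add_one ((2 : ℝ) ^ ((n : ℝ) * R))
  have hfl' := Nat.floor_le (show (0 : ℝ) ≤ (2 : ℝ) ^ ((n : ℝ) * R) by positivity)
  obtain ⟨k, hk⟩ : ∃ k, ⌊(2 : ℝ) ^ ((n : ℝ) * R)⌋₊ = k + 1 := by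
    refine Nat.exists_eq_succ_of_ne_zero fun h0 => ?_
    rw [h0] at hfl
    norm_num at hfl
    linarith
  rw [hk] at hfl hfl'
  refine ⟨k, hfl', ?_⟩
  have hexp : Real.exp (n * (c * Real.log 2)) = 2 ^ ((n : ℝ) * c) := by
    rw [Real.rpow_def_of_pos (by norm_num)]
    ring_nf
  have hsplit : (2 : ℝ) ^ ((n : ℝ) * R) = 2 ^ ((n : ℝ) * c) * 2 ^ ((n : ℝ) * (R - c)) := by
    rw [← Real.rpow_add (by norm_num)]
    ring_nf
  push_cast at hfl
  have hk2 : (2 : ℝ) ^ ((n : ℝ) * R) / 2 ≤ k := by linarith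
  rw [hexp]
  have hp : (0 : ℝ) < 2 ^ ((n : ℝ) * c) := by positivity
  rw [div_le_iff₀ hδ] at hn₁
  calc (2 : ℝ) ^ ((n : ℝ) * c) ≤ 2 ^ ((n : ℝ) * c) * (2 ^ ((n : ℝ) * (R - c)) * δ / 2) := by
        nlinarith
    _ = 2 ^ ((n : ℝ) * R) / 2 * δ := by rw [hsplit]; ring
    _ ≤ k * δ := by gcongr

lemma exists_fixedLength_block_codec [StandardBorelSpace 𝒴] {s : Sense}
    {Δ : 𝒳 → 𝒳 → ℝ≥0∞} (hΔ : Measurable (Function.uncurry Δ)) {b : ℝ≥0} (hb : ∀ x x', Δ x x' ≤ b)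
    (hs : s = Sense.average ∨ Finite 𝒴) {d : Measure 𝒳 → Measure 𝒳 → ℝ≥0∞} {D P : ℝ≥0∞}
    {R ε : ℝ≥0} (hR : rdcpFunction s Δ d μ D P < R) (hε : 0 < ε) :
    ∃ N : ℕ, ∀ n ≥ N, ∃ m : ℕ, (m : ℝ) ≤ 2 ^ ((n : ℝ) * R) ∧
      ∃ c : SharedCodec (Fin n → 𝒴) (Fin n → 𝒳) (Fin m),
        ∀ i, Meets s Δ d (D + ε) P (letterLaw (c.law (iidSource μ n)) i) := by
  have hlog2 : 0 < Real.log 2 := Real.log_pos (by norm_num)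
  obtain ⟨κ, hκ, hm, hI⟩ := exists_of_rdcpFunction_lt hR
  set γ := tripleLaw μ κ
  have hγ : γ.map (fun t => (t.1, t.2.1)) = μ := map_source_tripleLaw μ κ
  have hne : condMutualInfo γ ≠ ∞ := (hI.trans ENNReal.coe_lt_top).ne
  set a := (condMutualInfo γ).toReal
  have ha : 0 ≤ a := ENNReal.toReal_nonneg
  have haR : a < R := by
    have := (ENNReal.toReal_lt_toReal hne ENNReal.coe_ne_top).2 hI
    simpa using this
  -- The gap above a serves the law of large numbers, the gap below R the number of messages.
  obtain ⟨r, hac, hcR⟩ := exists_between haR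
  obtain ⟨φ, hφ, hφR⟩ := (reconGiven γ).exists_measurable_map_eq_unitInterval
  have hkl := toReal_condMutualInfo_mul_log hγ hne
  rw [indepLaw_eq_map hφ hφR] at hkl
  have hψ : Measurable fun q : (𝒴 × 𝒳) × I => (q.1.1, q.1.2, Function.uncurry φ (q.1.1, q.2)) := by
    fun_prop
  set ν := (μ.prod (volume : Measure I)).map
    fun q => (q.1.1, q.1.2, Function.uncurry φ (q.1.1, q.2)) with hν
  have : IsProbabilityMeasure ν := Measure.isProbabilityMeasure_map hψ.aemeasurable
  obtain ⟨habs, hint⟩ := klDiv_ne_top_iff.1 (hkl.trans_ne ENNReal.ofReal_ne_top)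
  have hmean : ∫ t, llr γ ν t ∂γ < r * Real.log 2 := by
    rw [← toReal_klDiv_of_measure_eq habs (by simp), hkl,
      ENNReal.toReal_ofReal (by positivity)]
    gcongr
  have htail := tendsto_pi_sum_gt γ (measurable_llr γ ν) hint hmean
  obtain ⟨β, hβ0, hβ1, hβ⟩ := exists_perturbation_atMost hs hΔ hm.1 (ε : ℝ≥0∞)
  have hβtop : β ≠ ∞ := ne_top_of_le_ne_top ENNReal.one_ne_top hβ1
  -- Failure has probability at most δ + δ and costs at most b, so the excess distortion stays below
  -- β * ε. The term + 1 covers b = 0.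
  set δ : ℝ≥0∞ := β * ε / (2 * (b + 1)) with hδ
  have hδ0 : δ ≠ 0 := by
    rw [hδ]
    exact (ENNReal.div_pos (mul_ne_zero hβ0 (by simpa using hε.ne')) (by finiteness)).ne'
  have hδtop : δ ≠ ∞ := ENNReal.div_ne_top (ENNReal.mul_ne_top hβtop ENNReal.coe_ne_top) (by simp)
  have hbδ : (b : ℝ≥0∞) * (δ + δ) ≤ β * ε := by
    calc (b : ℝ≥0∞) * (δ + δ) ≤ (2 * (b + 1)) * δ := by
          rw [← two_mul, ← mul_assoc, mul_comm (b : ℝ≥0∞) 2]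
          gcongr
          exact le_self_add
      _ = β * ε := by
          rw [hδ, ENNReal.mul_div_cancel (by simp) (by finiteness)]
  obtain ⟨N, hN⟩ := Filter.eventually_atTop.1 ((eventually_exp_le_floor (ha.trans hac.le) hcR
    (ENNReal.toReal_pos hδ0 hδtop)).and (ENNReal.tendsto_nhds_zero.1 htail δ (pos_iff_ne_zero.2 hδ0)))
  refine ⟨N, fun n hn => ?_⟩
  obtain ⟨⟨k, hk₁, hk₂⟩, hn₂⟩ := hN n hn
  refine ⟨k + 1, hk₁, ?_⟩
  have hφn : Measurable fun q : (Fin n → 𝒴) × (Fin n → I) =>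
      fun i => Function.uncurry φ (q.1 i, q.2 i) := by fun_prop
  have hacn : blockLaw γ n ≪ blockLaw ν n := by
    rw [blockLaw_withDensity (Measure.measurable_rnDeriv _ _)
      (Measure.withDensity_rnDeriv_eq _ _ habs).symm n]
    exact withDensity_absolutelyContinuous _ _
  obtain ⟨c, hc₁, hc₂⟩ := exists_fixedLength_codec
    (η := Measure.pi fun _ : Fin n => (volume : Measure I)) hφn (map_source_blockLaw hγ n)
    (map_iidSource_prod_pi hφ n).symm hacn k δ
  refine ⟨c, fun i => ?_⟩
  have hfail : blockLaw γ n {t | k * δ < (blockLaw γ n).rnDeriv (blockLaw ν n) t} ≤ δ := by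
    refine (blockLaw_rnDeriv_gt_le habs n (n * (r * Real.log 2)) ?_).trans hn₂
    calc ENNReal.ofReal (Real.exp (n * (r * Real.log 2))) ≤ ENNReal.ofReal (k * δ.toReal) :=
          ENNReal.ofReal_le_ofReal hk₂
      _ = k * δ := by
          rw [ENNReal.ofReal_mul (Nat.cast_nonneg k), ENNReal.ofReal_natCast,
            ENNReal.ofReal_toReal hδtop]
  have hsrc := map_source_letterLaw (map_source_law (μ := iidSource μ n) c) i
  have hrec := letterLaw_map_congr hc₁ i
  rw [letterLaw_blockLaw] at hrec
  have hfst : (letterLaw (c.law (iidSource μ n)) i).fst = γ.fst := by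
    rw [fst_eq_of_map_source hsrc, fst_eq_of_map_source hγ]
  constructor
  · refine hβ _ hfst fun A hA => ?_
    have hmA : Measurable fun t : 𝒴 × 𝒳 × 𝒳 => A.indicator (fun _ => Δ t.2.1 t.2.2) t.1 := by
      have h : Measurable fun t : 𝒴 × 𝒳 × 𝒳 => Δ t.2.1 t.2.2 := hΔ.comp measurable_snd
      exact h.indicator (measurable_fst hA)
    have hpr : Measurable fun t : (Fin n → 𝒴) × (Fin n → 𝒳) × (Fin n → 𝒳) =>
        (t.1 i, t.2.1 i, t.2.2 i) := by fun_prop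
    have h₂ := hc₂ _ (hmA.comp hpr) b fun t => by
      by_cases ht : t.1 i ∈ A
      · simpa [ht] using hb _ _
      · simp [ht]
    have h₃ : ∀ Γ : Measure ((Fin n → 𝒴) × (Fin n → 𝒳) × (Fin n → 𝒳)),
        ∫⁻ t, A.indicator (fun _ => Δ t.2.1 t.2.2) t.1 ∂letterLaw Γ i =
          ∫⁻ t, ((fun t => A.indicator (fun _ => Δ t.2.1 t.2.2) t.1) ∘
            fun t => (t.1 i, t.2.1 i, t.2.2 i)) t ∂Γ := fun Γ => by
      rw [letterLaw, lintegral_map hmA hpr]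
      rfl
    rw [← h₃, ← h₃, letterLaw_blockLaw] at h₂
    exact h₂.trans (add_le_add_right ((mul_le_mul_right (add_le_add_right hfail _) _).trans hbδ) _)
  -- No loss in perception: the laws of (Y_i, X_i) and of (Y_i, X̂_i) are those of γ.
  · rw [hfst]
    refine hm.2.congr ?_
    have h₁ := sourceGiven_ae_eq hsrc
    have h₂ := sourceGiven_ae_eq hγ
    have h₃ := reconGiven_ae_eq hrec
    have h₄ := reconGiven_ae_eq (γ := γ) rfl
    have h₅ : (γ.map fun t => (t.1, t.2.2)).fst = γ.fst := fst_map_prodMk γ (by fun_prop)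
    rw [h₅] at h₃ h₄
    rw [← fst_eq_of_map_source hγ] at h₁ h₂
    filter_upwards [h₁, h₂, h₃, h₄] with y e₁ e₂ e₃ e₄
    rw [condPerception, condPerception, e₁, e₂, e₃, e₄]

end FixedLengthBlocks
-- The converse by change of measure
section Converse

variable {𝒴 𝒳 : Type*} [MeasurableSpace 𝒴] [MeasurableSpace 𝒳] {μ : Measure (𝒴 × 𝒳)}
  [IsProbabilityMeasure μ]

lemma iidSource_map_eq {ρ : Measure 𝒴} [IsProbabilityMeasure ρ] {χ : 𝒴 × I → 𝒳}
    (hχ : Measurable χ) (hμ : μ = (ρ.prod (volume : Measure I)).map fun q => (q.1, χ q)) (n : ℕ) :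
    iidSource μ n = ((Measure.pi fun _ : Fin n => ρ).prod
      (Measure.pi fun _ : Fin n => (volume : Measure I))).map
        fun q => (q.1, fun i => χ (q.1 i, q.2 i)) := by
  have hm : Measurable fun q : 𝒴 × I => (q.1, χ q) := by fun_prop
  have hs : ∀ _ : Fin n, SigmaFinite ((ρ.prod (volume : Measure I)).map fun q => (q.1, χ q)) :=
    fun _ => by rw [← hμ]; infer_instance
  rw [map_pi_prod_pi _ _ _ (by fun_prop), iidSource]
  conv_lhs => rw [hμ]
  rw [← Measure.pi_map_pi (f := fun _ q => (q.1, χ q)) (fun _ => hm.aemeasurable),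
    Measure.map_map (by fun_prop) (by fun_prop)]
  rfl

variable [StandardBorelSpace 𝒳] [Nonempty 𝒳]

lemma exists_condKernel_map_eq (μ : Measure (𝒴 × 𝒳)) [IsProbabilityMeasure μ] :
    ∃ χ : 𝒴 × I → 𝒳, Measurable χ ∧
      (∀ y, (volume : Measure I).map (fun u => χ (y, u)) = μ.condKernel y) ∧
      μ = (μ.fst.prod (volume : Measure I)).map fun q => (q.1, χ q) := by
  obtain ⟨χ, hχ, hχμ⟩ := μ.condKernel.exists_measurable_map_eq_unitInterval
  refine ⟨Function.uncurry χ, hχ, hχμ, ?_⟩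
  have hm : Measurable fun q : 𝒴 × I => (q.1, Function.uncurry χ q) := by fun_prop
  have hχy : ∀ y, Measurable (χ y) := fun y => hχ.comp measurable_prodMk_left
  conv_lhs => rw [← μ.disintegrate μ.condKernel]
  ext A hA
  rw [Measure.compProd_apply hA, Measure.map_apply hm hA, Measure.prod_apply (hm hA)]
  refine lintegral_congr fun y => ?_
  rw [← hχμ, Measure.map_apply (hχy y) (measurable_prodMk_left hA)]
  rfl

lemma measurable_triple {𝓜 : Type*} [MeasurableSpace 𝓜] (c : SharedCodec 𝒴 𝒳 𝓜) :
    Measurable fun t : (𝒴 × 𝒳) × I => (t.1.1, t.1.2, c.dec ((t.1.1, c.enc t), t.2)) :=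
  measurable_fst.fst.prodMk (measurable_fst.snd.prodMk (c.measurable_dec.comp
    ((measurable_fst.fst.prodMk c.measurable_enc).prodMk measurable_snd)))

/-- If the weights `q` of the messages in use sum to at most one, then a product of letterwise
tests of mean at most one for every fixed reconstruction has weighted mean at most one. -/
lemma lintegral_prod_mul_weight_le {n : ℕ} {𝓜 : Type*} [MeasurableSpace 𝓜] [Countable 𝓜]
    [DiscreteMeasurableSpace 𝓜] (c : SharedCodec (Fin n → 𝒴) (Fin n → 𝒳) 𝓜) {q : 𝓜 → ℝ≥0∞}
    (hq : ∀ y w, ∑' m, (Set.range fun x => c.enc ((y, x), w)).indicator q m ≤ 1)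
    {g : 𝒴 × 𝒳 × 𝒳 → ℝ≥0∞} (hg : Measurable g)
    (hg1 : ∀ y x', ∫⁻ x, g (y, x, x') ∂μ.condKernel y ≤ 1) :
    ∫⁻ t, (∏ i, g (t.1.1 i, t.1.2 i, c.dec ((t.1.1, c.enc t), t.2) i)) * q (c.enc t)
      ∂((iidSource μ n).prod (volume : Measure I)) ≤ 1 := by
  obtain ⟨χ, hχ, hχμ, hμ⟩ := exists_condKernel_map_eq μ
  have hq' : Measurable q := Measurable.of_discrete
  have hm : Measurable fun t : ((Fin n → 𝒴) × (Fin n → 𝒳)) × I =>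
      (∏ i, g (t.1.1 i, t.1.2 i, c.dec ((t.1.1, c.enc t), t.2) i)) * q (c.enc t) := by
    have h := measurable_triple c
    refine Measurable.mul ?_ (hq'.comp c.measurable_enc)
    have h' : Measurable fun t : (Fin n → 𝒴) × (Fin n → 𝒳) × (Fin n → 𝒳) =>
      ∏ i, g (t.1 i, t.2.1 i, t.2.2 i) := by fun_prop
    exact h'.comp h
  have hΦ : Measurable fun p : (Fin n → 𝒴) × (Fin n → I) => (p.1, fun i => χ (p.1 i, p.2 i)) := by
    fun_prop
  rw [lintegral_prod_symm _ hm.aemeasurable, iidSource_map_eq hχ hμ]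
  have hw : ∀ w : I, ∫⁻ p, (∏ i, g (p.1 i, p.2 i, c.dec ((p.1, c.enc (p, w)), w) i)) *
      q (c.enc (p, w)) ∂(((Measure.pi fun _ : Fin n => μ.fst).prod
      (Measure.pi fun _ : Fin n => (volume : Measure I))).map
        fun q => (q.1, fun i => χ (q.1 i, q.2 i))) ≤ 1 := fun w => by
    have hmw : Measurable fun p : (Fin n → 𝒴) × (Fin n → 𝒳) =>
        (∏ i, g (p.1 i, p.2 i, c.dec ((p.1, c.enc (p, w)), w) i)) * q (c.enc (p, w)) :=
      hm.comp measurable_prodMk_right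
    have hmw' : Measurable fun p : (Fin n → 𝒴) × (Fin n → I) =>
        (∏ i, g (p.1 i, χ (p.1 i, p.2 i),
          c.dec ((p.1, c.enc ((p.1, fun i => χ (p.1 i, p.2 i)), w)), w) i)) *
          q (c.enc ((p.1, fun i => χ (p.1 i, p.2 i)), w)) := hmw.comp hΦ
    rw [lintegral_map hmw hΦ, lintegral_prod _ hmw'.aemeasurable]
    refine (lintegral_mono (g := fun _ => 1) fun y => ?_).trans (by simp)
    set S := Set.range fun x => c.enc ((y, x), w) with hS
    have hbox : ∀ m, Measurable fun u : Fin n → I =>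
        ∏ i, g (y i, χ (y i, u i), c.dec ((y, m), w) i) := fun m => by fun_prop
    -- Passing from the message sent to the sum over all messages in use unties the reconstruction
    -- from the source: y, w and m determine X̂^n, while the letters X_i remain independent given y.
    calc ∫⁻ u, (∏ i, g (y i, χ (y i, u i),
            c.dec ((y, c.enc ((y, fun i => χ (y i, u i)), w)), w) i)) *
            q (c.enc ((y, fun i => χ (y i, u i)), w)) ∂(Measure.pi fun _ : Fin n => volume)
        ≤ ∫⁻ u, ∑' m, (∏ i, g (y i, χ (y i, u i), c.dec ((y, m), w) i)) * S.indicator q m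
            ∂(Measure.pi fun _ : Fin n => volume) := by
          refine lintegral_mono fun u => ?_
          refine le_trans (le_of_eq ?_) (ENNReal.le_tsum (c.enc ((y, fun i => χ (y i, u i)), w)))
          have hmem : c.enc ((y, fun i => χ (y i, u i)), w) ∈ S := ⟨_, rfl⟩
          rw [Set.indicator_of_mem hmem]
      _ = ∑' m, (∏ i, ∫⁻ u, g (y i, χ (y i, u), c.dec ((y, m), w) i)) * S.indicator q m := by
          rw [lintegral_tsum fun m => ((hbox m).mul_const _).aemeasurable]
          refine tsum_congr fun m => ?_
          rw [lintegral_mul_const _ (hbox m), lintegral_pi_prod (volume : Measure I)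
            (f := fun i u => g (y i, χ (y i, u), c.dec ((y, m), w) i)) fun i => by fun_prop]
      _ ≤ ∑' m, S.indicator q m := by
          refine ENNReal.tsum_le_tsum fun m => mul_le_of_le_one_left' ?_
          refine Finset.prod_le_one' fun i _ => ?_
          refine le_trans (le_of_eq ?_) (hg1 (y i) (c.dec ((y, m), w) i))
          rw [← hχμ, lintegral_map (f := fun x => g (y i, x, c.dec ((y, m), w) i))
            (by fun_prop) (by fun_prop)]
      _ ≤ 1 := hq y w
  exact (lintegral_mono hw).trans (by simp)

/-- The mean of the laws of the letters. -/
noncomputable def meanLetterLaw {n : ℕ} (Γ : Measure ((Fin n → 𝒴) × (Fin n → 𝒳) × (Fin n → 𝒳))) :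
    Measure (𝒴 × 𝒳 × 𝒳) :=
  ∑ i, (n : ℝ≥0)⁻¹ • letterLaw Γ i

lemma mul_lintegral_meanLetterLaw {n : ℕ} (hn : n ≠ 0)
    (Γ : Measure ((Fin n → 𝒴) × (Fin n → 𝒳) × (Fin n → 𝒳))) {f : 𝒴 × 𝒳 × 𝒳 → ℝ≥0∞}
    (hf : Measurable f) :
    n * ∫⁻ t, f t ∂meanLetterLaw Γ = ∫⁻ t, ∑ i, f (t.1 i, t.2.1 i, t.2.2 i) ∂Γ := by
  have hn' : (n : ℝ≥0∞) ≠ 0 := by exact_mod_cast hn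
  rw [meanLetterLaw, lintegral_sum_smul, ← Finset.mul_sum, ← mul_assoc,
    ENNReal.coe_inv (by exact_mod_cast hn), ENNReal.coe_natCast,
    ENNReal.mul_inv_cancel hn' (ENNReal.natCast_ne_top n), one_mul,
    lintegral_finsetSum _ fun i _ => by fun_prop]
  refine Finset.sum_congr rfl fun i _ => ?_
  rw [letterLaw, lintegral_map hf (by fun_prop)]

/-- The change-of-measure bound, for a test of mean at most one for every reconstruction. -/
lemma mul_lintegral_log_le {n : ℕ} (hn : n ≠ 0) {𝓜 : Type*} [MeasurableSpace 𝓜] [Countable 𝓜]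
    [DiscreteMeasurableSpace 𝓜] (c : SharedCodec (Fin n → 𝒴) (Fin n → 𝒳) 𝓜) {ℓ : 𝓜 → ℝ}
    (hℓ : ∀ m, 0 ≤ ℓ m)
    (hq : ∀ y w, ∑' m, (Set.range fun x => c.enc ((y, x), w)).indicator
      (fun m => ENNReal.ofReal (Real.exp (-ℓ m))) m ≤ 1)
    {g : 𝒴 × 𝒳 × 𝒳 → ℝ} (hg : Measurable g) {K : ℝ} (hK : 1 ≤ K) (hgK : ∀ t, Real.exp (-K) ≤ g t)
    (hg1 : ∀ y x', ∫⁻ x, ENNReal.ofReal (g (y, x, x')) ∂μ.condKernel y ≤ 1) :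
    n * ∫⁻ t, ENNReal.ofReal (Real.log (g t) + K) ∂meanLetterLaw (c.law (iidSource μ n)) ≤
      ∫⁻ t, ENNReal.ofReal (ℓ (c.enc t)) ∂((iidSource μ n).prod (volume : Measure I)) +
        n * ENNReal.ofReal K := by
  have hgpos : ∀ t, 0 < g t := fun t => (Real.exp_pos _).trans_le (hgK t)
  have hlogK : ∀ t, 0 ≤ Real.log (g t) + K := fun t => by
    have := (Real.le_log_iff_exp_le (hgpos t)).2 (hgK t)
    linarith
  have hnK : (1 : ℝ) ≤ n * K := by
    have : (1 : ℝ) ≤ n := by exact_mod_cast Nat.one_le_iff_ne_zero.2 hn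
    nlinarith
  have hlogm : Measurable fun t => ENNReal.ofReal (Real.log (g t) + K) := by fun_prop
  have hZ := lintegral_prod_mul_weight_le (μ := μ) c hq hg.ennreal_ofReal hg1
  have hℓm : Measurable fun t => ENNReal.ofReal (ℓ (c.enc t)) :=
    (Measurable.of_discrete (f := fun m => ENNReal.ofReal (ℓ m))).comp c.measurable_enc
  rw [mul_lintegral_meanLetterLaw hn _ hlogm, SharedCodec.law,
    lintegral_map (by fun_prop) (measurable_triple c)]
  -- Pointwise this is log t ≤ t - 1 for t = ∏ g * exp (-ℓ). The shift by K makes the logarithms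
  -- nonnegative, so everything can be integrated in [0, ∞].
  refine (lintegral_mono (g := fun t => ((∏ i, ENNReal.ofReal (g (t.1.1 i, t.1.2 i,
    c.dec ((t.1.1, c.enc t), t.2) i))) * ENNReal.ofReal (Real.exp (-ℓ (c.enc t)))) +
    ENNReal.ofReal (ℓ (c.enc t)) + ENNReal.ofReal (n * K - 1)) fun t => ?_).trans ?_
  · set T : Fin n → 𝒴 × 𝒳 × 𝒳 := fun i => (t.1.1 i, t.1.2 i, c.dec ((t.1.1, c.enc t), t.2) i)
    change ∑ i, ENNReal.ofReal (Real.log (g (T i)) + K) ≤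
      (∏ i, ENNReal.ofReal (g (T i))) * ENNReal.ofReal (Real.exp (-ℓ (c.enc t))) +
        ENNReal.ofReal (ℓ (c.enc t)) + ENNReal.ofReal (n * K - 1)
    have hprod : 0 < ∏ i, g (T i) := Finset.prod_pos fun i _ => hgpos _
    rw [← ENNReal.ofReal_sum_of_nonneg fun i _ => hlogK _,
      ← ENNReal.ofReal_prod_of_nonneg fun i _ => (hgpos _).le, ← ENNReal.ofReal_mul hprod.le,
      ← ENNReal.ofReal_add (by positivity) (hℓ _),
      ← ENNReal.ofReal_add (add_nonneg (by positivity) (hℓ _)) (by linarith)]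
    refine ENNReal.ofReal_le_ofReal ?_
    have h := Real.log_le_sub_one_of_pos (mul_pos hprod (Real.exp_pos (-ℓ (c.enc t))))
    rw [Real.log_mul hprod.ne' (Real.exp_pos _).ne', Real.log_exp,
      Real.log_prod fun i _ => (hgpos _).ne'] at h
    rw [Finset.sum_add_distrib]
    simp only [Finset.sum_const, Finset.card_univ, Fintype.card_fin, nsmul_eq_mul]
    linarith
  · rw [lintegral_add_right _ measurable_const, lintegral_add_right _ hℓm]
    have h1 : n * ENNReal.ofReal K = 1 + ENNReal.ofReal (n * K - 1) := by
      rw [← ENNReal.ofReal_one, ← ENNReal.ofReal_add zero_le_one (by linarith),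
        ← ENNReal.ofReal_natCast, ← ENNReal.ofReal_mul (Nat.cast_nonneg n)]
      congr 1; ring
    rw [h1, lintegral_const, measure_univ, mul_one, ← add_assoc, add_comm _ (1 : ℝ≥0∞)]
    gcongr

/-- Where the mean bound fails, the test is replaced by the constant 1. Failure depends on (y, x̂)
only, so the test changes for all x at once and the bound then holds everywhere. -/
lemma mul_lintegral_log_le_of_ae {n : ℕ} (hn : n ≠ 0) {𝓜 : Type*} [MeasurableSpace 𝓜]
    [Countable 𝓜] [DiscreteMeasurableSpace 𝓜] (c : SharedCodec (Fin n → 𝒴) (Fin n → 𝒳) 𝓜)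
    {ℓ : 𝓜 → ℝ} (hℓ : ∀ m, 0 ≤ ℓ m)
    (hq : ∀ y w, ∑' m, (Set.range fun x => c.enc ((y, x), w)).indicator
      (fun m => ENNReal.ofReal (Real.exp (-ℓ m))) m ≤ 1)
    {g : 𝒴 × 𝒳 × 𝒳 → ℝ} (hg : Measurable g) {K : ℝ} (hK : 1 ≤ K) (hgK : ∀ t, Real.exp (-K) ≤ g t)
    (hg1 : ∀ᵐ t ∂meanLetterLaw (c.law (iidSource μ n)),
      ∫⁻ x, ENNReal.ofReal (g (t.1, x, t.2.2)) ∂μ.condKernel t.1 ≤ 1) :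
    n * ∫⁻ t, ENNReal.ofReal (Real.log (g t) + K) ∂meanLetterLaw (c.law (iidSource μ n)) ≤
      ∫⁻ t, ENNReal.ofReal (ℓ (c.enc t)) ∂((iidSource μ n).prod (volume : Measure I)) +
        n * ENNReal.ofReal K := by
  have hJ : Measurable fun p : 𝒴 × 𝒳 =>
      ∫⁻ x, ENNReal.ofReal (g (p.1, x, p.2)) ∂μ.condKernel p.1 := by
    have h : Measurable fun r : (𝒴 × 𝒳) × 𝒳 => ENNReal.ofReal (g (r.1.1, r.2, r.1.2)) := by fun_prop
    exact Measurable.lintegral_kernel_prod_right' (κ := μ.condKernel.comap Prod.fst measurable_fst) h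
  let G : Set (𝒴 × 𝒳) :=
    {p | ∫⁻ x, ENNReal.ofReal (g (p.1, x, p.2)) ∂μ.condKernel p.1 ≤ 1}
  have hG : MeasurableSet G := measurableSet_le hJ measurable_const
  classical
  let g' : 𝒴 × 𝒳 × 𝒳 → ℝ := fun t => if (t.1, t.2.2) ∈ G then g t else 1
  have hpr : Measurable fun t : 𝒴 × 𝒳 × 𝒳 => (t.1, t.2.2) := by fun_prop
  have hg' : Measurable g' := Measurable.ite (hpr hG) hg measurable_const
  have key := mul_lintegral_log_le (μ := μ) hn c hℓ hq hg' hK (fun t => ?_) fun y x' => ?_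
  · refine le_trans (le_of_eq ?_) key
    congr 1
    refine lintegral_congr_ae ?_
    filter_upwards [hg1] with t ht
    have ht' : (t.1, t.2.2) ∈ G := ht
    simp only [g', ht', if_true]
  · by_cases ht : (t.1, t.2.2) ∈ G
    · simp only [g', ht, if_true, hgK t]
    · simp only [g', ht, if_false]
      exact Real.exp_le_one_iff.2 (by linarith)
  · by_cases ht : (y, x') ∈ G
    · simp only [g', ht, if_true]
      exact ht
    · simp [g', ht]

/-- The reference law also arises from γ by keeping (Y, X̂) and redrawing X given Y. -/
lemma lintegral_indepLaw_reconGiven {γ : Measure (𝒴 × 𝒳 × 𝒳)} [IsFiniteMeasure γ]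
    (hγ : γ.map (fun t => (t.1, t.2.1)) = μ) {h : 𝒴 × 𝒳 × 𝒳 → ℝ≥0∞} (hh : Measurable h) :
    ∫⁻ t, h t ∂indepLaw μ (reconGiven γ) =
      ∫⁻ t, ∫⁻ x, h (t.1, x, t.2.2) ∂μ.condKernel t.1 ∂γ := by
  have hm : Measurable fun p : 𝒴 × 𝒳 => ∫⁻ x, h (p.1, x, p.2) ∂μ.condKernel p.1 := by
    have h : Measurable fun r : (𝒴 × 𝒳) × 𝒳 => h (r.1.1, r.2, r.1.2) := by fun_prop
    exact Measurable.lintegral_kernel_prod_right' (κ := μ.condKernel.comap Prod.fst measurable_fst) h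
  have hm' : Measurable fun p : 𝒴 × 𝒳 => ∫⁻ z, h (p.1, p.2, z) ∂reconGiven γ p.1 := by
    have h : Measurable fun r : (𝒴 × 𝒳) × 𝒳 => h (r.1.1, r.1.2, r.2) := by fun_prop
    exact Measurable.lintegral_kernel_prod_right' (κ := (reconGiven γ).comap Prod.fst measurable_fst) h
  have hpr : Measurable fun t : 𝒴 × 𝒳 × 𝒳 => (t.1, t.2.2) := by fun_prop
  rw [indepLaw, lintegral_tripleLaw hh, ← lintegral_map hm hpr, map_recon,
    fst_eq_of_map_source hγ, Measure.lintegral_compProd hm]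
  simp only [Kernel.prodMkRight_apply]
  conv_lhs => rw [← μ.disintegrate μ.condKernel]
  rw [Measure.lintegral_compProd hm']
  refine lintegral_congr fun y => ?_
  exact lintegral_lintegral_swap (μ := μ.condKernel y) (ν := reconGiven γ y)
    (f := fun x z => h (y, x, z)) (by fun_prop)

/-- γ and its reference law give (Y, X̂) the same law, so the density averaged over a redrawn X is 1
almost everywhere. Hence the density is an admissible test. -/
lemma ae_lintegral_density_le_one {γ : Measure (𝒴 × 𝒳 × 𝒳)} [IsFiniteMeasure γ]
    (hγ : γ.map (fun t => (t.1, t.2.1)) = μ) {f : 𝒴 × 𝒳 × 𝒳 → ℝ≥0∞} (hf : Measurable f)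
    (hγf : γ = (indepLaw μ (reconGiven γ)).withDensity f) :
    ∀ᵐ t ∂γ, ∫⁻ x, f (t.1, x, t.2.2) ∂μ.condKernel t.1 ≤ 1 := by
  have hm : Measurable fun p : 𝒴 × 𝒳 => ∫⁻ x, f (p.1, x, p.2) ∂μ.condKernel p.1 := by
    have h : Measurable fun r : (𝒴 × 𝒳) × 𝒳 => f (r.1.1, r.2, r.1.2) := by fun_prop
    exact Measurable.lintegral_kernel_prod_right' (κ := μ.condKernel.comap Prod.fst measurable_fst) h
  have hpr : Measurable fun t : 𝒴 × 𝒳 × 𝒳 => (t.1, t.2.2) := by fun_prop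
  have hae : (fun p : 𝒴 × 𝒳 => ∫⁻ x, f (p.1, x, p.2) ∂μ.condKernel p.1)
      =ᵐ[γ.map fun t => (t.1, t.2.2)] fun _ => 1 := by
    refine ae_eq_of_forall_setLIntegral_eq_of_sigmaFinite hm measurable_const fun B hB _ => ?_
    rw [setLIntegral_one, setLIntegral_map hB hm hpr, Measure.map_apply hpr hB]
    have hfB : Measurable (((fun t : 𝒴 × 𝒳 × 𝒳 => (t.1, t.2.2)) ⁻¹' B).indicator f) :=
      hf.indicator (hpr hB)
    calc ∫⁻ t in (fun t => (t.1, t.2.2)) ⁻¹' B, ∫⁻ x, f (t.1, x, t.2.2) ∂μ.condKernel t.1 ∂γ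
        = ∫⁻ t, ∫⁻ x, ((fun t : 𝒴 × 𝒳 × 𝒳 => (t.1, t.2.2)) ⁻¹' B).indicator f (t.1, x, t.2.2)
            ∂μ.condKernel t.1 ∂γ := by
          rw [← lintegral_indicator (hpr hB)]
          refine lintegral_congr fun t => ?_
          by_cases ht : (t.1, t.2.2) ∈ B
          · simp [Set.indicator, ht]
          · simp [Set.indicator, ht]
      _ = γ ((fun t => (t.1, t.2.2)) ⁻¹' B) := by
          rw [← lintegral_indepLaw_reconGiven hγ hfB, lintegral_indicator (hpr hB),
            ← withDensity_apply _ (hpr hB), ← hγf]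
  exact (ae_of_ae_map hpr.aemeasurable hae).mono fun t ht => ht.le

/-- The single-letter bound behind the converse. -/
lemma mul_klDiv_meanLetterLaw_le {n : ℕ} (hn : n ≠ 0) {𝓜 : Type*} [MeasurableSpace 𝓜]
    [Countable 𝓜] [DiscreteMeasurableSpace 𝓜] (c : SharedCodec (Fin n → 𝒴) (Fin n → 𝒳) 𝓜)
    {ℓ : 𝓜 → ℝ} (hℓ : ∀ m, 0 ≤ ℓ m)
    (hq : ∀ y w, ∑' m, (Set.range fun x => c.enc ((y, x), w)).indicator
      (fun m => ENNReal.ofReal (Real.exp (-ℓ m))) m ≤ 1)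
    {γ : Measure (𝒴 × 𝒳 × 𝒳)} [IsProbabilityMeasure γ]
    (hγ : γ = meanLetterLaw (c.law (iidSource μ n))) (hγμ : γ.map (fun t => (t.1, t.2.1)) = μ) :
    n * klDiv γ (indepLaw μ (reconGiven γ)) ≤
      ∫⁻ t, ENNReal.ofReal (ℓ (c.enc t)) ∂((iidSource μ n).prod (volume : Measure I)) := by
  set E := ∫⁻ t, ENNReal.ofReal (ℓ (c.enc t)) ∂((iidSource μ n).prod (volume : Measure I))
  rcases eq_or_ne E ∞ with hE | hE
  · rw [hE]; exact le_top
  have key : ∀ (g : 𝒴 × 𝒳 × 𝒳 → ℝ), Measurable g → ∀ K : ℝ, 1 ≤ K → (∀ t, Real.exp (-K) ≤ g t) →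
      (∀ᵐ t ∂γ, ∫⁻ x, ENNReal.ofReal (g (t.1, x, t.2.2)) ∂μ.condKernel t.1 ≤ 1) →
      n * ∫⁻ t, ENNReal.ofReal (Real.log (g t) + K) ∂γ ≤ E + n * ENNReal.ofReal K := by
    intro g hg K hK hgK hg1
    rw [hγ] at hg1 ⊢
    exact mul_lintegral_log_le_of_ae hn c hℓ hq hg hK hgK hg1
  have hn0 : (n : ℝ≥0∞) ≠ 0 := by exact_mod_cast hn
  set ν := indepLaw μ (reconGiven γ) with hν
  have : IsProbabilityMeasure ν := by rw [hν, indepLaw]; infer_instance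
  -- If γ charged a ν-null set A, the tests equal to 1 + exp C on A and to 1 elsewhere would be
  -- admissible for every C ≥ 0, forcing E = ∞.
  have hac : γ ≪ ν := by
    refine Measure.AbsolutelyContinuous.mk fun A hA hA0 => ?_
    have hsec : ∀ᵐ t ∂γ, μ.condKernel t.1 {x | (t.1, x, t.2.2) ∈ A} = 0 := by
      have h := lintegral_indepLaw_reconGiven hγμ (measurable_one.indicator hA)
      rw [lintegral_indicator_one hA, ← hν, hA0] at h
      have hm : Measurable fun t : 𝒴 × 𝒳 × 𝒳 =>
          ∫⁻ x, A.indicator 1 (t.1, x, t.2.2) ∂μ.condKernel t.1 := by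
        have h : Measurable fun r : (𝒴 × 𝒳 × 𝒳) × 𝒳 =>
            A.indicator (1 : 𝒴 × 𝒳 × 𝒳 → ℝ≥0∞) (r.1.1, r.2, r.1.2.2) :=
          (measurable_one.indicator hA).comp (by fun_prop)
        exact Measurable.lintegral_kernel_prod_right'
          (κ := μ.condKernel.comap Prod.fst measurable_fst) h
      filter_upwards [(lintegral_eq_zero_iff hm).1 h.symm] with t ht
      rw [← lintegral_indicator_one]
      · exact ht
      · exact (show Measurable fun x => (t.1, x, t.2.2) by fun_prop) hA
    by_contra hne
    have hbound : ∀ C : ℝ, 0 ≤ C → ENNReal.ofReal C * (n * γ A) ≤ E := fun C hC => by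
      have h := key (fun t => 1 + A.indicator (fun _ => Real.exp C) t)
        (measurable_const.add (measurable_const.indicator hA)) 1 le_rfl (fun t => ?_) ?_
      · have h₁ : ∀ t, A.indicator (fun _ => ENNReal.ofReal C) t + ENNReal.ofReal 1 ≤
            ENNReal.ofReal (Real.log (1 + A.indicator (fun _ => Real.exp C) t) + 1) := fun t => by
          by_cases ht : t ∈ A
          · rw [Set.indicator_of_mem ht, Set.indicator_of_mem ht,
              ← ENNReal.ofReal_add hC zero_le_one]
            refine ENNReal.ofReal_le_ofReal (add_le_add_left ?_ _)
            rw [Real.le_log_iff_exp_le (by positivity)]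
            linarith
          · simp [ht]
        have h₂ := (mul_le_mul_right (lintegral_mono h₁ (μ := γ)) (n : ℝ≥0∞)).trans h
        rw [lintegral_add_right _ measurable_const, lintegral_indicator hA, setLIntegral_const,
          lintegral_const, measure_univ, mul_one, mul_add] at h₂
        have h₃ := (ENNReal.add_le_add_iff_right (by finiteness)).1 h₂
        rwa [mul_left_comm] at h₃
      · refine (Real.exp_le_one_iff.2 (by norm_num)).trans ?_
        have : 0 ≤ A.indicator (fun _ => Real.exp C) t :=
          Set.indicator_nonneg (fun _ _ => (Real.exp_pos C).le) t
        linarith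
      · filter_upwards [hsec] with t ht
        refine le_of_eq ?_
        have : ∀ᵐ x ∂μ.condKernel t.1, ENNReal.ofReal
            (1 + A.indicator (fun _ => Real.exp C) (t.1, x, t.2.2)) = 1 := by
          filter_upwards [(measure_eq_zero_iff_ae_notMem.1 ht)] with x hx
          have hx' : (t.1, x, t.2.2) ∉ A := hx
          simp [hx']
        rw [lintegral_congr_ae this]
        simp
    obtain ⟨k, hk⟩ := ENNReal.exists_nat_mul_gt (mul_ne_zero hn0 hne) hE
    have := hbound k (Nat.cast_nonneg k)
    rw [ENNReal.ofReal_natCast] at this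
    exact absurd this (not_le.2 hk)
  let f : 𝒴 × 𝒳 × 𝒳 → ℝ := fun t => (γ.rnDeriv ν t).toReal
  have hf : Measurable f := (Measure.measurable_rnDeriv γ ν).ennreal_toReal
  have hf0 : ∀ t, 0 ≤ f t := fun t => ENNReal.toReal_nonneg
  have hγf : γ = ν.withDensity fun t => ENNReal.ofReal (f t) := by
    conv_lhs => rw [← Measure.withDensity_rnDeriv_eq _ _ hac]
    refine withDensity_congr_ae ?_
    filter_upwards [γ.rnDeriv_lt_top ν] with t ht
    exact (ENNReal.ofReal_toReal ht.ne).symm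
  have hf1 : ∀ᵐ t ∂γ, ∫⁻ x, ENNReal.ofReal (f (t.1, x, t.2.2)) ∂μ.condKernel t.1 ≤ 1 :=
    ae_lintegral_density_le_one hγμ hf.ennreal_ofReal hγf
  refine ENNReal.le_of_forall_pos_le_add fun ε hε _ => ?_
  -- The test will be the density smoothed by e, so that it is bounded below. Normalising by 1 + e
  -- costs log (1 + e) ≤ e per letter, hence at most ε for the block.
  set e : ℝ := min 1 (ε / n)
  have hnpos : (0 : ℝ) < n := by exact_mod_cast Nat.pos_of_ne_zero hn
  have he0 : 0 < e := lt_min one_pos (div_pos (by exact_mod_cast hε) hnpos)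
  have hne : n * e ≤ ε := by
    calc n * e ≤ n * (ε / n) := by gcongr; exact min_le_right _ _
      _ = ε := by field_simp
  have hlog1 : Real.log (1 + e) ≤ e := by
    have := Real.log_le_sub_one_of_pos (show 0 < 1 + e by linarith)
    linarith
  have hlog0 : 0 ≤ Real.log (1 + e) := Real.log_nonneg (by linarith)
  have he1 : e ≤ 1 := min_le_left _ _
  -- Chosen so that exp (-K) lies below e / (1 + e), a lower bound of the smoothed test.
  set K : ℝ := 1 + Real.log ((1 + e) / e) with hKdef
  have hK : 1 ≤ K := by
    have : 0 ≤ Real.log ((1 + e) / e) := Real.log_nonneg (by rw [le_div_iff₀ he0]; linarith)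
    linarith
  have h := key (fun t => (f t + e) / (1 + e)) (by fun_prop) K hK (fun t => ?_) ?_
  -- This is f log f ≤ f log (f + e), with terms arranged so that none is negative.
  · have hpt : ∀ t, ENNReal.ofReal (klFun (f t)) +
        ENNReal.ofReal (f t) * ENNReal.ofReal (1 + K - Real.log (1 + e)) ≤
        ENNReal.ofReal (f t) * ENNReal.ofReal (Real.log ((f t + e) / (1 + e)) + K) + 1 := fun t => by
      rw [← ENNReal.ofReal_mul (hf0 t), ← ENNReal.ofReal_mul (hf0 t), ← ENNReal.ofReal_one,
        ← ENNReal.ofReal_add (klFun_nonneg (hf0 t)) (mul_nonneg (hf0 t) (by linarith))]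
      refine (ENNReal.ofReal_le_ofReal ?_).trans ENNReal.ofReal_add_le
      rcases (hf0 t).eq_or_lt with h0 | h0
      · simp [← h0, klFun]
      · rw [klFun, Real.log_div (by linarith) (by linarith)]
        have : Real.log (f t) ≤ Real.log (f t + e) := Real.log_le_log h0 (by linarith)
        nlinarith
    have hint := lintegral_mono hpt (μ := ν)
    have hmul : ∀ h : 𝒴 × 𝒳 × 𝒳 → ℝ≥0∞, Measurable h →
        ∫⁻ t, ENNReal.ofReal (f t) * h t ∂ν = ∫⁻ t, h t ∂γ := fun h hh => by
      conv_rhs => rw [hγf]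
      rw [lintegral_withDensity_eq_lintegral_mul _ hf.ennreal_ofReal hh]
      rfl
    have hkl : ∫⁻ t, ENNReal.ofReal (klFun (f t)) ∂ν = klDiv γ ν :=
      (klDiv_eq_lintegral_klFun_of_ac hac).symm
    rw [lintegral_add_left (by fun_prop), lintegral_add_right _ measurable_const, hkl,
      hmul _ measurable_const, hmul _ (by fun_prop), lintegral_const, lintegral_const,
      measure_univ, measure_univ, mul_one, mul_one] at hint
    have h₁ := mul_le_mul_right hint (n : ℝ≥0∞)
    rw [mul_add, mul_add, mul_one] at h₁
    have h₂ := add_le_add_left (h₁.trans (add_le_add_left h _))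
      (n * ENNReal.ofReal (Real.log (1 + e)))
    have e₁ : n * ENNReal.ofReal (1 + K - Real.log (1 + e)) +
        n * ENNReal.ofReal (Real.log (1 + e)) = n * ENNReal.ofReal (1 + K) := by
      rw [← mul_add, ← ENNReal.ofReal_add (by linarith) hlog0, sub_add_cancel]
    have e₂ : E + n * ENNReal.ofReal K + n + n * ENNReal.ofReal (Real.log (1 + e)) =
        E + n * ENNReal.ofReal (Real.log (1 + e)) + n * ENNReal.ofReal (1 + K) := by
      have e₃ : ENNReal.ofReal (1 + K) = 1 + ENNReal.ofReal K := by
        rw [ENNReal.ofReal_add zero_le_one (by linarith), ENNReal.ofReal_one]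
      rw [e₃]
      ring
    rw [add_assoc, e₁, e₂] at h₂
    refine ((ENNReal.add_le_add_iff_right (by finiteness)).1 h₂).trans ?_
    gcongr
    rw [← ENNReal.ofReal_natCast, ← ENNReal.ofReal_mul (Nat.cast_nonneg n),
      ← ENNReal.ofReal_coe_nnreal]
    exact ENNReal.ofReal_le_ofReal ((mul_le_mul_of_nonneg_left hlog1 hnpos.le).trans hne)
  · rw [hKdef, neg_add, Real.exp_add, Real.exp_neg (Real.log _), Real.exp_log (by positivity),
      inv_div]
    calc Real.exp (-1) * (e / (1 + e)) ≤ 1 * (e / (1 + e)) := by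
          gcongr
          exact Real.exp_le_one_iff.2 (by norm_num)
      _ ≤ (f t + e) / (1 + e) := by
          rw [one_mul]
          gcongr
          linarith [hf0 t]
  · filter_upwards [hf1] with t ht
    have hfm : Measurable fun x => ENNReal.ofReal (f (t.1, x, t.2.2)) := by fun_prop
    simp_rw [ENNReal.ofReal_div_of_pos (show 0 < 1 + e by linarith),
      ENNReal.ofReal_add (hf0 _) he0.le, ENNReal.div_eq_inv_mul]
    rw [lintegral_const_mul _ (by fun_prop), lintegral_add_left hfm, lintegral_const, measure_univ,
      mul_one, ← ENNReal.div_eq_inv_mul]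
    refine ENNReal.div_le_of_le_mul ?_
    rw [one_mul, ENNReal.ofReal_add zero_le_one he0.le, ENNReal.ofReal_one]
    gcongr

/-- The mean letter law is a mixture with source marginal μ: its conditional distortion is the
average of those of the letters, and its perception is no larger than their average. -/
lemma rdcpFunction_le_meanLetterLaw {s : Sense} {Δ : 𝒳 → 𝒳 → ℝ≥0∞}
    {d : Measure 𝒳 → Measure 𝒳 → ℝ≥0∞} (hd : ConvexInSecond d) {D P : ℝ≥0∞} {n : ℕ} (hn : n ≠ 0)
    {Γ : Measure ((Fin n → 𝒴) × (Fin n → 𝒳) × (Fin n → 𝒳))} [IsProbabilityMeasure Γ]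
    (hΓ : Γ.map (fun t => (t.1, t.2.1)) = iidSource μ n)
    (hm : MeetsOnAverage s Δ d D P μ.fst Γ) :
    ∃ _ : IsProbabilityMeasure (meanLetterLaw Γ),
      (meanLetterLaw Γ).map (fun t => (t.1, t.2.1)) = μ ∧
      rdcpFunction s Δ d μ D P ≤ condMutualInfo (meanLetterLaw Γ) := by
  have hlet : ∀ i : Fin n, IsProbabilityMeasure (letterLaw Γ i) := fun i => by
    unfold letterLaw
    exact Measure.isProbabilityMeasure_map (Measurable.aemeasurable (by fun_prop))
  have hw : ∑ _i : Fin n, (n : ℝ≥0)⁻¹ = 1 := by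
    have : (n : ℝ≥0) ≠ 0 := by exact_mod_cast hn
    simp [this]
  have hsrc : ∀ i, (letterLaw Γ i).map (fun t => (t.1, t.2.1)) = μ := map_source_letterLaw hΓ
  have hp : IsProbabilityMeasure (meanLetterLaw Γ) := isProbabilityMeasure_sum_smul hw _
  have hmean : (meanLetterLaw Γ).map (fun t => (t.1, t.2.1)) = μ := map_source_mixture hw hsrc
  have hdiv : ∀ F : Fin n → ℝ≥0∞, (∑ i, F i) / n = ∑ i, ((n : ℝ≥0)⁻¹ : ℝ≥0) * F i := fun F => by
    rw [← Finset.mul_sum, ENNReal.div_eq_inv_mul, ENNReal.coe_inv (by exact_mod_cast hn),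
      ENNReal.coe_natCast]
  refine ⟨hp, hmean, rdcpFunction_le hmean ⟨?_, ?_⟩⟩
  · rw [fst_eq_of_map_source hmean]
    refine hm.1.congr ?_
    filter_upwards [condDistortion_mixture hw hsrc Δ] with y hy
    rw [hdiv]
    exact hy
  · rw [fst_eq_of_map_source hmean]
    refine hm.2.mono ?_ le_rfl
    filter_upwards [condPerception_mixture_le hd hw hsrc] with y hy
    rw [hdiv]
    exact hy

instance {𝓜 : Type*} [MeasurableSpace 𝓜] (c : SharedCodec 𝒴 𝒳 𝓜) :
    IsProbabilityMeasure (c.law μ) := by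
  unfold SharedCodec.law
  exact Measure.isProbabilityMeasure_map (measurable_triple c).aemeasurable

lemma mul_rdcpFunction_mul_log_le {s : Sense} {Δ : 𝒳 → 𝒳 → ℝ≥0∞}
    {d : Measure 𝒳 → Measure 𝒳 → ℝ≥0∞} (hd : ConvexInSecond d) {D P : ℝ≥0∞} {n : ℕ} (hn : n ≠ 0)
    {𝓜 : Type*} [MeasurableSpace 𝓜] [Countable 𝓜] [DiscreteMeasurableSpace 𝓜]
    (c : SharedCodec (Fin n → 𝒴) (Fin n → 𝒳) 𝓜) {ℓ : 𝓜 → ℝ} (hℓ : ∀ m, 0 ≤ ℓ m)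
    (hq : ∀ y w, ∑' m, (Set.range fun x => c.enc ((y, x), w)).indicator
      (fun m => ENNReal.ofReal (Real.exp (-ℓ m))) m ≤ 1)
    (hm : MeetsOnAverage s Δ d D P μ.fst (c.law (iidSource μ n))) :
    n * rdcpFunction s Δ d μ D P * ENNReal.ofReal (Real.log 2) ≤
      ∫⁻ t, ENNReal.ofReal (ℓ (c.enc t)) ∂((iidSource μ n).prod (volume : Measure I)) := by
  obtain ⟨hp, hmean, hle⟩ := rdcpFunction_le_meanLetterLaw hd hn (map_source_law c) hm
  have h := mul_klDiv_meanLetterLaw_le hn c hℓ hq rfl hmean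
  refine le_trans ?_ h
  rw [mul_assoc]
  gcongr
  rw [condMutualInfo_eq hmean] at hle
  exact ENNReal.mul_le_of_le_div hle

lemma mul_rdcpFunction_le_logb {s : Sense} {Δ : 𝒳 → 𝒳 → ℝ≥0∞}
    {d : Measure 𝒳 → Measure 𝒳 → ℝ≥0∞} (hd : ConvexInSecond d) {D P : ℝ≥0∞} {n : ℕ} (hn : n ≠ 0)
    {m : ℕ} (c : SharedCodec (Fin n → 𝒴) (Fin n → 𝒳) (Fin m))
    (hm : MeetsOnAverage s Δ d D P μ.fst (c.law (iidSource μ n))) :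
    n * rdcpFunction s Δ d μ D P ≤ ENNReal.ofReal (Real.logb 2 m) := by
  have hlog2 : 0 < Real.log 2 := Real.log_pos (by norm_num)
  have hne : Nonempty ((Fin n → 𝒴) × (Fin n → 𝒳)) :=
    nonempty_of_isProbabilityMeasure (iidSource μ n)
  have hm0 : 0 < m := (c.enc (Classical.arbitrary _, 0)).pos
  have hm1 : (1 : ℝ) ≤ m := by exact_mod_cast hm0
  -- Uniform weights 1 / m on the messages.
  have h := mul_rdcpFunction_mul_log_le hd hn c (ℓ := fun _ => Real.log m)
    (fun _ => Real.log_nonneg hm1) (fun y w => ?_) hm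
  · rw [lintegral_const, measure_univ, mul_one] at h
    rw [Real.logb, ENNReal.ofReal_div_of_pos hlog2]
    exact (ENNReal.le_div_iff_mul_le (.inl (by simpa using hlog2)) (.inl ENNReal.ofReal_ne_top)).2 h
  · calc ∑' j, (Set.range fun x => c.enc ((y, x), w)).indicator
          (fun _ => ENNReal.ofReal (Real.exp (-Real.log m))) j
        ≤ ∑' _j : Fin m, ENNReal.ofReal (Real.exp (-Real.log m)) :=
          ENNReal.tsum_le_tsum fun j => Set.indicator_le_self _ _ _
      _ = 1 := by
          rw [tsum_fintype, Finset.sum_const, Finset.card_univ, Fintype.card_fin, nsmul_eq_mul,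
            Real.exp_neg, Real.exp_log (by linarith), ENNReal.ofReal_inv_of_pos (by linarith),
            ENNReal.ofReal_natCast, ENNReal.mul_inv_cancel (by exact_mod_cast hm0.ne')
            (ENNReal.natCast_ne_top m)]

/-- The Kraft-McMillan inequality for the finite subsets of S, whose sums have the infinite sum as
supremum. -/
lemma tsum_indicator_exp_length_le {S : Set (List Bool)} (hS : UniquelyDecodable S) :
    ∑' m, S.indicator (fun m => ENNReal.ofReal (Real.exp (-(m.length * Real.log 2)))) m ≤ 1 := by
  classical
  have hpow : ∀ m : List Bool, Real.exp (-(m.length * Real.log 2)) =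
      (1 / Fintype.card Bool : ℝ) ^ m.length := fun m => by
    rw [Real.exp_neg, mul_comm, Real.exp_mul, Real.exp_log (by norm_num)]
    simp
  rw [ENNReal.tsum_eq_iSup_sum]
  refine iSup_le fun T => ?_
  simp only [Set.indicator_apply]
  rw [← Finset.sum_filter]
  have hT : UniquelyDecodable ((T.filter fun m => m ∈ S : Finset (List Bool)) : Set (List Bool)) := by
    have hmem : ∀ m ∈ ((T.filter fun m => m ∈ S : Finset (List Bool)) : Set (List Bool)), m ∈ S :=
      fun m hm => (Finset.mem_filter.1 (Finset.mem_coe.1 hm)).2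
    exact fun L₁ L₂ h₁ h₂ => hS L₁ L₂ (fun m hm => hmem m (h₁ m hm)) fun m hm => hmem m (h₂ m hm)
  have h := kraft_mcmillan_inequality hT
  simp only [hpow]
  rw [← ENNReal.ofReal_sum_of_nonneg fun m _ => by positivity]
  exact ENNReal.ofReal_le_one.2 h

lemma mul_rdcpFunction_le_rate {s : Sense} {Δ : 𝒳 → 𝒳 → ℝ≥0∞}
    {d : Measure 𝒳 → Measure 𝒳 → ℝ≥0∞} (hd : ConvexInSecond d) {D P : ℝ≥0∞} {n : ℕ} (hn : n ≠ 0)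
    (c : SharedCodec (Fin n → 𝒴) (Fin n → 𝒳) (List Bool)) (hc : c.IsUniquelyDecodable)
    (hm : MeetsOnAverage s Δ d D P μ.fst (c.law (iidSource μ n))) :
    n * rdcpFunction s Δ d μ D P ≤ c.rate (iidSource μ n) := by
  have hlog2 : 0 < Real.log 2 := Real.log_pos (by norm_num)
  have h := mul_rdcpFunction_mul_log_le hd hn c (ℓ := fun m => m.length * Real.log 2)
    (fun m => by positivity) (fun y w => tsum_indicator_exp_length_le (hc y w)) hm
  have hlen : Measurable fun t => ((c.enc t).length : ℝ≥0∞) :=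
    (Measurable.of_discrete (f := fun m : List Bool => (m.length : ℝ≥0∞))).comp c.measurable_enc
  simp only [ENNReal.ofReal_mul (Nat.cast_nonneg _), ENNReal.ofReal_natCast] at h
  rw [lintegral_mul_const _ hlen] at h
  exact (ENNReal.mul_le_mul_iff_left (by simpa using hlog2) ENNReal.ofReal_ne_top).1 h

end Converse
-- Variance identities for the squared error
section SquaredError

variable {k : ℕ}

lemma measurable_squaredError :
    Measurable (Function.uncurry (squaredError (k := k))) := by
  unfold squaredError Function.uncurry
  fun_prop

lemma measurable_squaredError_right (a : EuclideanSpace ℝ (Fin k)) :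
    Measurable fun x => squaredError a x := by
  unfold squaredError
  fun_prop

lemma squaredError_comm (x x' : EuclideanSpace ℝ (Fin k)) :
    squaredError x x' = squaredError x' x := by
  rw [squaredError, squaredError, norm_sub_rev]

lemma memLp_two_of_lintegral_squaredError {p : Measure (EuclideanSpace ℝ (Fin k))}
    [IsProbabilityMeasure p] {a : EuclideanSpace ℝ (Fin k)}
    (h : ∫⁻ x, squaredError x a ∂p ≠ ∞) : MemLp (fun x => x) 2 p := by
  have h₁ : MemLp (fun x => x - a) 2 p := by
    rw [memLp_two_iff_integrable_sq_norm (by fun_prop)]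
    refine ⟨by fun_prop, ?_⟩
    rw [hasFiniteIntegral_iff_ofReal (.of_forall fun x => by positivity)]
    exact h.lt_top
  exact (memLp_congr_ae (.of_forall fun x => by simp)).1 (h₁.add (memLp_const a))

/-- The decomposition of the mean squared error into variance and squared bias. -/
lemma lintegral_squaredError_eq {p : Measure (EuclideanSpace ℝ (Fin k))} [IsProbabilityMeasure p]
    {a₀ : EuclideanSpace ℝ (Fin k)} (h : ∫⁻ x, squaredError x a₀ ∂p ≠ ∞)
    (a : EuclideanSpace ℝ (Fin k)) :
    ∫⁻ x, squaredError x a ∂p =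
      ∫⁻ x, squaredError x (∫ z, z ∂p) ∂p + squaredError (∫ z, z ∂p) a := by
  have hL := memLp_two_of_lintegral_squaredError h
  have hint : Integrable (fun x => x) p := hL.integrable one_le_two
  set m := ∫ z, z ∂p with hm
  have hsq : ∀ b : EuclideanSpace ℝ (Fin k), Integrable (fun x => ‖x - b‖ ^ 2) p := fun b =>
    (memLp_two_iff_integrable_sq_norm (by fun_prop)).1 (hL.sub (memLp_const b))
  have hconv : ∀ b : EuclideanSpace ℝ (Fin k), ∫⁻ x, squaredError x b ∂p =
      ENNReal.ofReal (∫ x, ‖x - b‖ ^ 2 ∂p) := fun b =>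
    (ofReal_integral_eq_lintegral_ofReal (hsq b) (.of_forall fun x => by positivity)).symm
  rw [hconv, hconv, squaredError, ← ENNReal.ofReal_add (integral_nonneg fun x => by positivity)
    (by positivity)]
  congr 1
  have hexp : ∀ x : EuclideanSpace ℝ (Fin k), ‖x - a‖ ^ 2 =
      ‖x - m‖ ^ 2 + (2 * inner ℝ (m - a) (x - m) + ‖m - a‖ ^ 2) := fun x => by
    have : x - a = (x - m) + (m - a) := by abel
    rw [this, norm_add_sq_real, real_inner_comm]
    ring
  have hi₂ : Integrable (fun x => 2 * inner ℝ (m - a) (x - m) + ‖m - a‖ ^ 2) p :=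
    (((hint.sub (integrable_const m)).const_inner _).const_mul 2).add (integrable_const _)
  have hsub : Integrable (fun x => x - m) p := hint.sub (integrable_const m)
  have hi : Integrable (fun x => inner ℝ (m - a) (x - m)) p :=
    (hint.sub (integrable_const m)).const_inner _
  rw [integral_congr_ae (.of_forall hexp), integral_add (hsq m) hi₂,
    integral_add (hi.const_mul 2) (integrable_const _), integral_const_mul,
    integral_inner hsub, integral_sub hint (integrable_const m)]
  simp [← hm]

/-- For independent draws from p the mean squared difference is twice the variance, and the mean is
the best constant predictor. -/
lemma lintegral_lintegral_squaredError_self_le (p : Measure (EuclideanSpace ℝ (Fin k)))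
    [IsProbabilityMeasure p] (a : EuclideanSpace ℝ (Fin k)) :
    ∫⁻ x, ∫⁻ z, squaredError x z ∂p ∂p ≤ 2 * ∫⁻ x, squaredError x a ∂p := by
  by_cases h : ∫⁻ x, squaredError x a ∂p = ∞
  · rw [h, ENNReal.mul_top two_ne_zero]; exact le_top
  have hm := measurable_squaredError_right (∫ z, z ∂p)
  calc ∫⁻ x, ∫⁻ z, squaredError x z ∂p ∂p
      = ∫⁻ x, (∫⁻ z, squaredError z (∫ z, z ∂p) ∂p + squaredError (∫ z, z ∂p) x) ∂p := by
        refine lintegral_congr fun x => ?_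
        rw [← lintegral_squaredError_eq h x]
        exact lintegral_congr fun z => squaredError_comm x z
    _ = 2 * ∫⁻ z, squaredError z (∫ z, z ∂p) ∂p := by
        rw [lintegral_add_right _ hm, lintegral_const, measure_univ, mul_one, two_mul,
          lintegral_congr fun z => squaredError_comm (∫ z, z ∂p) z]
    _ ≤ _ := by
        gcongr 2 * ?_
        rw [lintegral_squaredError_eq h a]
        exact le_self_add

/-- For independent X and Z the mean squared difference is the sum of both variances and of the
squared distance of the means. -/
lemma lintegral_squaredError_mean_add_le (p q : Measure (EuclideanSpace ℝ (Fin k)))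
    [IsProbabilityMeasure p] [IsProbabilityMeasure q] :
    ∫⁻ x, squaredError x (∫ z, z ∂p) ∂p + ∫⁻ x, squaredError x (∫ z, z ∂q) ∂q ≤
      ∫⁻ x, ∫⁻ z, squaredError x z ∂q ∂p := by
  by_cases h : ∫⁻ x, ∫⁻ z, squaredError x z ∂q ∂p = ∞
  · rw [h]; exact le_top
  have hswap : ∫⁻ x, ∫⁻ z, squaredError x z ∂q ∂p = ∫⁻ z, ∫⁻ x, squaredError x z ∂p ∂q :=
    lintegral_lintegral_swap measurable_squaredError.aemeasurable
  -- A finite double integral provides a centre with finite second moment, as the variance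
  -- decomposition requires.
  have hq : ∃ a, ∫⁻ z, squaredError z a ∂q ≠ ∞ := by
    by_contra hall
    push Not at hall
    refine h ?_
    have h' : ∀ x, ∫⁻ z, squaredError x z ∂q = ∞ := fun x => by
      rw [lintegral_congr fun z => squaredError_comm x z, hall x]
    simp [h']
  have hp : ∃ a, ∫⁻ x, squaredError x a ∂p ≠ ∞ := by
    by_contra hall
    push Not at hall
    refine h ?_
    rw [hswap]
    simp [hall]
  obtain ⟨a, ha⟩ := hq
  obtain ⟨b, hb⟩ := hp
  rw [hswap]
  rw [lintegral_congr fun z => lintegral_squaredError_eq hb z,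
    lintegral_add_left measurable_const, lintegral_const, measure_univ, mul_one]
  refine add_le_add le_rfl ?_
  rw [lintegral_congr fun z => squaredError_comm (∫ x, x ∂p) z,
    lintegral_squaredError_eq ha (∫ x, x ∂p)]
  exact le_self_add

end SquaredError

/-! ### Decoding a code, and sampling from the posterior -/

section Posterior

variable {𝒴 𝒳 𝒵 : Type*} [MeasurableSpace 𝒴] [MeasurableSpace 𝒳] [MeasurableSpace 𝒵]

/-- The law of `(Y, X, X̂)` when `((Y, X), Z)` has law `Γ` and `X̂` is drawn from
`p_{X̂|Y,Z} = K`. -/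
noncomputable def decodeLaw (Γ : Measure ((𝒴 × 𝒳) × 𝒵)) (K : Kernel (𝒴 × 𝒵) 𝒳) :
    Measure (𝒴 × 𝒳 × 𝒳) :=
  (Γ ⊗ₘ K.comap (fun t => (t.1.1, t.2)) (by fun_prop)).map fun t => (t.1.1.1, t.1.1.2, t.2)

/-- The law of `((Y, Z), X)` when `((Y, X), Z)` has law `Γ`. -/
noncomputable def codeSource (Γ : Measure ((𝒴 × 𝒳) × 𝒵)) : Measure ((𝒴 × 𝒵) × 𝒳) :=
  Γ.map fun t => ((t.1.1, t.2), t.1.2)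

instance (Γ : Measure ((𝒴 × 𝒳) × 𝒵)) [IsProbabilityMeasure Γ] :
    IsProbabilityMeasure (codeSource Γ) :=
  Measure.isProbabilityMeasure_map (Measurable.aemeasurable (by fun_prop))

variable {Γ : Measure ((𝒴 × 𝒳) × 𝒵)} [IsProbabilityMeasure Γ] {K : Kernel (𝒴 × 𝒵) 𝒳}
  [IsMarkovKernel K]

instance : IsProbabilityMeasure (decodeLaw Γ K) :=
  Measure.isProbabilityMeasure_map (Measurable.aemeasurable (by fun_prop))

lemma lintegral_decodeLaw {h : 𝒴 × 𝒳 × 𝒳 → ℝ≥0∞} (hh : Measurable h) :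
    ∫⁻ t, h t ∂decodeLaw Γ K = ∫⁻ t, ∫⁻ z, h (t.1.1, t.1.2, z) ∂K (t.1.1, t.2) ∂Γ := by
  rw [decodeLaw, lintegral_map hh (by fun_prop), Measure.lintegral_compProd (by fun_prop)]
  rfl

lemma map_source_decodeLaw : (decodeLaw Γ K).map (fun t => (t.1, t.2.1)) = Γ.fst := by
  rw [decodeLaw, Measure.map_map (by fun_prop) (by fun_prop)]
  conv_rhs => rw [← Measure.fst_compProd Γ (K.comap (fun t => (t.1.1, t.2)) (by fun_prop)),
    Measure.fst, Measure.fst, Measure.map_map (by fun_prop) (by fun_prop)]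
  rfl

lemma map_recon_decodeLaw : (decodeLaw Γ K).map (fun t => (t.1, t.2.2)) =
    ((codeSource Γ).fst ⊗ₘ K).map fun q => (q.1.1, q.2) := by
  refine Measure.ext_of_lintegral _ fun h hh => ?_
  have hm : Measurable fun q : 𝒴 × 𝒵 => ∫⁻ z, h (q.1, z) ∂K q := by
    have h' : Measurable fun r : (𝒴 × 𝒵) × 𝒳 => h (r.1.1, r.2) := by fun_prop
    exact h'.lintegral_kernel_prod_right'
  rw [lintegral_map hh (by fun_prop), lintegral_map hh (by fun_prop),
    lintegral_decodeLaw (h := fun t => h (t.1, t.2.2)) (by fun_prop),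
    Measure.lintegral_compProd (by fun_prop), Measure.fst, lintegral_map hm (by fun_prop),
    codeSource, lintegral_map (f := fun a : (𝒴 × 𝒵) × 𝒳 => ∫⁻ z, h (a.1.1, z) ∂K a.1)
      (hm.comp measurable_fst) (by fun_prop)]

variable [StandardBorelSpace 𝒳] [Nonempty 𝒳]

lemma lintegral_codeSource {h : (𝒴 × 𝒵) × 𝒳 → ℝ≥0∞} (hh : Measurable h) :
    ∫⁻ t, h ((t.1.1, t.2), t.1.2) ∂Γ =
      ∫⁻ q, ∫⁻ x, h (q, x) ∂(codeSource Γ).condKernel q ∂(codeSource Γ).fst := by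
  rw [← Measure.lintegral_compProd hh, (codeSource Γ).disintegrate, codeSource,
    lintegral_map hh (by fun_prop)]

/-- Source and reconstruction are independent given (Y, Z), each with its own kernel. -/
lemma lintegral_decodeLaw_eq {h : 𝒴 × 𝒳 × 𝒳 → ℝ≥0∞} (hh : Measurable h) :
    ∫⁻ t, h t ∂decodeLaw Γ K =
      ∫⁻ q, ∫⁻ x, ∫⁻ z, h (q.1, x, z) ∂K q ∂(codeSource Γ).condKernel q ∂(codeSource Γ).fst := by
  rw [lintegral_decodeLaw hh]
  refine lintegral_codeSource (h := fun r => ∫⁻ z, h (r.1.1, r.2, z) ∂K r.1) ?_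
  have h' : Measurable fun r : ((𝒴 × 𝒵) × 𝒳) × 𝒳 => h (r.1.1.1, r.1.2, r.2) := by fun_prop
  exact Measurable.lintegral_kernel_prod_right' (κ := K.comap Prod.fst measurable_fst) h'

/-- Redrawing X from its law given (Y, Z) leaves the law of (Y, X) unchanged. -/
lemma map_recon_decodeLaw_condKernel :
    (decodeLaw Γ (codeSource Γ).condKernel).map (fun t => (t.1, t.2.2)) = Γ.fst := by
  rw [map_recon_decodeLaw, (codeSource Γ).disintegrate, codeSource,
    Measure.map_map (by fun_prop) (by fun_prop), Measure.fst]
  rfl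

lemma atMost_condPerception_zero {s : Sense} {d : Measure 𝒳 → Measure 𝒳 → ℝ≥0∞}
    (hd : IsDivergence d) {γ : Measure (𝒴 × 𝒳 × 𝒳)} [IsProbabilityMeasure γ]
    (h : γ.map (fun t => (t.1, t.2.1)) = γ.map (fun t => (t.1, t.2.2))) :
    s.AtMost γ.fst (condPerception d γ) 0 := by
  have h₁ := sourceGiven_ae_eq (γ := γ) rfl
  have h₂ := reconGiven_ae_eq (γ := γ) rfl
  refine Sense.atMost_zero ?_
  have h₃ : (γ.map fun t => (t.1, t.2.1)).fst = γ.fst := fst_map_prodMk γ (by fun_prop)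
  simp only [← h] at h₂
  rw [h₃] at h₁ h₂
  filter_upwards [h₁, h₂] with y e₁ e₂
  exact (hd _ _).2 (e₁.trans e₂.symm)

lemma ae_condDistortion_le {Δ : 𝒳 → 𝒳 → ℝ≥0∞} (hΔ : Measurable (Function.uncurry Δ))
    {γ : Measure (𝒴 × 𝒳 × 𝒳)} [IsFiniteMeasure γ] {g : 𝒴 → ℝ≥0∞}
    (h : ∀ A, MeasurableSet A → ∫⁻ t, A.indicator (fun _ => Δ t.2.1 t.2.2) t.1 ∂γ ≤
      ∫⁻ y in A, g y ∂γ.fst) :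
    ∀ᵐ y ∂γ.fst, condDistortion Δ γ y ≤ g y := by
  refine ae_le_of_forall_setLIntegral_le_of_sigmaFinite (measurable_condDistortion hΔ γ)
    fun A hA _ => ?_
  rw [setLIntegral_condDistortion hΔ γ hA]
  exact h A hA

end Posterior
-- Posterior sampling: twice the error, no more information
section Resampling

variable {𝒴 𝒵 : Type*} [MeasurableSpace 𝒴] [MeasurableSpace 𝒵] {k : ℕ}

lemma fst_decodeLaw {𝒳 : Type*} [MeasurableSpace 𝒳] [StandardBorelSpace 𝒳] [Nonempty 𝒳]
    {Γ : Measure ((𝒴 × 𝒳) × 𝒵)} [IsProbabilityMeasure Γ] {K : Kernel (𝒴 × 𝒵) 𝒳} [IsMarkovKernel K] :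
    (decodeLaw Γ K).fst = Γ.fst.fst :=
  fst_eq_of_map_source map_source_decodeLaw

lemma condDistortion_congr {𝒳 : Type*} [MeasurableSpace 𝒳] [StandardBorelSpace 𝒳] [Nonempty 𝒳]
    (Δ : 𝒳 → 𝒳 → ℝ≥0∞) {γ γ' : Measure (𝒴 × 𝒳 × 𝒳)} [IsFiniteMeasure γ] [IsFiniteMeasure γ']
    (h : γ = γ') : condDistortion Δ γ = condDistortion Δ γ' := by
  subst h
  rfl

lemma measurable_indicator_squaredError {A : Set 𝒴} (hA : MeasurableSet A) :
    Measurable fun t : 𝒴 × EuclideanSpace ℝ (Fin k) × EuclideanSpace ℝ (Fin k) =>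
      A.indicator (fun _ => squaredError t.2.1 t.2.2) t.1 := by
  have h : Measurable fun t : 𝒴 × EuclideanSpace ℝ (Fin k) × EuclideanSpace ℝ (Fin k) =>
      squaredError t.2.1 t.2.2 := measurable_squaredError.comp measurable_snd
  exact h.indicator (measurable_fst hA)

/-- Drawing the reconstruction from the posterior law of the source at most doubles the squared
error of any other decoder. -/
lemma condDistortion_posterior_le {Γ : Measure ((𝒴 × EuclideanSpace ℝ (Fin k)) × 𝒵)}
    [IsProbabilityMeasure Γ] {K : Kernel (𝒴 × 𝒵) (EuclideanSpace ℝ (Fin k))} [IsMarkovKernel K] :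
    ∀ᵐ y ∂Γ.fst.fst, condDistortion squaredError (decodeLaw Γ (codeSource Γ).condKernel) y ≤
      2 * condDistortion squaredError (decodeLaw Γ K) y := by
  have hfst := fst_decodeLaw (Γ := Γ) (K := (codeSource Γ).condKernel)
  have hfst' := fst_decodeLaw (Γ := Γ) (K := K)
  rw [← hfst]
  refine ae_condDistortion_le measurable_squaredError fun A hA => ?_
  have hm := measurable_indicator_squaredError (k := k) hA
  rw [lintegral_const_mul _ (measurable_condDistortion measurable_squaredError _), hfst, ← hfst',
    setLIntegral_condDistortion measurable_squaredError _ hA, lintegral_decodeLaw_eq hm,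
    lintegral_decodeLaw_eq hm, ← lintegral_const_mul']
  · refine lintegral_mono fun q => ?_
    by_cases hq : q.1 ∈ A
    · simp only [Set.indicator_of_mem hq]
      rw [lintegral_lintegral_swap (μ := (codeSource Γ).condKernel q) (ν := K q)
        measurable_squaredError.aemeasurable]
      have hmx : Measurable fun z => ∫⁻ x, squaredError x z ∂(codeSource Γ).condKernel q :=
        measurable_squaredError.lintegral_prod_left'
      rw [← lintegral_const_mul _ hmx]
      -- Each output a of the given decoder serves as a constant predictor; the bound is averaged
      -- over a.
      calc ∫⁻ x, ∫⁻ z, squaredError x z ∂(codeSource Γ).condKernel q ∂(codeSource Γ).condKernel q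
          = ∫⁻ _ : EuclideanSpace ℝ (Fin k), ∫⁻ x, ∫⁻ z, squaredError x z
              ∂(codeSource Γ).condKernel q ∂(codeSource Γ).condKernel q ∂K q := by simp
        _ ≤ _ := lintegral_mono fun a => lintegral_lintegral_squaredError_self_le _ a
    · simp [hq]
  · exact ENNReal.ofNat_ne_top

lemma meets_posterior {s : Sense}
    {d : Measure (EuclideanSpace ℝ (Fin k)) → Measure (EuclideanSpace ℝ (Fin k)) → ℝ≥0∞}
    (hd : IsDivergence d) {D : ℝ≥0∞} {Γ : Measure ((𝒴 × EuclideanSpace ℝ (Fin k)) × 𝒵)}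
    [IsProbabilityMeasure Γ] {K : Kernel (𝒴 × 𝒵) (EuclideanSpace ℝ (Fin k))} [IsMarkovKernel K]
    (h : s.AtMost (decodeLaw Γ K).fst (condDistortion squaredError (decodeLaw Γ K)) (D / 2)) :
    Meets s squaredError d D 0 (decodeLaw Γ (codeSource Γ).condKernel) := by
  refine ⟨?_, atMost_condPerception_zero hd ?_⟩
  · rw [fst_decodeLaw] at h ⊢
    exact (h.const_mul 2).mono condDistortion_posterior_le
      (ENNReal.mul_div_cancel two_ne_zero ENNReal.ofNat_ne_top).le
  · rw [map_source_decodeLaw, map_recon_decodeLaw_condKernel]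

/-- The old reconstruction plays the part of the code and a posterior draw replaces it. The new
reconstruction is a degraded version of the old one, so the information cannot grow. -/
lemma rdcpFunction_zero_le {ν : Measure (𝒴 × EuclideanSpace ℝ (Fin k))} [IsProbabilityMeasure ν]
    {s : Sense}
    {d : Measure (EuclideanSpace ℝ (Fin k)) → Measure (EuclideanSpace ℝ (Fin k)) → ℝ≥0∞}
    (hd : IsDivergence d) (D : ℝ≥0∞) :
    rdcpFunction s squaredError d ν D 0 ≤ rdcpFunction s squaredError d ν (D / 2) ∞ := by
  refine le_iInf fun κ => le_iInf fun hκ => le_iInf fun hm => ?_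
  set γ := tripleLaw ν κ
  have hγ : γ.map (fun t => (t.1, t.2.1)) = ν := map_source_tripleLaw ν κ
  let Γ : Measure ((𝒴 × EuclideanSpace ℝ (Fin k)) × EuclideanSpace ℝ (Fin k)) :=
    γ.map fun t => ((t.1, t.2.1), t.2.2)
  have : IsProbabilityMeasure Γ :=
    Measure.isProbabilityMeasure_map (Measurable.aemeasurable (by fun_prop))
  have hΓ : Γ.fst = ν := by
    rw [← hγ, Measure.fst, Measure.map_map (by fun_prop) (by fun_prop)]; rfl
  have hdec : decodeLaw Γ (Kernel.deterministic Prod.snd measurable_snd) = γ := by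
    refine Measure.ext_of_lintegral _ fun h hh => ?_
    rw [lintegral_decodeLaw hh]
    simp only [Kernel.deterministic_apply, lintegral_dirac]
    rw [lintegral_map (by fun_prop) (by fun_prop)]
  set C := (codeSource Γ).condKernel
  have hm' : Meets s squaredError d D 0 (decodeLaw Γ C) := by
    refine meets_posterior hd (K := Kernel.deterministic Prod.snd measurable_snd) ?_
    rw [condDistortion_congr squaredError hdec, hdec]
    exact hm.1
  have hγ' : (decodeLaw Γ C).map (fun t => (t.1, t.2.1)) = ν := map_source_decodeLaw.trans hΓ
  refine (rdcpFunction_le hγ' hm').trans ?_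
  rw [condMutualInfo_eq hγ', condMutualInfo_eq hγ]
  gcongr
  -- The posterior draw as a channel that ignores the source value. It carries both the old triple
  -- and its reference law to the new ones, so the divergence obeys data processing.
  let C' : Kernel (𝒴 × EuclideanSpace ℝ (Fin k) × EuclideanSpace ℝ (Fin k))
    (EuclideanSpace ℝ (Fin k)) := C.comap (fun t => (t.1, t.2.2)) (by fun_prop)
  have hC' : ∀ (τ : Measure (𝒴 × EuclideanSpace ℝ (Fin k) × EuclideanSpace ℝ (Fin k)))
      [IsProbabilityMeasure τ] (h : 𝒴 × EuclideanSpace ℝ (Fin k) × EuclideanSpace ℝ (Fin k) → ℝ≥0∞),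
      Measurable h → ∫⁻ t, h t ∂((τ ⊗ₘ C').map fun t => (t.1.1, t.1.2.1, t.2)) =
        ∫⁻ t, ∫⁻ z, h (t.1, t.2.1, z) ∂C (t.1, t.2.2) ∂τ := fun τ _ h hh => by
    rw [lintegral_map hh (by fun_prop), Measure.lintegral_compProd (by fun_prop)]
    rfl
  have h₁ : decodeLaw Γ C = (γ ⊗ₘ C').map fun t => (t.1.1, t.1.2.1, t.2) := by
    refine Measure.ext_of_lintegral _ fun h hh => ?_
    have hmz : Measurable fun t : (𝒴 × EuclideanSpace ℝ (Fin k)) × EuclideanSpace ℝ (Fin k) =>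
        ∫⁻ z, h (t.1.1, t.1.2, z) ∂C (t.1.1, t.2) := by
      have h' : Measurable fun r : ((𝒴 × EuclideanSpace ℝ (Fin k)) × EuclideanSpace ℝ (Fin k)) ×
          EuclideanSpace ℝ (Fin k) => h (r.1.1.1, r.1.1.2, r.2) := by fun_prop
      exact Measurable.lintegral_kernel_prod_right'
        (κ := C.comap (fun t => (t.1.1, t.2)) (by fun_prop)) h'
    rw [hC' γ h hh, lintegral_decodeLaw hh, lintegral_map hmz (by fun_prop)]
  have : IsProbabilityMeasure (indepLaw ν (reconGiven γ)) := by rw [indepLaw]; infer_instance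
  have h₂ : indepLaw ν (reconGiven (decodeLaw Γ C)) =
      (indepLaw ν (reconGiven γ) ⊗ₘ C').map fun t => (t.1.1, t.1.2.1, t.2) := by
    refine Measure.ext_of_lintegral _ fun h hh => ?_
    have hmz : Measurable fun t : 𝒴 × EuclideanSpace ℝ (Fin k) × EuclideanSpace ℝ (Fin k) =>
        ∫⁻ z, h (t.1, t.2.1, z) ∂C (t.1, t.2.2) := by
      have h' : Measurable fun r : (𝒴 × EuclideanSpace ℝ (Fin k) × EuclideanSpace ℝ (Fin k)) ×
          EuclideanSpace ℝ (Fin k) => h (r.1.1, r.1.2.1, r.2) := by fun_prop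
      exact Measurable.lintegral_kernel_prod_right' (κ := C') h'
    have hmx : Measurable fun t : 𝒴 × EuclideanSpace ℝ (Fin k) × EuclideanSpace ℝ (Fin k) =>
        ∫⁻ x, h (t.1, x, t.2.2) ∂ν.condKernel t.1 := by
      have h' : Measurable fun r : (𝒴 × EuclideanSpace ℝ (Fin k) × EuclideanSpace ℝ (Fin k)) ×
          EuclideanSpace ℝ (Fin k) => h (r.1.1, r.2, r.1.2.2) := by fun_prop
      exact Measurable.lintegral_kernel_prod_right'
        (κ := ν.condKernel.comap Prod.fst measurable_fst) h'
    rw [hC' _ h hh, lintegral_indepLaw_reconGiven hγ hmz, lintegral_indepLaw_reconGiven hγ' hh, h₁,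
      hC' _ _ hmx]
    refine lintegral_congr fun t => ?_
    exact lintegral_lintegral_swap (μ := C (t.1, t.2.2)) (ν := ν.condKernel t.1)
      (f := fun z x => h (t.1, x, z)) (by fun_prop)
  rw [h₂, h₁]
  refine (klDiv_map_le _ _ (by fun_prop)).trans ?_
  rw [klDiv_compProd_left]

end Resampling
-- Laws of code, source and reconstruction in a one-shot codec
section PosteriorCodec

variable {𝒴 𝒳 : Type*} [MeasurableSpace 𝒴] [MeasurableSpace 𝒳]

lemma OneShotCodec.codeSourceLaw_eq (c : OneShotCodec 𝒴 𝒳) (ν : Measure (𝒴 × 𝒳))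
    [IsProbabilityMeasure ν] : c.codeSourceLaw ν = codeSource (ν ⊗ₘ c.enc) := by
  rw [codeSourceLaw, codeSource,
    ← Measure.fst_compProd (ν ⊗ₘ c.enc) (c.dec.comap (fun t => (t.1.1, t.2)) (by fun_prop)),
    Measure.fst, Measure.map_map (by fun_prop) (by fun_prop)]
  rfl

lemma OneShotCodec.codeReconLaw_eq (c : OneShotCodec 𝒴 𝒳) (ν : Measure (𝒴 × 𝒳))
    [IsProbabilityMeasure ν] :
    c.codeReconLaw ν = (codeSource (ν ⊗ₘ c.enc)).fst ⊗ₘ c.dec := by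
  refine Measure.ext_of_lintegral _ fun h hh => ?_
  have hm : Measurable fun q => ∫⁻ z, h (q, z) ∂c.dec q := hh.lintegral_kernel_prod_right'
  rw [codeReconLaw, fullLaw, lintegral_map hh (by fun_prop),
    Measure.lintegral_compProd (by fun_prop), Measure.lintegral_compProd hh, Measure.fst,
    lintegral_map hm (by fun_prop), codeSource,
    lintegral_map (f := fun a : (𝒴 × List Bool) × 𝒳 => ∫⁻ z, h (a.1, z) ∂c.dec a.1)
      (hm.comp measurable_fst) (by fun_prop)]
  rfl

end PosteriorCodec

/-! ### Exchanging the roles of source and reconstruction -/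

section Reversal

variable {𝒴 𝒳 𝒵 : Type*} [MeasurableSpace 𝒴] [MeasurableSpace 𝒳] [MeasurableSpace 𝒵]

/-- The law of `((Y, X̂), Z)` when `((Y, X), Z)` has law `Γ` and `X̂` is drawn from
`p_{X̂|Y,Z} = K`. -/
noncomputable def reconCode (Γ : Measure ((𝒴 × 𝒳) × 𝒵)) (K : Kernel (𝒴 × 𝒵) 𝒳) :
    Measure ((𝒴 × 𝒳) × 𝒵) :=
  ((codeSource Γ).fst ⊗ₘ K).map fun q => ((q.1.1, q.2), q.1.2)

variable {Γ : Measure ((𝒴 × 𝒳) × 𝒵)} [IsProbabilityMeasure Γ] {K : Kernel (𝒴 × 𝒵) 𝒳}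
  [IsMarkovKernel K]

instance : IsProbabilityMeasure (reconCode Γ K) :=
  Measure.isProbabilityMeasure_map (Measurable.aemeasurable (by fun_prop))

lemma fst_reconCode : (reconCode Γ K).fst = (decodeLaw Γ K).map (fun t => (t.1, t.2.2)) := by
  rw [map_recon_decodeLaw, reconCode, Measure.fst, Measure.map_map (by fun_prop) (by fun_prop)]
  rfl

lemma lintegral_reconCode {h : (𝒴 × 𝒳) × 𝒵 → ℝ≥0∞} (hh : Measurable h) :
    ∫⁻ t, h t ∂reconCode Γ K = ∫⁻ q, ∫⁻ x, h ((q.1, x), q.2) ∂K q ∂(codeSource Γ).fst := by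
  rw [reconCode, lintegral_map hh (by fun_prop), Measure.lintegral_compProd (by fun_prop)]

lemma lintegral_fst_codeSource {h : 𝒴 × 𝒵 → ℝ≥0∞} (hh : Measurable h) :
    ∫⁻ q, h q ∂(codeSource Γ).fst = ∫⁻ t, h (t.1.1, t.2) ∂Γ := by
  rw [Measure.fst, lintegral_map hh (by fun_prop), codeSource,
    lintegral_map (f := fun a : (𝒴 × 𝒵) × 𝒳 => h a.1) (by fun_prop) (by fun_prop)]

/-- The exchange leaves the law of (Y, Z) alone, hence also the expected code length. -/
lemma lintegral_reconCode_side {h : 𝒴 × 𝒵 → ℝ≥0∞} (hh : Measurable h) :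
    ∫⁻ t, h (t.1.1, t.2) ∂reconCode Γ K = ∫⁻ t, h (t.1.1, t.2) ∂Γ := by
  rw [lintegral_reconCode (h := fun t => h (t.1.1, t.2)) (by fun_prop),
    ← lintegral_fst_codeSource hh]
  simp

/-- Of two encoders one may be used for the values of the side information in `A` and the other
one for the rest; codewords outside the codebook that occur with probability zero are avoided. -/
lemma exists_kernel_select {ν : Measure (𝒴 × 𝒳)} [IsProbabilityMeasure ν]
    {κ κ' : Kernel (𝒴 × 𝒳) 𝒵} [IsMarkovKernel κ] [IsMarkovKernel κ'] {C : 𝒴 → Set 𝒵}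
    (hκ : ∀ y x, ∀ᵐ z ∂κ (y, x), z ∈ C y) (hκ' : ∀ᵐ p ∂ν, ∀ᵐ z ∂κ' p, z ∈ C p.1)
    {A : Set 𝒴} (hA : MeasurableSet A) :
    ∃ κ₀ : Kernel (𝒴 × 𝒳) 𝒵, IsMarkovKernel κ₀ ∧ (∀ y x, ∀ᵐ z ∂κ₀ (y, x), z ∈ C y) ∧
      ∀ F : (𝒴 × 𝒳) × 𝒵 → ℝ≥0∞, Measurable F → ∫⁻ t, F t ∂(ν ⊗ₘ κ₀) =
        ∫⁻ t, A.indicator (fun _ => F t) t.1.1 ∂(ν ⊗ₘ κ) +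
          ∫⁻ t, Aᶜ.indicator (fun _ => F t) t.1.1 ∂(ν ⊗ₘ κ') := by
  classical
  -- The exceptional set need not be measurable, so its measurable hull, still null, is added to the
  -- domain of `κ`, which respects the codebook everywhere.
  set B := toMeasurable ν {p | ¬ ∀ᵐ z ∂κ' p, z ∈ C p.1} with hBdef
  have hB : MeasurableSet B := measurableSet_toMeasurable _ _
  have hB0 : ν B = 0 := by rw [hBdef, measure_toMeasurable]; exact hκ'
  have hU : MeasurableSet (Prod.fst ⁻¹' A ∪ B : Set (𝒴 × 𝒳)) := (measurable_fst hA).union hB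
  refine ⟨Kernel.piecewise hU κ κ', inferInstance, fun y x => ?_, fun F hF => ?_⟩
  · rw [Kernel.piecewise_apply]
    split_ifs with h
    · exact hκ y x
    · by_contra hn
      exact h (Or.inr (subset_toMeasurable ν {p | ¬ ∀ᵐ z ∂κ' p, z ∈ C p.1} hn))
  · have h₁ : Measurable fun t : (𝒴 × 𝒳) × 𝒵 => A.indicator (fun _ => F t) t.1.1 :=
      hF.indicator (measurable_fst.comp measurable_fst hA)
    have h₂ : Measurable fun t : (𝒴 × 𝒳) × 𝒵 => Aᶜ.indicator (fun _ => F t) t.1.1 :=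
      hF.indicator (measurable_fst.comp measurable_fst hA.compl)
    rw [Measure.lintegral_compProd hF, Measure.lintegral_compProd h₁,
      Measure.lintegral_compProd h₂, ← lintegral_add_left h₁.lintegral_kernel_prod_right']
    refine lintegral_congr_ae ?_
    have hB' : ∀ᵐ p ∂ν, p ∉ B := measure_eq_zero_iff_ae_notMem.1 hB0
    filter_upwards [hB'] with p hp
    rw [Kernel.piecewise_apply]
    by_cases hpA : p.1 ∈ A
    · have hpU : p ∈ (Prod.fst ⁻¹' A ∪ B : Set (𝒴 × 𝒳)) := Or.inl hpA
      simp [hpU, hpA]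
    · have hpU : p ∉ (Prod.fst ⁻¹' A ∪ B : Set (𝒴 × 𝒳)) := fun h => h.elim hpA hp
      rw [if_neg hpU]
      simp [hpA]

end Reversal

/-! ### Codewords of the reversed encoder -/

section Codebook

variable {𝒴 𝒳 𝒵 : Type*} [MeasurableSpace 𝒴] [MeasurableSpace 𝒳] [StandardBorelSpace 𝒳]
  [Nonempty 𝒳] [MeasurableSpace 𝒵] [Countable 𝒵] [DiscreteMeasurableSpace 𝒵]

/-- The reconstruction, used as a source, has a code in the codebook almost surely. The codebook
need not depend measurably on the side information. -/
lemma ae_reconCode_mem {ν : Measure (𝒴 × 𝒳)} [IsProbabilityMeasure ν] {κ : Kernel (𝒴 × 𝒳) 𝒵}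
    [IsMarkovKernel κ] {K : Kernel (𝒴 × 𝒵) 𝒳} [IsMarkovKernel K] {C : 𝒴 → Set 𝒵}
    (hκ : ∀ y x, ∀ᵐ z ∂κ (y, x), z ∈ C y) :
    ∃ N : Set (𝒴 × 𝒵), MeasurableSet N ∧ (∀ q ∈ N, q.2 ∈ C q.1) ∧
      ∀ᵐ t ∂reconCode (ν ⊗ₘ κ) K, (t.1.1, t.2) ∈ N := by
  -- The conditional probability of z given Y = y, measurable in (y, z). Where it is positive, z
  -- lies in the codebook of y, since otherwise every source value would give z probability zero.
  let w : 𝒴 × 𝒵 → ℝ≥0∞ := fun q => ∫⁻ x, κ (q.1, x) {q.2} ∂ν.condKernel q.1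
  have hwz : ∀ z, Measurable fun y => w (y, z) := fun z => by
    have h : Measurable fun p : 𝒴 × 𝒳 => κ p {z} := κ.measurable_coe (measurableSet_singleton z)
    exact h.lintegral_kernel_prod_right'
  have hw : Measurable w := measurable_from_prod_countable_left hwz
  have hN : MeasurableSet {q | w q ≠ 0} := (hw (measurableSet_singleton 0)).compl
  refine ⟨{q | w q ≠ 0}, hN, fun q hq => ?_, ?_⟩
  · by_contra hn
    refine hq ?_
    have : ∀ x, κ (q.1, x) {q.2} = 0 := fun x =>
      measure_mono_null (fun z hz => by rw [Set.mem_singleton_iff.1 hz]; exact hn) (hκ q.1 x)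
    simp [w, this]
  · have hind : Measurable (Set.indicator {q | w q ≠ 0}ᶜ (1 : 𝒴 × 𝒵 → ℝ≥0∞)) :=
      measurable_one.indicator hN.compl
    have key : ∀ᵐ t ∂(ν ⊗ₘ κ), w (t.1.1, t.2) ≠ 0 := by
      refine Measure.ae_compProd_of_ae_ae ?_ ?_
      · exact (hw.comp (f := fun t : (𝒴 × 𝒳) × 𝒵 => (t.1.1, t.2)) (by fun_prop)
          (measurableSet_singleton 0)).compl
      · have hS : ∀ᵐ p ∂ν, ∀ z, w (p.1, z) = 0 → κ p {z} = 0 := by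
          rw [ae_all_iff]
          intro z
          have hm : MeasurableSet {p : 𝒴 × 𝒳 | w (p.1, z) = 0 → κ p {z} = 0} := by
            have h₁ : MeasurableSet {p : 𝒴 × 𝒳 | w (p.1, z) = 0} :=
              ((hwz z).comp measurable_fst) (measurableSet_singleton 0)
            have h₂ : MeasurableSet {p : 𝒴 × 𝒳 | κ p {z} = 0} :=
              κ.measurable_coe (measurableSet_singleton z) (measurableSet_singleton 0)
            exact h₁.himp h₂
          rw [← ν.disintegrate ν.condKernel]
          refine Measure.ae_compProd_of_ae_ae hm (Filter.Eventually.of_forall fun y => ?_)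
          by_cases h0 : w (y, z) = 0
          · have hk : Measurable fun x => κ (y, x) {z} :=
              (κ.measurable_coe (measurableSet_singleton z)).comp measurable_prodMk_left
            filter_upwards [(lintegral_eq_zero_iff hk).1 h0] with x hx _ using hx
          · exact Filter.Eventually.of_forall fun x h => absurd h h0
        filter_upwards [hS] with p hp
        rw [ae_iff_of_countable]
        intro z hz h0
        exact hz (hp z h0)
    rw [ae_iff, ← lintegral_indicator_one]
    · have := lintegral_reconCode_side (Γ := ν ⊗ₘ κ) (K := K) hind
      refine Eq.trans this ?_
      refine lintegral_eq_zero_of_ae_eq_zero ?_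
      filter_upwards [key] with t ht
      simp [ht]
    · exact ((by fun_prop : Measurable fun t : (𝒴 × 𝒳) × 𝒵 => (t.1.1, t.2)) hN).compl

end Codebook
-- Mean decoders, halving of the distortion, and optimality
section Means

variable {𝒴 𝒵 : Type*} [MeasurableSpace 𝒴] [MeasurableSpace 𝒵] {k : ℕ}

/-- The decoder that returns the mean of the kernel `K`. -/
noncomputable def meanDecoder (K : Kernel (𝒴 × 𝒵) (EuclideanSpace ℝ (Fin k))) [IsMarkovKernel K] :
    Kernel (𝒴 × 𝒵) (EuclideanSpace ℝ (Fin k)) :=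
  Kernel.deterministic (fun q => ∫ x, x ∂K q)
    (StronglyMeasurable.integral_kernel (f := fun x => x) (κ := K) stronglyMeasurable_id).measurable

variable {Γ : Measure ((𝒴 × EuclideanSpace ℝ (Fin k)) × 𝒵)} [IsProbabilityMeasure Γ]
  {K : Kernel (𝒴 × 𝒵) (EuclideanSpace ℝ (Fin k))} [IsMarkovKernel K]

instance : IsMarkovKernel (meanDecoder K) := by unfold meanDecoder; infer_instance

lemma lintegral_meanDecoder {h : 𝒴 × EuclideanSpace ℝ (Fin k) × EuclideanSpace ℝ (Fin k) → ℝ≥0∞}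
    (hh : Measurable h) :
    ∫⁻ t, h t ∂decodeLaw Γ (meanDecoder K) =
      ∫⁻ t, h (t.1.1, t.1.2, ∫ x, x ∂K (t.1.1, t.2)) ∂Γ := by
  rw [lintegral_decodeLaw hh]
  refine lintegral_congr fun t => ?_
  rw [meanDecoder, Kernel.deterministic_apply, lintegral_dirac' _ (by fun_prop)]

/-- Decoding the code to the mean of the source, or to the mean of the reconstruction when the
roles of source and reconstruction are exchanged: the squared errors add up to at most the
original one. -/
lemma condDistortion_mean_add_le (h : (reconCode Γ K).fst = Γ.fst) :
    ∀ᵐ y ∂Γ.fst.fst,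
      condDistortion squaredError (decodeLaw Γ (meanDecoder (codeSource Γ).condKernel)) y +
        condDistortion squaredError (decodeLaw (reconCode Γ K) (meanDecoder K)) y ≤
      condDistortion squaredError (decodeLaw Γ K) y := by
  have h₁ := fst_decodeLaw (Γ := Γ) (K := meanDecoder (codeSource Γ).condKernel)
  have h₂ := fst_decodeLaw (Γ := reconCode Γ K) (K := meanDecoder K)
  have h₃ := fst_decodeLaw (Γ := Γ) (K := K)
  rw [h] at h₂
  have m₁ := measurable_condDistortion (measurable_squaredError (k := k))
    (decodeLaw Γ (meanDecoder (codeSource Γ).condKernel))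
  have m₂ := measurable_condDistortion (measurable_squaredError (k := k))
    (decodeLaw (reconCode Γ K) (meanDecoder K))
  refine ae_le_of_forall_setLIntegral_le_of_sigmaFinite (m₁.add m₂) fun A hA _ => ?_
  have hm := measurable_indicator_squaredError (k := k) hA
  have e₁ := setLIntegral_condDistortion (measurable_squaredError (k := k))
    (decodeLaw Γ (meanDecoder (codeSource Γ).condKernel)) hA
  have e₂ := setLIntegral_condDistortion (measurable_squaredError (k := k))
    (decodeLaw (reconCode Γ K) (meanDecoder K)) hA
  have e₃ := setLIntegral_condDistortion (measurable_squaredError (k := k)) (decodeLaw Γ K) hA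
  rw [h₁] at e₁
  rw [h₂] at e₂
  rw [h₃] at e₃
  have hmean : Measurable fun q : 𝒴 × 𝒵 => ∫ x, x ∂K q :=
    (StronglyMeasurable.integral_kernel (f := fun x => x) (κ := K)
      stronglyMeasurable_id).measurable
  have hmB : Measurable fun t : (𝒴 × EuclideanSpace ℝ (Fin k)) × 𝒵 =>
      A.indicator (fun _ => squaredError t.1.2 (∫ x, x ∂K (t.1.1, t.2))) t.1.1 := by
    have hr : Measurable fun t : (𝒴 × EuclideanSpace ℝ (Fin k)) × 𝒵 =>
        (t.1.1, t.1.2, ∫ x, x ∂K (t.1.1, t.2)) := by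
      have := hmean.comp (f := fun t : (𝒴 × EuclideanSpace ℝ (Fin k)) × 𝒵 => (t.1.1, t.2))
        (by fun_prop)
      exact (by fun_prop : Measurable fun t : (𝒴 × EuclideanSpace ℝ (Fin k)) × 𝒵 =>
        t.1.1).prodMk ((by fun_prop : Measurable fun t : (𝒴 × EuclideanSpace ℝ (Fin k)) × 𝒵 =>
        t.1.2).prodMk this)
    exact hm.comp hr
  have hmA : Measurable fun q : 𝒴 × 𝒵 => ∫⁻ x, A.indicator (fun _ => squaredError x
      (∫ z, z ∂K q)) q.1 ∂K q := by
    have h' : Measurable fun r : (𝒴 × 𝒵) × EuclideanSpace ℝ (Fin k) =>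
        A.indicator (fun _ => squaredError r.2 (∫ z, z ∂K r.1)) r.1.1 :=
      hmB.comp (g := fun t : (𝒴 × EuclideanSpace ℝ (Fin k)) × 𝒵 =>
        A.indicator (fun _ => squaredError t.1.2 (∫ x, x ∂K (t.1.1, t.2))) t.1.1)
        (f := fun r : (𝒴 × 𝒵) × EuclideanSpace ℝ (Fin k) => ((r.1.1, r.2), r.1.2)) (by fun_prop)
    exact h'.lintegral_kernel_prod_right'
  beta_reduce
  rw [lintegral_add_left m₁, e₁, e₂, e₃, lintegral_decodeLaw_eq hm, lintegral_meanDecoder hm,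
    lintegral_reconCode hmB, lintegral_decodeLaw_eq hm, ← lintegral_add_right _ hmA]
  refine lintegral_mono fun q => ?_
  by_cases hq : q.1 ∈ A
  · have : ∀ x : EuclideanSpace ℝ (Fin k), ∫⁻ z, squaredError x z
        ∂meanDecoder (codeSource Γ).condKernel q =
          squaredError x (∫ z, z ∂(codeSource Γ).condKernel q) := fun x => by
      rw [meanDecoder, Kernel.deterministic_apply, lintegral_dirac]
    simp only [Set.indicator_of_mem hq, this]
    exact lintegral_squaredError_mean_add_le _ _
  · simp [hq]

/-- A choice, by the value of the side information, between two encoders and two decoders. -/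
lemma lintegral_decodeLaw_select {𝒳 : Type*} [MeasurableSpace 𝒳] {Γ Γ₁ Γ₂ : Measure ((𝒴 × 𝒳) × 𝒵)}
    [IsProbabilityMeasure Γ] [IsProbabilityMeasure Γ₁] [IsProbabilityMeasure Γ₂]
    {K₁ K₂ : Kernel (𝒴 × 𝒵) 𝒳} [IsMarkovKernel K₁] [IsMarkovKernel K₂] {A : Set 𝒴}
    [DecidablePred (· ∈ (Prod.fst ⁻¹' A : Set (𝒴 × 𝒵)))]
    (hA : MeasurableSet A)
    (hΓ : ∀ F : (𝒴 × 𝒳) × 𝒵 → ℝ≥0∞, Measurable F → ∫⁻ t, F t ∂Γ =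
      ∫⁻ t, A.indicator (fun _ => F t) t.1.1 ∂Γ₁ + ∫⁻ t, Aᶜ.indicator (fun _ => F t) t.1.1 ∂Γ₂)
    {h : 𝒴 × 𝒳 × 𝒳 → ℝ≥0∞} (hh : Measurable h) :
    ∫⁻ t, h t ∂decodeLaw Γ (Kernel.piecewise (measurable_fst hA) K₁ K₂) =
      ∫⁻ t, A.indicator (fun _ => h t) t.1 ∂decodeLaw Γ₁ K₁ +
        ∫⁻ t, Aᶜ.indicator (fun _ => h t) t.1 ∂decodeLaw Γ₂ K₂ := by
  have hF : Measurable fun t : (𝒴 × 𝒳) × 𝒵 => ∫⁻ z, h (t.1.1, t.1.2, z)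
      ∂Kernel.piecewise (measurable_fst hA) K₁ K₂ (t.1.1, t.2) := by
    have h' : Measurable fun r : ((𝒴 × 𝒳) × 𝒵) × 𝒳 => h (r.1.1.1, r.1.1.2, r.2) := by fun_prop
    exact Measurable.lintegral_kernel_prod_right' (κ := (Kernel.piecewise (measurable_fst hA)
      K₁ K₂).comap (fun t => (t.1.1, t.2)) (by fun_prop)) h'
  have h₁ : Measurable fun t : 𝒴 × 𝒳 × 𝒳 => A.indicator (fun _ => h t) t.1 :=
    hh.indicator (measurable_fst hA)
  have h₂ : Measurable fun t : 𝒴 × 𝒳 × 𝒳 => Aᶜ.indicator (fun _ => h t) t.1 :=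
    hh.indicator (measurable_fst hA.compl)
  rw [lintegral_decodeLaw hh, hΓ _ hF, lintegral_decodeLaw h₁, lintegral_decodeLaw h₂]
  congr 1
  · refine lintegral_congr fun t => ?_
    by_cases ht : t.1.1 ∈ A <;> simp [ht, Kernel.piecewise_apply]
  · refine lintegral_congr fun t => ?_
    by_cases ht : t.1.1 ∈ A <;> simp [ht, Kernel.piecewise_apply]

lemma min_le_half_of_add_le {a b c : ℝ≥0∞} (h : a + b ≤ c) : min a b ≤ 2⁻¹ * c := by
  rw [← ENNReal.div_eq_inv_mul, ENNReal.le_div_iff_mul_le (by simp) (by simp), mul_two]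
  exact (add_le_add (min_le_left a b) (min_le_right a b)).trans h

/-- A codec with perfect conditional perceptual quality can be replaced by one of the same rate
and at most half the squared error. -/
lemma exists_codec_half_distortion {ν : Measure (𝒴 × EuclideanSpace ℝ (Fin k))}
    [IsProbabilityMeasure ν] {s : Sense}
    {d : Measure (EuclideanSpace ℝ (Fin k)) → Measure (EuclideanSpace ℝ (Fin k)) → ℝ≥0∞}
    (hd : IsDivergence d) {D : ℝ≥0∞} {c : OneShotCodec 𝒴 (EuclideanSpace ℝ (Fin k))}
    (hc : Meets s squaredError d D 0 (c.law ν)) :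
    ∃ c' : OneShotCodec 𝒴 (EuclideanSpace ℝ (Fin k)), c'.rate ν = c.rate ν ∧
      Meets s squaredError d (D / 2) ∞ (c'.law ν) := by
  classical
  set Γ := ν ⊗ₘ c.enc with hΓ
  set K := c.dec with hK
  have hΓν : Γ.fst = ν := Measure.fst_compProd _ _
  have hlaw : c.law ν = decodeLaw Γ K := rfl
  have : IsProbabilityMeasure (c.law ν) := by rw [hlaw]; infer_instance
  -- Perfect perception: (Y, X̂) has the law of the source, so the conditional law of M given (Y,
  -- X̂) can encode the source as well.
  have hB : (reconCode Γ K).fst = ν := by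
    rw [fst_reconCode, ← hlaw, ← map_source_eq_map_recon_of_condPerception_zero hd _ hc.2, hlaw,
      map_source_decodeLaw, hΓν]
  set κ := (reconCode Γ K).condKernel
  have hκ : ν ⊗ₘ κ = reconCode Γ K := by
    rw [← hB]; exact (reconCode Γ K).disintegrate _
  set K₁ := meanDecoder (codeSource Γ).condKernel
  set K₂ := meanDecoder K
  set a := condDistortion squaredError (decodeLaw Γ K₁)
  set b := condDistortion squaredError (decodeLaw (reconCode Γ K) K₂)
  have ha : Measurable a := measurable_condDistortion measurable_squaredError _
  have hb : Measurable b := measurable_condDistortion measurable_squaredError _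
  -- The better codec is chosen separately for each y, so the halved bound holds for almost every y
  -- and not just on average.
  have hA : MeasurableSet {y | a y ≤ b y} := measurableSet_le ha hb
  set A := {y | a y ≤ b y} with hAdef
  obtain ⟨N, hN, hNC, hNae⟩ := ae_reconCode_mem (ν := ν) (K := K) c.enc_mem
  have hκC : ∀ᵐ p ∂ν, ∀ᵐ m ∂κ p, m ∈ c.codebook p.1 := by
    have hNae' : ∀ᵐ t ∂(ν ⊗ₘ κ), (t.1.1, t.2) ∈ N := by rw [hκ]; exact hNae
    filter_upwards [Measure.ae_ae_of_ae_compProd hNae'] with p hp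
    exact hp.mono fun m hm => hNC _ hm
  obtain ⟨κ₀, hκ₀, hκ₀C, hκ₀F⟩ := exists_kernel_select c.enc_mem hκC hA
  simp only [hκ, ← hΓ] at hκ₀F
  refine ⟨⟨κ₀, Kernel.piecewise (measurable_fst hA) K₁ K₂, hκ₀, inferInstance, c.codebook,
    c.uniquelyDecodable, hκ₀C⟩, ?_, ?_, Sense.atMost_top⟩
  · have hlen : Measurable fun q : 𝒴 × List Bool => Aᶜ.indicator
        (fun _ => (q.2.length : ℝ≥0∞)) q.1 := by
      have : Measurable fun q : 𝒴 × List Bool => (q.2.length : ℝ≥0∞) :=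
        (measurable_of_countable (fun m : List Bool => (m.length : ℝ≥0∞))).comp measurable_snd
      exact this.indicator (measurable_fst hA.compl)
    have hlen' : Measurable fun t : (𝒴 × EuclideanSpace ℝ (Fin k)) × List Bool =>
        (t.2.length : ℝ≥0∞) :=
      (measurable_of_countable (fun m : List Bool => (m.length : ℝ≥0∞))).comp measurable_snd
    have hlenA : Measurable fun t : (𝒴 × EuclideanSpace ℝ (Fin k)) × List Bool =>
        A.indicator (fun _ => (t.2.length : ℝ≥0∞)) t.1.1 :=
      hlen'.indicator (measurable_fst.comp measurable_fst hA)
    change ∫⁻ t, (t.2.length : ℝ≥0∞) ∂(ν ⊗ₘ κ₀) = ∫⁻ t, (t.2.length : ℝ≥0∞) ∂Γ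
    rw [hκ₀F _ hlen', lintegral_reconCode_side hlen, ← lintegral_add_left hlenA]
    refine lintegral_congr fun t => ?_
    by_cases ht : t.1.1 ∈ A <;> simp [ht]
  · set Γ₀ := ν ⊗ₘ κ₀
    change s.AtMost (decodeLaw Γ₀ _).fst (condDistortion squaredError (decodeLaw Γ₀ _)) (D / 2)
    have hfst₀ := fst_decodeLaw (Γ := Γ₀) (K := Kernel.piecewise (measurable_fst hA) K₁ K₂)
    have hfst₁ := fst_decodeLaw (Γ := Γ) (K := K₁)
    have hfst₂ := fst_decodeLaw (Γ := reconCode Γ K) (K := K₂)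
    rw [hΓν] at hfst₁
    rw [hB] at hfst₂
    rw [Measure.fst_compProd] at hfst₀
    have hD : s.AtMost ν.fst (condDistortion squaredError (decodeLaw Γ K)) D := by
      have := hc.1
      rwa [condDistortion_congr squaredError hlaw, hlaw, fst_decodeLaw, hΓν] at this
    have hle : ∀ᵐ y ∂(decodeLaw Γ₀ (Kernel.piecewise (measurable_fst hA) K₁ K₂)).fst,
        condDistortion squaredError
          (decodeLaw Γ₀ (Kernel.piecewise (measurable_fst hA) K₁ K₂)) y ≤ min (a y) (b y) := by
      refine ae_condDistortion_le measurable_squaredError fun S hS => ?_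
      have hm := measurable_indicator_squaredError (k := k) hS
      rw [lintegral_decodeLaw_select hA hκ₀F hm, hfst₀]
      have e₁ := setLIntegral_condDistortion (measurable_squaredError (k := k))
        (decodeLaw Γ K₁) (hS.inter hA)
      have e₂ := setLIntegral_condDistortion (measurable_squaredError (k := k))
        (decodeLaw (reconCode Γ K) K₂) (hS.diff hA)
      rw [hfst₁] at e₁
      rw [hfst₂] at e₂
      have i₁ : ∀ t : 𝒴 × EuclideanSpace ℝ (Fin k) × EuclideanSpace ℝ (Fin k),
          A.indicator (fun _ => S.indicator (fun _ => squaredError t.2.1 t.2.2) t.1) t.1 =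
            (S ∩ A).indicator (fun _ => squaredError t.2.1 t.2.2) t.1 := fun t => by
        by_cases h₁ : t.1 ∈ A <;> by_cases h₂ : t.1 ∈ S <;> simp [h₁, h₂]
      have i₂ : ∀ t : 𝒴 × EuclideanSpace ℝ (Fin k) × EuclideanSpace ℝ (Fin k),
          Aᶜ.indicator (fun _ => S.indicator (fun _ => squaredError t.2.1 t.2.2) t.1) t.1 =
            (S \ A).indicator (fun _ => squaredError t.2.1 t.2.2) t.1 := fun t => by
        by_cases h₁ : t.1 ∈ A <;> by_cases h₂ : t.1 ∈ S <;> simp [h₁, h₂]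
      rw [lintegral_congr i₁, lintegral_congr i₂, ← e₁, ← e₂,
        ← lintegral_inter_add_sdiff (fun y => min (a y) (b y)) S hA]
      refine (congrArg₂ _ ?_ ?_).le
      · exact setLIntegral_congr_fun (hS.inter hA) fun y hy => (min_eq_left hy.2).symm
      · exact setLIntegral_congr_fun (hS.diff hA) fun y hy => (min_eq_right (not_le.1 hy.2).le).symm
    rw [hfst₀] at hle ⊢
    refine (hD.const_mul 2⁻¹).mono ?_ (ENNReal.div_eq_inv_mul).ge
    have hadd := condDistortion_mean_add_le (hB.trans hΓν.symm)
    rw [hΓν] at hadd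
    filter_upwards [hle, hadd] with y h₁ h₂
    exact h₁.trans (min_le_half_of_add_le h₂)

/-- The codec with the same encoder whose decoder draws the reconstruction from the posterior law
of the source. -/
noncomputable def OneShotCodec.withPosterior (c : OneShotCodec 𝒴 (EuclideanSpace ℝ (Fin k)))
    (ν : Measure (𝒴 × EuclideanSpace ℝ (Fin k))) [IsProbabilityMeasure ν] :
    OneShotCodec 𝒴 (EuclideanSpace ℝ (Fin k)) :=
  { c with
    dec := (codeSource (ν ⊗ₘ c.enc)).condKernel
    isMarkovKernel_dec := inferInstance }

lemma OneShotCodec.codeReconLaw_withPosterior (c : OneShotCodec 𝒴 (EuclideanSpace ℝ (Fin k)))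
    (ν : Measure (𝒴 × EuclideanSpace ℝ (Fin k))) [IsProbabilityMeasure ν] :
    (c.withPosterior ν).codeReconLaw ν = c.codeSourceLaw ν := by
  rw [codeReconLaw_eq, codeSourceLaw_eq]
  exact (codeSource (ν ⊗ₘ c.enc)).disintegrate (codeSource (ν ⊗ₘ c.enc)).condKernel

lemma condKernel_congr {𝒳 : Type*} [MeasurableSpace 𝒳] [StandardBorelSpace 𝒳] [Nonempty 𝒳]
    {ρ ρ' : Measure (𝒴 × 𝒳)} [IsFiniteMeasure ρ] [IsFiniteMeasure ρ'] (h : ρ = ρ') :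
    ρ.condKernel = ρ'.condKernel := by
  subst h
  rfl

/-- Every competitor for (D, 0) yields one of equal rate for (D / 2, ∞), while the posterior decoder
leaves the rate of `c` unchanged. -/
lemma OneShotCodec.isOptimal_withPosterior {ν : Measure (𝒴 × EuclideanSpace ℝ (Fin k))}
    [IsProbabilityMeasure ν] {s : Sense}
    {d : Measure (EuclideanSpace ℝ (Fin k)) → Measure (EuclideanSpace ℝ (Fin k)) → ℝ≥0∞}
    (hd : IsDivergence d) {D : ℝ≥0∞} {c : OneShotCodec 𝒴 (EuclideanSpace ℝ (Fin k))}
    (h : c.IsOptimal s squaredError d ν (D / 2) ∞) :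
    (c.withPosterior ν).IsOptimal s squaredError d ν D 0 := by
  refine ⟨meets_posterior hd (K := c.dec) h.1.1, fun c₁ h₁ => ?_⟩
  obtain ⟨c₂, hrate, h₂⟩ := exists_codec_half_distortion hd h₁
  exact (h.2 c₂ h₂).trans hrate.le

end Means
end RDCP

open RDCP in
theorem theorem2
    {𝒴 : Type*} [MeasurableSpace 𝒴] [StandardBorelSpace 𝒴]
    {𝒳 : Type*} [MeasurableSpace 𝒳] [StandardBorelSpace 𝒳] [Nonempty 𝒳]
    (μ : Measure (𝒴 × 𝒳)) [IsProbabilityMeasure μ]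
    (Δ : 𝒳 → 𝒳 → ℝ≥0∞) (hΔ : Measurable (Function.uncurry Δ))
    (d : Measure 𝒳 → Measure 𝒳 → ℝ≥0∞) (hd : IsDivergence d) (s : Sense) :
    -- (1) monotonicity and convexity
    (∀ D D' P P' : ℝ≥0∞, D ≤ D' → P ≤ P' →
      rdcpFunction s Δ d μ D' P' ≤ rdcpFunction s Δ d μ D P) ∧
    (ConvexInSecond d →
      ConvexOn ℝ≥0 Set.univ fun q : ℝ≥0∞ × ℝ≥0∞ => rdcpFunction s Δ d μ q.1 q.2) ∧
    -- (2) one-shot achievability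
    (∀ (D P : ℝ≥0∞) (R : ℝ), rdcpFunction s Δ d μ D P ≠ ∞ →
      (rdcpFunction s Δ d μ D P).toReal +
        Real.logb 2 ((rdcpFunction s Δ d μ D P).toReal + 1) + 5 < R →
      ∃ c : SharedCodec 𝒴 𝒳 (List Bool), c.IsUniquelyDecodable ∧
        c.rate μ ≤ ENNReal.ofReal R ∧ Meets s Δ d D P (c.law μ)) ∧
    -- (3) asymptotic achievability by variable-length codes
    (∀ (D P : ℝ≥0∞) (R : ℝ≥0), rdcpFunction s Δ d μ D P < R →
      ∃ N : ℕ, ∀ n ≥ N, ∃ c : SharedCodec (Fin n → 𝒴) (Fin n → 𝒳) (List Bool),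
        c.IsUniquelyDecodable ∧ c.rate (iidSource μ n) ≤ n * R ∧
        ∀ i, Meets s Δ d D P (letterLaw (c.law (iidSource μ n)) i) ∧
          Meets s Δ d D P (letterBlockLaw (c.law (iidSource μ n)) i)) ∧
    -- asymptotic achievability by fixed-length codes
    ((∃ B : ℝ≥0, ∀ x x', Δ x x' ≤ B) → (s = Sense.average ∨ Finite 𝒴) →
      ∀ (D P : ℝ≥0∞) (R ε : ℝ≥0), rdcpFunction s Δ d μ D P < R → 0 < ε →
        ∃ N : ℕ, ∀ n ≥ N, ∃ m : ℕ, (m : ℝ) ≤ 2 ^ ((n : ℝ) * R) ∧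
          ∃ c : SharedCodec (Fin n → 𝒴) (Fin n → 𝒳) (Fin m),
            ∀ i, Meets s Δ d (D + ε) P (letterLaw (c.law (iidSource μ n)) i)) ∧
    -- converse, for fixed-length and for variable-length codes
    (ConvexInSecond d → ∀ (D P : ℝ≥0∞) (n : ℕ), 1 ≤ n →
      (∀ (m : ℕ) (c : SharedCodec (Fin n → 𝒴) (Fin n → 𝒳) (Fin m)),
        MeetsOnAverage s Δ d D P μ.fst (c.law (iidSource μ n)) →
        n * rdcpFunction s Δ d μ D P ≤ ENNReal.ofReal (Real.logb 2 m)) ∧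
      (∀ c : SharedCodec (Fin n → 𝒴) (Fin n → 𝒳) (List Bool), c.IsUniquelyDecodable →
        MeetsOnAverage s Δ d D P μ.fst (c.law (iidSource μ n)) →
        n * rdcpFunction s Δ d μ D P ≤ c.rate (iidSource μ n))) ∧
    -- (4) perfect conditional perceptual quality implies perfect perceptual quality
    (∀ (γ : Measure (𝒴 × 𝒳 × 𝒳)) [IsProbabilityMeasure γ],
      s.AtMost γ.fst (condPerception d γ) 0 →
      γ.map (fun t => t.2.1) = γ.map (fun t => t.2.2) ∧
        d (γ.map fun t => t.2.1) (γ.map fun t => t.2.2) = 0) ∧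
    -- (5) and (6): squared error
    (∀ (k : ℕ) (ν : Measure (𝒴 × EuclideanSpace ℝ (Fin k))) [IsProbabilityMeasure ν]
      (δ : Measure (EuclideanSpace ℝ (Fin k)) → Measure (EuclideanSpace ℝ (Fin k)) → ℝ≥0∞),
      IsDivergence δ → ∀ D : ℝ≥0∞,
      rdcpFunction s squaredError δ ν D 0 ≤ rdcpFunction s squaredError δ ν (D / 2) ∞ ∧
      ∀ c : OneShotCodec 𝒴 (EuclideanSpace ℝ (Fin k)),
        Meets s squaredError δ (D / 2) ∞ (c.law ν) →
        ∃ c₂ : OneShotCodec 𝒴 (EuclideanSpace ℝ (Fin k)),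
          c₂.enc = c.enc ∧ c₂.codebook = c.codebook ∧
          (∀ᵐ q ∂(c.codeSourceLaw ν).fst,
            (c₂.codeReconLaw ν).condKernel q = (c.codeSourceLaw ν).condKernel q) ∧
          Meets s squaredError δ D 0 (c₂.law ν) ∧
          (c.IsOptimal s squaredError δ ν (D / 2) ∞ →
            c₂.IsOptimal s squaredError δ ν D 0)) := by
  refine ⟨fun D D' P P' hD hP => rdcpFunction_anti hD hP,
    fun hconv => convexOn_rdcpFunction s Δ hconv μ,
    fun D P R hfin hR => exists_oneShot_codec hfin hR,
    fun D P R hR => exists_block_codec hR, ?_, ?_, fun γ _ h => ?_, ?_⟩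
  · rintro ⟨b, hb⟩ hs D P R ε hR hε
    exact exists_fixedLength_block_codec hΔ hb hs hR hε
  · intro hconv D P n hn
    have hn0 : n ≠ 0 := Nat.one_le_iff_ne_zero.1 hn
    exact ⟨fun m c hm => mul_rdcpFunction_le_logb hconv hn0 c hm,
      fun c hc hm => mul_rdcpFunction_le_rate hconv hn0 c hc hm⟩
  · have h' := map_eq_of_condPerception_zero hd γ h
    have := Measure.isProbabilityMeasure_map (μ := γ) (f := fun t => t.2.1)
      (Measurable.aemeasurable (by fun_prop))
    refine ⟨h', ?_⟩
    rw [← h']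
    exact (hd _ _).2 rfl
  · exact fun k ν _ δ hδ D => ⟨rdcpFunction_zero_le hδ D, fun c hc => ⟨c.withPosterior ν, rfl, rfl,
      Filter.Eventually.of_forall fun q => by
        rw [condKernel_congr (c.codeReconLaw_withPosterior ν)],
      meets_posterior hδ (K := c.dec) hc.1, c.isOptimal_withPosterior hδ⟩⟩
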